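/- Let $k\in\mathbb R\setminus\{0\}$, $N=B(0,2)\subset\mathbb R^3$, $N_1=B(0,2)\setminus\overline{B(0,1)}$, $N_2=B(0,1)$, $\Sigma=\partial B(0,1)$. Let $M$ be the disjoint union of $M_1=B(0,2)$ and $M_2=B(0,1)$ with the Euclidean metric $g$, and write $M\setminus\{0\}=(M_1\setminus\{0\})\sqcup M_2$. Let $F=(F_1,F_2):M\setminus\{0\}\to N\setminus\Sigma$, where $F_1(x)=(\tfrac{|x|}{2}+1)\tfrac{x}{|x|}$ maps $M_1\setminus\{0\}$ onto $N_1$ and $F_2=\mathrm{Id}:M_2\to N_2$. Put $\widetilde g=F_*g$ and $\widetilde\varepsilon^{jk}=\widetilde\mu^{jk}=|\widetilde g|^{1/2}\widetilde g^{jk}$ in $N_1$, $\widetilde\varepsilon^{jk}=\widetilde\mu^{jk}=\delta^{jk}$ in $N_2$. Identify 1-forms $E_jdx^j$ and 2-forms $D^1dx^2\wedge dx^3+D^2dx^3\wedge dx^1+D^3dx^1\wedge dx^2$ (with complex coefficients) with their components; $\nabla\times$ is the exterior derivative of 1-forms. Finite energy solutions on $N\setminus\Sigma$ with perfectly conducting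 cloaking surface. A pair of 1-forms $(\widetilde E,\widetilde H)$ is such a solution of $\nabla\times\widetilde E=ik\widetilde\mu\widetilde H$, $\nabla\times\widetilde H=-ik\widetilde\varepsilon\widetilde E+\widetilde J$ on $N\setminus\Sigma$, $\nu\times\widetilde E|_\Sigma=0$, if $\widetilde E,\widetilde H,\widetilde\varepsilon\widetilde E,\widetilde\mu\widetilde H$ have coefficients in $L^1(N,dx)$, $$\int_N\widetilde\varepsilon^{jk}\widetilde E_j\overline{\widetilde E_k}\,dx<\infty,\qquad \int_N\widetilde\mu^{jk}\widetilde H_j\overline{\widetilde H_k}\,dx<\infty,$$ and $$\int_N\big((\nabla\times\widetilde h)\cdot\widetilde E-ik\,\widetilde h\cdot\widetilde\mu\widetilde H\big)dx=0,\qquad \int_N\big((\nabla\times\widetilde e)\cdot\widetilde H+\widetilde e\cdot(ik\widetilde\varepsilon\widetilde E-\widetilde J)\big)dx=0$$ for all real 1-forms $\widetilde h,\widetilde e$ on $N$ whose restrictions to $N_1$ and to $N_2$ are $C^\infty$ up to the boundary, which vanish near $\partial N$, and where $\widetilde e$ (but not necessarily $\widetilde h$) satisfies $\nu\times\widetilde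 e|_\Sigma=0$ from both sides of $\Sigma$. Finite energy solutions on $M$. For $i=1,2$, a pair $(E,H)$ of 1-forms is a solution of $\nabla\times E=ikH$, $\nabla\times H=-ikE+J$ on $M_i$ if $E,H\in L^2(M_i)$ and the equations hold weakly, i.e. tested against 1-forms with components in $C_0^\infty(M_i)$. The condition $\nu\times E|_{\partial M_2}=0$ means that the weak tangential trace of $E$ vanishes: $\nabla\times E\in L^2(M_2)$ and $\int_{M_2}\big((\nabla\times h)\cdot E-h\cdot(\nabla\times E)\big)dx=0$ for all 1-forms $h$ smooth on $\overline{M_2}$. Theorem. Let $J$ and $\widetilde J$ be 2-forms with smooth coefficients on $M\setminus\{0\}$ and $N\setminus\Sigma$, supported away from $\{0\}$ and $\Sigma$ respectively, such that $\widetilde J=F_*J$. Let $E,H$ be 1-forms with measurable coefficients on $M\setminus\{0\}$ and $\widetilde E,\widetilde H$ 1-forms with measurable coefficients on $N\setminus\Sigma$ such that $\widetilde E=F_*E$, $\widetilde H=F_*H$. Then the following are equivalent: 1. $(\widetilde E,\widetilde H)$ is a finite energy solution of Maxwell's equations on $N\setminus\Sigma$ with perfectly conducting cloaking surface and current $\widetilde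 J$. 2. $(E,H)$ satisfies $\nabla\times E=ikH$, $\nabla\times H=-ikE+J$ on $M_1$ and on $M_2$, and $\nu\times E|_{\partial M_2}=0$. Moreover, $F_*$ is a bijection from the 1-forms with measurable coefficients on $M\setminus\{0\}$ onto those on $N\setminus\Sigma$, so the solutions in 1 and in 2 correspond one-to-one via $F$. -/

import Mathlib

open scoped ContDiff Matrix ComplexConjugate
open MeasureTheory

namespace Cloaking

/-! ### The spaces `M` and `N` -/

/-- Euclidean three-space. -/
abbrev Space : Type := EuclideanSpace ℝ (Fin 3)

/-- `N = B(0,2)`. -/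
def N : Set Space := Metric.ball 0 2

/-- The cloaking surface `∂B(0,1)`. -/
def cloakSurface : Set Space := Metric.sphere 0 1

/-- `N₁ = B(0,2) \ closure B(0,1)`. -/
def N₁ : Set Space := Metric.ball 0 2 \ Metric.closedBall 0 1

/-- `N₂ = B(0,1)`. -/
def N₂ : Set Space := Metric.ball 0 1

/-- `M₁ = B(0,2)`. -/
def M₁ : Set Space := Metric.ball 0 2

/-- `M₂ = B(0,1)`. -/
def M₂ : Set Space := Metric.ball 0 1

/-- `M \ {0} = (M₁ \ {0}) ⊔ M₂`, inside two disjoint copies of three-space. -/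
def puncturedM : Set (Space ⊕ Space) := Sum.inl '' (M₁ \ {0}) ∪ Sum.inr '' M₂

/-! ### The cloaking transformation -/

/-- `F₁(x) = (|x|/2 + 1) x/|x|`, from `M₁ \ {0}` onto `N₁`. -/
noncomputable def F₁ (x : Space) : Space := (‖x‖ / 2 + 1) • (‖x‖⁻¹ • x)

/-- `F = (F₁, id)`, from `M \ {0}` onto `N` minus the cloaking surface. -/
noncomputable def F : Space ⊕ Space → Space := Sum.elim F₁ id

/-- The inverse `y ↦ 2(|y| - 1) y/|y|` of `F₁`, from `N₁` onto `M₁ \ {0}`. -/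
noncomputable def G₁ (y : Space) : Space := (2 * (‖y‖ - 1)) • (‖y‖⁻¹ • y)

/-- The inverse of `F`. -/
noncomputable def G (y : Space) : Space ⊕ Space :=
  open Classical in if y ∈ N₁ then Sum.inl (G₁ y) else Sum.inr y

theorem norm_F₁ {x : Space} (hx : x ≠ 0) : ‖F₁ x‖ = ‖x‖ / 2 + 1 := by
  have h : 0 < ‖x‖ := norm_pos_iff.2 hx
  rw [F₁, norm_smul, norm_smul, norm_inv, norm_norm, inv_mul_cancel₀ h.ne', mul_one,
    Real.norm_of_nonneg (by positivity)]

theorem norm_G₁ {y : Space} (hy : 1 < ‖y‖) : ‖G₁ y‖ = 2 * (‖y‖ - 1) := by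
  have h : 0 < ‖y‖ := by linarith
  rw [G₁, norm_smul, norm_smul, norm_inv, norm_norm, inv_mul_cancel₀ h.ne', mul_one,
    Real.norm_of_nonneg (by linarith)]

theorem G₁_F₁ {x : Space} (hx : x ≠ 0) : G₁ (F₁ x) = x := by
  have h : 0 < ‖x‖ := norm_pos_iff.2 hx
  rw [G₁, norm_F₁ hx, F₁, smul_smul, smul_smul, smul_smul]
  have h2 : ‖x‖ / 2 + 1 ≠ 0 := by positivity
  convert one_smul ℝ x using 2
  field_simp
  ring

theorem F₁_G₁ {y : Space} (hy : 1 < ‖y‖) : F₁ (G₁ y) = y := by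
  have h : 0 < ‖y‖ := by linarith
  have h2 : 0 < ‖y‖ - 1 := by linarith
  rw [F₁, norm_G₁ hy, G₁, smul_smul, smul_smul, smul_smul]
  convert one_smul ℝ y using 2
  field_simp
  ring

/-- `G` is the two-sided inverse of `F`, as a map from `M \ {0}` to `N` minus the cloaking
surface. -/
theorem invOn_G_F : Set.InvOn G F puncturedM (N \ cloakSurface) ∧
    Set.MapsTo F puncturedM (N \ cloakSurface) ∧
    Set.MapsTo G (N \ cloakSurface) puncturedM := by
  refine ⟨⟨?_, ?_⟩, ?_, ?_⟩
  · rintro _ (⟨x, ⟨hx, hx0⟩, rfl⟩ | ⟨x, hx, rfl⟩)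
    · have hx0' : x ≠ 0 := hx0
      have h : 0 < ‖x‖ := norm_pos_iff.2 hx0'
      simp only [M₁, mem_ball_zero_iff] at hx
      have : F₁ x ∈ N₁ := by
        simp only [N₁, Set.mem_sdiff, mem_ball_zero_iff, mem_closedBall_zero_iff, norm_F₁ hx0']
        constructor <;> linarith
      simp [F, G, this, G₁_F₁ hx0']
    · simp only [M₂, mem_ball_zero_iff] at hx
      have : x ∉ N₁ := by
        simp only [N₁, Set.mem_sdiff, mem_closedBall_zero_iff, not_and, not_not]
        intro _; linarith
      simp [F, G, this]
  · rintro y ⟨hy, hys⟩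
    by_cases h : y ∈ N₁
    · have h1 : 1 < ‖y‖ := by
        simpa [N₁] using h.2
      simp [F, G, h, F₁_G₁ h1]
    · simp [F, G, h]
  · rintro _ (⟨x, ⟨hx, hx0⟩, rfl⟩ | ⟨x, hx, rfl⟩)
    · have hx0' : x ≠ 0 := hx0
      have h : 0 < ‖x‖ := norm_pos_iff.2 hx0'
      simp only [M₁, mem_ball_zero_iff] at hx
      simp only [F, Sum.elim_inl, N, cloakSurface, Set.mem_sdiff, mem_ball_zero_iff,
        mem_sphere_zero_iff_norm, norm_F₁ hx0']
      constructor
      · linarith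
      · intro h'; linarith
    · simp only [M₂, mem_ball_zero_iff] at hx
      simp only [F, Sum.elim_inr, id, N, cloakSurface, Set.mem_sdiff, mem_ball_zero_iff,
        mem_sphere_zero_iff_norm]
      constructor
      · linarith
      · intro h'; linarith
  · rintro y ⟨hy, hys⟩
    simp only [N, cloakSurface, mem_ball_zero_iff, mem_sphere_zero_iff_norm] at hy hys
    by_cases h : y ∈ N₁
    · have h1 : 1 < ‖y‖ := by simpa [N₁] using h.2
      have h2 : ‖G₁ y‖ = 2 * (‖y‖ - 1) := norm_G₁ h1
      simp only [G, h, if_true]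
      refine Or.inl ⟨G₁ y, ⟨?_, ?_⟩, rfl⟩
      · simp only [M₁, mem_ball_zero_iff, h2]; linarith
      · intro h0
        have h0' : G₁ y = 0 := h0
        rw [h0', norm_zero] at h2; linarith
    · simp only [G, h, if_false]
      refine Or.inr ⟨y, ?_, rfl⟩
      have : ‖y‖ ≤ 1 := by
        by_contra hc
        exact h (by simpa [N₁, hy] using hc)
      simp only [M₂, mem_ball_zero_iff]
      exact lt_of_le_of_ne this hys

/-! ### Forms, in Cartesian components

A complex 1-form `E = Eⱼ dxʲ` is given by its components `(E₁, E₂, E₃)`, and a complex 2-form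
`D = D¹ dx²∧dx³ + D² dx³∧dx¹ + D³ dx¹∧dx²` by its components `(D¹, D², D³)`. -/

/-- The Jacobian matrix `∂Φⁱ/∂xʲ`. -/
noncomputable def jac (Φ : Space → Space) (x : Space) : Matrix (Fin 3) (Fin 3) ℝ :=
  Matrix.of fun i j => fderiv ℝ Φ x (EuclideanSpace.single j 1) i

/-- The matrix of a real linear map, acting on complex components. -/
noncomputable def cmul (A : Matrix (Fin 3) (Fin 3) ℝ) (v : Fin 3 → ℂ) : Fin 3 → ℂ :=
  A.map (fun a : ℝ => (a : ℂ)) *ᵥ v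

/-- The push-forward `F_*E = (F⁻¹)^*E` of a 1-form on `M \ {0}`. On `N₁` it has the components
`∑ₚ ∂(F₁⁻¹)ᵖ/∂yʲ Eₚ(F₁⁻¹(y))`; on `N₂` the map `F` is the identity. -/
noncomputable def pushOneForm (E : Space ⊕ Space → Fin 3 → ℂ) (y : Space) : Fin 3 → ℂ :=
  open Classical in
  if y ∈ N₁ then cmul (jac G₁ y)ᵀ (E (Sum.inl (G₁ y))) else E (Sum.inr y)

/-- The push-forward `F_*J = (F⁻¹)^*J` of a 2-form on `M \ {0}`. The components of the pull-back of
a 2-form are given by the adjugate of the Jacobian matrix, see `pullback_two_form`. -/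
noncomputable def pushTwoForm (J : Space ⊕ Space → Fin 3 → ℂ) (y : Space) : Fin 3 → ℂ :=
  open Classical in
  if y ∈ N₁ then cmul (jac G₁ y).adjugate (J (Sum.inl (G₁ y))) else J (Sum.inr y)

/-- The 2-form with components `D` takes the value `D ⬝ (u × v)` on `(u, v)`. Its pull-back by a
linear map with matrix `A` takes the value `D ⬝ (Au × Av)`, so it has the components `adj(A) D`. -/
theorem pullback_two_form (A : Matrix (Fin 3) (Fin 3) ℂ) (D u v : Fin 3 → ℂ) :
    D ⬝ᵥ (crossProduct (A *ᵥ u) (A *ᵥ v)) = (A.adjugate *ᵥ D) ⬝ᵥ (crossProduct u v) := by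
  rw [Matrix.adjugate_fin_three]
  simp [cross_apply, Matrix.mulVec, dotProduct, Fin.sum_univ_three]
  ring

/-! ### The metric and the material parameters -/

/-- The push-forward by `F₁` of the Euclidean metric, a metric on `N₁`. -/
noncomputable def metricTilde (y : Space) : Matrix (Fin 3) (Fin 3) ℝ :=
  (jac G₁ y)ᵀ * jac G₁ y

/-- The permittivity and the permeability of the cloaking device: `|g̃|^{1/2} g̃^{jk}` in `N₁` and
`δ^{jk}` in `N₂`. -/
noncomputable def materialTilde (y : Space) : Matrix (Fin 3) (Fin 3) ℝ :=
  open Classical in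
  if y ∈ N₁ then Real.sqrt (metricTilde y).det • (metricTilde y)⁻¹ else 1

/-! ### Weak Maxwell equations -/

/-- The partial derivative `∂h_j/∂xⁱ` of a component of a real 1-form. -/
noncomputable def pd (i : Fin 3) (h : Space → Fin 3 → ℝ) (j : Fin 3) (x : Space) : ℝ :=
  fderiv ℝ h x (EuclideanSpace.single i 1) j

/-- The curl of a real 1-form, in components (the exterior derivative). -/
noncomputable def curl (h : Space → Fin 3 → ℝ) (x : Space) : Fin 3 → ℝ :=
  ![pd 1 h 2 x - pd 2 h 1 x, pd 2 h 0 x - pd 0 h 2 x, pd 0 h 1 x - pd 1 h 0 x]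

/-- The Euclidean product of real and complex components. -/
noncomputable def rdot (a : Fin 3 → ℝ) (b : Fin 3 → ℂ) : ℂ := ∑ j, (a j : ℂ) * b j

/-- The energy density `ε^{jk} Eⱼ conj(E_k)`. -/
noncomputable def energyDensity (ε : Space → Matrix (Fin 3) (Fin 3) ℝ) (E : Space → Fin 3 → ℂ)
    (x : Space) : ℂ :=
  ∑ j, ∑ k, (ε x j k : ℂ) * E x j * conj (E x k)

/-- Weak finite energy solutions on `U` of Maxwell's equations
`curl E = i k μ H`, `curl H = - i k ε E + J`, where the first equation is tested against the
1-forms in `testH` and the second one against the 1-forms in `testE`. -/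
structure IsFiniteEnergySolution (k : ℝ) (U : Set Space) (ε μ : Space → Matrix (Fin 3) (Fin 3) ℝ)
    (testE testH : Set (Space → Fin 3 → ℝ)) (E H J : Space → Fin 3 → ℂ) : Prop where
  integrable_E : IntegrableOn E U
  integrable_H : IntegrableOn H U
  integrable_D : IntegrableOn (fun x => cmul (ε x) (E x)) U
  integrable_B : IntegrableOn (fun x => cmul (μ x) (H x)) U
  energy_E : IntegrableOn (energyDensity ε E) U
  energy_H : IntegrableOn (energyDensity μ H) U
  faraday : ∀ h ∈ testH,
    ∫ x in U, (rdot (curl h x) (E x) - Complex.I * k * rdot (h x) (cmul (μ x) (H x))) = 0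
  ampere : ∀ e ∈ testE,
    ∫ x in U, (rdot (curl e x) (H x) +
      rdot (e x) ((Complex.I * k) • cmul (ε x) (E x) - J x)) = 0

/-- Real 1-forms with components in `C₀^∞(U)`. -/
def compactTests (U : Set Space) : Set (Space → Fin 3 → ℝ) :=
  {h | ContDiff ℝ ∞ h ∧ HasCompactSupport h ∧ tsupport h ⊆ U}

/-- Real 1-forms on `N` whose restrictions to `N₁` and to `N₂` are smooth up to the boundary, and
which vanish near the boundary of `N`. -/
def surfaceTests : Set (Space → Fin 3 → ℝ) :=
  {h | (∃ h₁ h₂ : Space → Fin 3 → ℝ, ContDiff ℝ ∞ h₁ ∧ ContDiff ℝ ∞ h₂ ∧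
          Set.EqOn h h₁ N₁ ∧ Set.EqOn h h₂ N₂) ∧
       ∃ r < (2 : ℝ), ∀ y ∈ N, r < ‖y‖ → h y = 0}

/-- The forms `e` in `surfaceTests` with `ν × e = 0` on the cloaking surface from both sides; the
unit normal of the cloaking surface at `y` is `y`. -/
def surfaceTestsPEC : Set (Space → Fin 3 → ℝ) :=
  {e | e ∈ surfaceTests ∧ ∀ y ∈ cloakSurface,
    Filter.Tendsto (fun x => crossProduct (WithLp.ofLp y) (e x)) (nhdsWithin y N₁) (nhds 0) ∧
    Filter.Tendsto (fun x => crossProduct (WithLp.ofLp y) (e x)) (nhdsWithin y N₂) (nhds 0)}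

/-- Finite energy solutions of Maxwell's equations on `N` minus the cloaking surface, with
perfectly conducting cloaking surface. -/
def IsSolutionN (k : ℝ) (E H J : Space → Fin 3 → ℂ) : Prop :=
  IsFiniteEnergySolution k (N \ cloakSurface) materialTilde materialTilde
    surfaceTestsPEC surfaceTests E H J

/-- The square integrable 1-form `C` (in components) is the weak curl of `E` in `U`. -/
def HasWeakCurl (U : Set Space) (E C : Space → Fin 3 → ℂ) : Prop :=
  ∀ h ∈ compactTests U, ∫ x in U, rdot (curl h x) (E x) = ∫ x in U, rdot (h x) (C x)

/-- `ν × E = 0` on the boundary of the bounded smooth domain `U`, for `E` with square integrable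
weak curl `C`: the trace `ν × E`, that is, the functional `h ↦ ∫ (h ⬝ C - curl h ⬝ E)` on forms `h`
smooth up to the boundary, vanishes. -/
def HasZeroTangentialTrace (U : Set Space) (E : Space → Fin 3 → ℂ) : Prop :=
  ∃ C : Space → Fin 3 → ℂ, MemLp C 2 (volume.restrict U) ∧ HasWeakCurl U E C ∧
    ∀ h : Space → Fin 3 → ℝ, ContDiff ℝ ∞ h →
      ∫ x in U, rdot (curl h x) (E x) = ∫ x in U, rdot (h x) (C x)

/-- Finite energy solutions of Maxwell's equations on `M₁`, with `ε = μ = 1`. -/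
def IsSolutionM₁ (k : ℝ) (E H J : Space → Fin 3 → ℂ) : Prop :=
  IsFiniteEnergySolution k M₁ (fun _ => 1) (fun _ => 1) (compactTests M₁) (compactTests M₁) E H J

/-- Finite energy solutions of Maxwell's equations on `M₂`, with `ε = μ = 1`, and with
`ν × E = 0` on the boundary. -/
def IsSolutionM₂ (k : ℝ) (E H J : Space → Fin 3 → ℂ) : Prop :=
  IsFiniteEnergySolution k M₂ (fun _ => 1) (fun _ => 1) (compactTests M₂) (compactTests M₂) E H J ∧
    HasZeroTangentialTrace M₂ E

/-- Measurability of the coefficients of a form on `M \ {0}`. -/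
def MeasurableOnM (E : Space ⊕ Space → Fin 3 → ℂ) : Prop :=
  AEStronglyMeasurable (E ∘ Sum.inl) (volume.restrict (M₁ \ {0})) ∧
    AEStronglyMeasurable (E ∘ Sum.inr) (volume.restrict M₂)

end Cloaking

/-!
The map `F` is a diffeomorphism from `M \ {0}` onto `N` minus the cloaking surface, and the
material tensors are made so that Maxwell's equations are transported by it: the curl is natural
under pull-back (`curl_pullback`), and multiplication by `ε̃ = μ̃` turns the push-forward of a
1-form into the push-forward of the corresponding 2-form (`cmul_materialTilde`). Hence, by a
change of variables, the energies agree, and the weak equations with test forms compactly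
supported in `N₁` are those with test forms compactly supported in `M₁ \ {0}`
(`forall_compactTests_N₁_iff`). On `N₂ = M₂` nothing changes but the boundary condition. What
remains is to compare the origin of `M₁` with the outer side of the cloaking surface, and the
boundary condition on `M₂` with its inner side.

*From `N` to `M`.* The map `F₁` blows up the origin to a sphere, and `Ẽ ∈ L¹` implies that `E/|x|`
is integrable near the origin (`integrableOn_inv_norm_mul_norm`). Cutoffs of the origin have
gradients of the order of `1/|x|`, so the weak equations extend over the origin
(`integral_pairing_M₁`). On `M₂`, the test forms in Faraday's law are free on the inner side of
the surface, which is the natural boundary condition `ν × E = 0`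
(`hasZeroTangentialTrace_of_integral_pairing`).

*From `M` to `N`.* Now the integrability of `Ẽ` and `H̃` has to be proved. It is more than finite
energy gives, and it comes from interior regularity. Near the origin there are no currents, so
`curl H = -ikE` with `k ≠ 0` shows that `E` is divergence free, with the square integrable curl
`ikH`. By the div-curl identity (`sum_integral_partialD_sq`), applied to mollifications of `E`,
the field `E` is in `H¹` near the origin, and Hardy's inequality (`hardy_regularized`) gives
`E/|x| ∈ L²` (`integrableOn_sq_div_norm_sq_of_weak_curl`). As the Jacobian determinant of `F₁⁻¹`
is comparable to `|x|²`, the components of `E ∘ F₁⁻¹` are integrable on `N₁`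
(`integrableOn_comp_G₁_of_div_norm_sq`), and so are those of `Ẽ`; the same holds for `H`. The weak
equations then extend from compactly supported test forms on `N₁` to all test forms smooth up to
the surface, since the tangential part of `Ẽ` is the product of `E ∘ F₁⁻¹` and a factor of the
order of the distance to the surface (`cross_jac_G₁`, `integral_pairing_N₁`): no boundary
condition is needed on the outer side. On the inner side, Faraday's law holds with free test forms
because the trace of `E` vanishes (`integral_pairing_of_hasZeroTangentialTrace`), and the Ampère
law holds because the tangential part of its test forms vanishes (`integral_pairing_N₂`).
-/

namespace Cloaking

/-! ### The Jacobian matrix of the cloaking map -/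

theorem mem_N₁ {y : Space} : y ∈ N₁ ↔ 1 < ‖y‖ ∧ ‖y‖ < 2 := by
  simp [N₁, and_comm]

theorem isOpen_N₁ : IsOpen N₁ := Metric.isOpen_ball.sdiff Metric.isClosed_closedBall

theorem hasFDerivAt_G₁ {y : Space} (hy : y ≠ 0) :
    HasFDerivAt G₁ ((2 - 2 * ‖y‖⁻¹) • ContinuousLinearMap.id ℝ Space +
      (2 * ‖y‖⁻¹ ^ 3) • (innerSL ℝ y).smulRight y) y := by
  have h : 0 < ‖y‖ := norm_pos_iff.2 hy
  have h1 : HasFDerivAt (fun x : Space => ‖x‖ ^ 2) (2 • (innerSL ℝ y)) y :=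
    (hasStrictFDerivAt_norm_sq y).hasFDerivAt
  have h2 : HasFDerivAt (fun x : Space => ‖x‖) ((1 / (2 * ‖y‖)) • (2 • innerSL ℝ y)) y := by
    have := h1.sqrt (by positivity)
    simpa [Real.sqrt_sq (norm_nonneg _)] using this
  have h3 : HasFDerivAt (fun x : Space => 2 - 2 * ‖x‖⁻¹)
      ((2 * ‖y‖⁻¹ ^ 3) • innerSL ℝ y) y := by
    have h4 := (hasDerivAt_inv h.ne').comp_hasFDerivAt y h2
    have h5 := (h4.const_mul 2).const_sub 2
    refine h5.congr_fderiv ?_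
    ext v
    simp
    field_simp
  have h6 := h3.smul (hasFDerivAt_id (𝕜 := ℝ) y)
  refine (h6.congr_of_eventuallyEq ?_).congr_fderiv ?_
  · filter_upwards [isOpen_ne.mem_nhds hy] with x hx
    have hx' : 0 < ‖x‖ := norm_pos_iff.2 hx
    simp only [G₁, smul_smul]
    congr 1
    field_simp
  · ext v
    simp [mul_assoc, mul_left_comm]

/-- The Jacobian matrix of `G₁` has the eigenvalue `2 - 2/|y|`, which vanishes on the cloaking
surface, on the tangential directions, and the eigenvalue `2` in the radial direction. -/
theorem jac_G₁ {y : Space} (hy : y ≠ 0) (i j : Fin 3) :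
    jac G₁ y i j = (2 - 2 * ‖y‖⁻¹) * (if i = j then 1 else 0) + 2 * ‖y‖⁻¹ ^ 3 * (y i * y j) := by
  simp only [jac, Matrix.of_apply, (hasFDerivAt_G₁ hy).fderiv]
  simp only [add_apply, smul_apply,
    ContinuousLinearMap.smulRight_apply, innerSL_apply_apply, PiLp.inner_apply]
  simp [mul_comm (y i), mul_assoc, eq_comm (a := i)]

theorem jac_G₁_transpose {y : Space} (hy : y ≠ 0) : (jac G₁ y)ᵀ = jac G₁ y := by
  ext i j
  simp only [Matrix.transpose_apply, jac_G₁ hy, eq_comm (a := i), mul_comm (y i)]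

theorem norm_sq_eq (y : Space) : ‖y‖ ^ 2 = y 0 ^ 2 + y 1 ^ 2 + y 2 ^ 2 := by
  rw [EuclideanSpace.norm_sq_eq]; simp [Fin.sum_univ_three]

theorem det_jac_G₁ {y : Space} (hy : y ≠ 0) :
    (jac G₁ y).det = 2 * (2 - 2 * ‖y‖⁻¹) ^ 2 := by
  have h : 0 < ‖y‖ := norm_pos_iff.2 hy
  have hs := norm_sq_eq y
  rw [Matrix.det_fin_three]
  simp only [jac_G₁ hy]
  simp
  set a := 2 - 2 * ‖y‖⁻¹ with ha
  -- the product of the eigenvalues `a`, `a` and `a + 2 |y|⁻¹ = 2`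
  have e : a ^ 3 + a ^ 2 * (2 * ‖y‖⁻¹ ^ 3) * ‖y‖ ^ 2 = 2 * a ^ 2 := by
    have : 2 * ‖y‖⁻¹ ^ 3 * ‖y‖ ^ 2 = 2 * ‖y‖⁻¹ := by field_simp
    rw [mul_assoc, this, ha]; ring
  rw [← e, hs]
  ring

theorem det_jac_G₁_pos {y : Space} (hy : 1 < ‖y‖) : 0 < (jac G₁ y).det := by
  have h0 : y ≠ 0 := norm_pos_iff.1 (by linarith)
  rw [det_jac_G₁ h0]
  have : ‖y‖⁻¹ < 1 := inv_lt_one_of_one_lt₀ hy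
  have : 0 < 2 - 2 * ‖y‖⁻¹ := by linarith
  positivity

theorem det_fderiv (Φ : Space → Space) (y : Space) : (fderiv ℝ Φ y).det = (jac Φ y).det := by
  let b := (EuclideanSpace.basisFun (Fin 3) ℝ).toBasis
  have : jac Φ y = LinearMap.toMatrix b b (fderiv ℝ Φ y).toLinearMap := by
    ext i j
    simp [jac, b, LinearMap.toMatrix_apply]
  rw [this, LinearMap.det_toMatrix]

theorem contDiffAt_G₁ {y : Space} (hy : y ≠ 0) : ContDiffAt ℝ ∞ G₁ y := by
  have h1 : ContDiffAt ℝ ∞ (fun y : Space => ‖y‖) y := contDiffAt_norm ℝ hy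
  unfold G₁
  exact (contDiffAt_const.mul (h1.sub contDiffAt_const)).smul
    ((h1.inv (norm_ne_zero_iff.2 hy)).smul contDiffAt_id)

theorem contDiffAt_F₁ {y : Space} (hy : y ≠ 0) : ContDiffAt ℝ ∞ F₁ y := by
  have h1 : ContDiffAt ℝ ∞ (fun y : Space => ‖y‖) y := contDiffAt_norm ℝ hy
  unfold F₁
  exact ((h1.div_const 2).add contDiffAt_const).smul
    ((h1.inv (norm_ne_zero_iff.2 hy)).smul contDiffAt_id)

/-! ### Linear algebra of one- and two-forms -/

theorem cmul_cmul (A B : Matrix (Fin 3) (Fin 3) ℝ) (v : Fin 3 → ℂ) :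
    cmul A (cmul B v) = cmul (A * B) v := by
  have : (A * B).map (fun a : ℝ => (a : ℂ)) =
      A.map (fun a : ℝ => (a : ℂ)) * B.map (fun a : ℝ => (a : ℂ)) :=
    Matrix.map_mul (f := Complex.ofRealHom)
  simp [cmul, this]

@[simp] theorem cmul_one (v : Fin 3 → ℂ) : cmul 1 v = v := by
  simp [cmul]

theorem cmul_sub (A : Matrix (Fin 3) (Fin 3) ℝ) (v w : Fin 3 → ℂ) :
    cmul A (v - w) = cmul A v - cmul A w := by simp [cmul, Matrix.mulVec_sub]

theorem cmul_smul (A : Matrix (Fin 3) (Fin 3) ℝ) (c : ℂ) (v : Fin 3 → ℂ) :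
    cmul A (c • v) = c • cmul A v := by simp [cmul, Matrix.mulVec_smul]

theorem rdot_mulVec_cmul (A B : Matrix (Fin 3) (Fin 3) ℝ) (a : Fin 3 → ℝ) (v : Fin 3 → ℂ) :
    rdot (A *ᵥ a) (cmul B v) = rdot a (cmul (Aᵀ * B) v) := by
  simp [rdot, cmul, Matrix.mulVec, dotProduct, Fin.sum_univ_three, Matrix.mul_apply]
  ring

theorem cmul_smul_one (c : ℝ) (v : Fin 3 → ℂ) : cmul (c • 1) v = (c : ℂ) • v := by
  ext i
  fin_cases i <;> simp [cmul, Matrix.mulVec, dotProduct, Fin.sum_univ_three]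

theorem rdot_smul (a : Fin 3 → ℝ) (c : ℂ) (v : Fin 3 → ℂ) : rdot a (c • v) = c * rdot a v := by
  simp [rdot, Finset.mul_sum, mul_left_comm]

/-- The pairing of the curl of a test form, a 2-form, with a 1-form: under a linear change of
variables with matrix `A` it is multiplied by `det A`. -/
theorem rdot_adjugate (A : Matrix (Fin 3) (Fin 3) ℝ) (a : Fin 3 → ℝ) (v : Fin 3 → ℂ) :
    rdot (A.adjugate *ᵥ a) (cmul Aᵀ v) = A.det * rdot a v := by
  rw [rdot_mulVec_cmul, ← Matrix.transpose_mul, Matrix.mul_adjugate, Matrix.transpose_smul,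
    Matrix.transpose_one, cmul_smul_one, rdot_smul]

/-- The pairing of a test 1-form with a 2-form, under a linear change of variables. -/
theorem rdot_transpose (A : Matrix (Fin 3) (Fin 3) ℝ) (a : Fin 3 → ℝ) (v : Fin 3 → ℂ) :
    rdot (Aᵀ *ᵥ a) (cmul A.adjugate v) = A.det * rdot a v := by
  rw [rdot_mulVec_cmul, Matrix.transpose_transpose, Matrix.mul_adjugate, cmul_smul_one, rdot_smul]

/-- For the metric `AᵀA`, the tensor `|g|^{1/2} g⁻¹` maps the components of the pull-back of a
1-form to those of the pull-back, as a 2-form, of its Hodge dual. -/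
theorem material_mul_transpose {A : Matrix (Fin 3) (Fin 3) ℝ} (hA : 0 < A.det) :
    (Real.sqrt (Aᵀ * A).det • (Aᵀ * A)⁻¹) * Aᵀ = A.adjugate := by
  have h : IsUnit A.det := hA.ne'.isUnit
  have ht : IsUnit Aᵀ.det := by rwa [Matrix.det_transpose]
  rw [Matrix.det_mul, Matrix.det_transpose, Real.sqrt_mul_self hA.le, Matrix.mul_inv_rev,
    smul_mul_assoc, Matrix.mul_assoc, Matrix.nonsing_inv_mul _ ht, Matrix.mul_one, Matrix.inv_def,
    smul_smul, Ring.inverse_eq_inv', mul_inv_cancel₀ hA.ne', one_smul]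

/-- The electric displacement `ε̃Ẽ` of the push-forward `Ẽ` of `E` is the push-forward of `E` as a
2-form. -/
theorem cmul_materialTilde {y : Space} (hy : y ∈ N₁) (v : Fin 3 → ℂ) :
    cmul (materialTilde y) (cmul (jac G₁ y)ᵀ v) = cmul (jac G₁ y).adjugate v := by
  rw [cmul_cmul, materialTilde, if_pos hy, metricTilde,
    material_mul_transpose (det_jac_G₁_pos (mem_N₁.1 hy).1)]

theorem energy_eq (ε : Matrix (Fin 3) (Fin 3) ℝ) (hε : εᵀ = ε) (E : Fin 3 → ℂ) :
    ∑ j, ∑ k, (ε j k : ℂ) * E j * conj (E k) = cmul ε E ⬝ᵥ (fun k => conj (E k)) := by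
  have h : ∀ i j, ε i j = ε j i := fun i j => by
    conv_lhs => rw [← hε]
    rfl
  simp only [cmul, Matrix.mulVec, dotProduct, Fin.sum_univ_three, Matrix.map_apply]
  rw [h 0 1, h 0 2, h 1 2]
  ring

theorem materialTilde_transpose {y : Space} (hy : y ∈ N₁) :
    (materialTilde y)ᵀ = materialTilde y := by
  rw [materialTilde, if_pos hy, metricTilde]
  simp [Matrix.transpose_nonsing_inv]

theorem energyDensity_one (E : Space → Fin 3 → ℂ) (x : Space) :
    energyDensity (fun _ => 1) E x = ((∑ j, ‖E x j‖ ^ 2 : ℝ) : ℂ) := by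
  rw [energyDensity, energy_eq _ Matrix.transpose_one, cmul_one]
  simp [dotProduct, Complex.mul_conj, Complex.normSq_eq_norm_sq]

/-- The energy of the push-forward is the energy of the original form, with the Jacobian
determinant as a density. -/
theorem energyDensity_materialTilde {y : Space} (hy : y ∈ N₁) {Et E : Space → Fin 3 → ℂ}
    (hE : Et y = cmul (jac G₁ y)ᵀ (E (G₁ y))) :
    energyDensity materialTilde Et y =
      (jac G₁ y).det * energyDensity (fun _ => 1) E (G₁ y) := by
  rw [energyDensity, energyDensity, energy_eq _ (materialTilde_transpose hy),
    energy_eq _ Matrix.transpose_one, hE, cmul_materialTilde hy, cmul_one]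
  have : (fun k => conj (cmul (jac G₁ y)ᵀ (E (G₁ y)) k)) =
      cmul (jac G₁ y)ᵀ (fun k => conj (E (G₁ y) k)) := by
    ext k
    simp [cmul, Matrix.mulVec, dotProduct, Fin.sum_univ_three]
  rw [this]
  set A := jac G₁ y
  -- `adj(A) v ⬝ Aᵀ w = (A adj(A)) v ⬝ w`
  have h2 : ∀ v w : Fin 3 → ℂ, cmul A.adjugate v ⬝ᵥ cmul Aᵀ w = A.det * (v ⬝ᵥ w) := by
    intro v w
    have : cmul A.adjugate v ⬝ᵥ cmul Aᵀ w = cmul (A * A.adjugate) v ⬝ᵥ w := by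
      simp [cmul, Matrix.mulVec, dotProduct, Fin.sum_univ_three, Matrix.mul_apply]
      ring
    rw [this, Matrix.mul_adjugate, cmul_smul_one, smul_dotProduct, smul_eq_mul]
  exact h2 _ _

/-! ### Naturality of the curl -/

theorem fderiv_apply_eq {Φ : Space → Space} {y : Space} (v : Space) (i : Fin 3) :
    fderiv ℝ Φ y v i = ∑ j, v j * jac Φ y i j := by
  have : v = ∑ j, v j • EuclideanSpace.single j (1 : ℝ) := by
    ext i
    simp [Pi.single_apply]
  conv_lhs => rw [this]
  simp [jac, map_sum]

/-- The product and chain rules for the components of a pull-back. The first term contains the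
second derivatives of `Φ`; it is symmetric in `i` and `j` and so does not contribute to the curl. -/
theorem pd_pullback {Φ : Space → Space} {h : Space → Fin 3 → ℝ} {y : Space}
    (hΦ : ContDiffAt ℝ 2 Φ y) (hh : DifferentiableAt ℝ h (Φ y)) (i j : Fin 3) :
    pd i (fun z => (jac Φ z)ᵀ *ᵥ h (Φ z)) j y =
      ∑ p, (fderiv ℝ (fderiv ℝ Φ) y (EuclideanSpace.single i 1) (EuclideanSpace.single j 1) p *
          h (Φ y) p + jac Φ y p j * ∑ q, jac Φ y q i * pd q h p (Φ y)) := by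
  have hd : DifferentiableAt ℝ Φ y := hΦ.differentiableAt (by norm_num)
  have h2 : DifferentiableAt ℝ (fderiv ℝ Φ) y :=
    (hΦ.fderiv_right (m := 1) (by norm_num)).differentiableAt (by norm_num)
  have hD : ∀ p j, HasFDerivAt (fun z => jac Φ z p j)
      ((EuclideanSpace.proj p : Space →L[ℝ] ℝ) ∘L
        ((ContinuousLinearMap.apply ℝ Space (EuclideanSpace.single j (1 : ℝ))) ∘L
          fderiv ℝ (fderiv ℝ Φ) y)) y := by
    intro p j
    exact (EuclideanSpace.proj p : Space →L[ℝ] ℝ).hasFDerivAt.comp y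
      ((ContinuousLinearMap.apply ℝ Space (EuclideanSpace.single j (1 : ℝ))).hasFDerivAt.comp y
        h2.hasFDerivAt)
  have hH : ∀ p, HasFDerivAt (fun z => h (Φ z) p)
      ((ContinuousLinearMap.proj p : (Fin 3 → ℝ) →L[ℝ] ℝ) ∘L
        (fderiv ℝ h (Φ y) ∘L fderiv ℝ Φ y)) y := fun p =>
    (ContinuousLinearMap.proj p : (Fin 3 → ℝ) →L[ℝ] ℝ).hasFDerivAt.comp y
      (hh.hasFDerivAt.comp y hd.hasFDerivAt)
  have hall := hasFDerivAt_pi.2 fun j => HasFDerivAt.fun_sum (u := Finset.univ)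
    fun p _ => (hD p j).mul (hH p)
  have heq : (fun z => (jac Φ z)ᵀ *ᵥ h (Φ z)) =
      fun z j => ∑ p, ((fun z => jac Φ z p j) * fun z => h (Φ z) p) z := by
    ext z j
    simp [Matrix.mulVec, dotProduct]
  rw [pd, heq, hall.fderiv]
  simp only [ContinuousLinearMap.coe_pi', sum_apply]
  refine Finset.sum_congr rfl fun p _ => ?_
  have key : ∀ v : Space, fderiv ℝ h (Φ y) v p = ∑ q, v q * pd q h p (Φ y) := by
    intro v
    have : v = ∑ j, v j • EuclideanSpace.single j (1 : ℝ) := by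
      ext i
      simp [Pi.single_apply]
    conv_lhs => rw [this]
    simp [pd, map_sum]
  simp only [add_apply, smul_apply,
    ContinuousLinearMap.comp_apply, ContinuousLinearMap.proj_apply, smul_eq_mul, key]
  simp only [jac, Matrix.of_apply, PiLp.proj_apply, ContinuousLinearMap.apply_apply]
  ring

/-- The exterior derivative of a 1-form commutes with pull-back; in components, the pull-back of
the curl is taken with the adjugate of the Jacobian matrix. -/
theorem curl_pullback {Φ : Space → Space} {h : Space → Fin 3 → ℝ} {y : Space}
    (hΦ : ContDiffAt ℝ 2 Φ y) (hh : DifferentiableAt ℝ h (Φ y)) :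
    curl (fun z => (jac Φ z)ᵀ *ᵥ h (Φ z)) y = (jac Φ y).adjugate *ᵥ curl h (Φ y) := by
  have hsymm : ∀ i j : Fin 3,
      fderiv ℝ (fderiv ℝ Φ) y (EuclideanSpace.single i 1) (EuclideanSpace.single j 1) =
      fderiv ℝ (fderiv ℝ Φ) y (EuclideanSpace.single j 1) (EuclideanSpace.single i 1) :=
    fun i j => (hΦ.isSymmSndFDerivAt (by simp)).eq _ _
  rw [Matrix.adjugate_fin_three]
  simp only [curl, pd_pullback hΦ hh]
  rw [hsymm 1 2, hsymm 2 0, hsymm 0 1]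
  simp only [Fin.sum_univ_three]
  ext i
  fin_cases i <;> simp [Matrix.mulVec, dotProduct, Fin.sum_univ_three] <;> ring

/-! ### Change of variables and measurability -/

theorem mem_M₁_diff {x : Space} : x ∈ M₁ \ {0} ↔ 0 < ‖x‖ ∧ ‖x‖ < 2 := by
  simp [M₁, and_comm]

theorem N₁_ne_zero {y : Space} (hy : y ∈ N₁) : y ≠ 0 :=
  norm_pos_iff.1 (by linarith [(mem_N₁.1 hy).1])

theorem G₁_mem {y : Space} (hy : y ∈ N₁) : G₁ y ∈ M₁ \ {0} := by
  rw [mem_N₁] at hy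
  rw [mem_M₁_diff, norm_G₁ hy.1]
  constructor <;> linarith

theorem F₁_mem {x : Space} (hx : x ∈ M₁ \ {0}) : F₁ x ∈ N₁ := by
  have h0 : x ≠ 0 := hx.2
  rw [mem_M₁_diff] at hx
  rw [mem_N₁, norm_F₁ h0]
  constructor <;> linarith

theorem image_G₁ : G₁ '' N₁ = M₁ \ {0} := by
  refine Set.Subset.antisymm (Set.image_subset_iff.2 fun y hy => G₁_mem hy) fun x hx => ?_
  exact ⟨F₁ x, F₁_mem hx, G₁_F₁ hx.2⟩

theorem injOn_G₁ : Set.InjOn G₁ N₁ := fun y hy z hz h => by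
  rw [← F₁_G₁ (mem_N₁.1 hy).1, h, F₁_G₁ (mem_N₁.1 hz).1]

theorem hasFDerivWithinAt_G₁ (y : Space) (hy : y ∈ N₁) :
    HasFDerivWithinAt G₁ (fderiv ℝ G₁ y) N₁ y :=
  (hasFDerivAt_G₁ (N₁_ne_zero hy)).differentiableAt.hasFDerivAt.hasFDerivWithinAt

theorem abs_det_fderiv_G₁ {y : Space} (hy : y ∈ N₁) :
    |(fderiv ℝ G₁ y).det| = (jac G₁ y).det := by
  rw [det_fderiv, abs_of_pos (det_jac_G₁_pos (mem_N₁.1 hy).1)]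

/-- No absolute value is needed: `G₁` preserves orientation on `N₁`. -/
theorem integral_comp_G₁ {E : Type*} [NormedAddCommGroup E] [NormedSpace ℝ E] (g : Space → E) :
    ∫ x in M₁ \ {0}, g x = ∫ y in N₁, (jac G₁ y).det • g (G₁ y) := by
  rw [← image_G₁, integral_image_eq_integral_abs_det_fderiv_smul volume
    isOpen_N₁.measurableSet hasFDerivWithinAt_G₁ injOn_G₁]
  exact setIntegral_congr_fun isOpen_N₁.measurableSet fun y hy => by
    simp only [abs_det_fderiv_G₁ hy]

theorem integrableOn_comp_G₁ {E : Type*} [NormedAddCommGroup E] [NormedSpace ℝ E]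
    (g : Space → E) :
    IntegrableOn g (M₁ \ {0}) ↔ IntegrableOn (fun y => (jac G₁ y).det • g (G₁ y)) N₁ := by
  rw [← image_G₁, integrableOn_image_iff_integrableOn_abs_det_fderiv_smul volume
    isOpen_N₁.measurableSet hasFDerivWithinAt_G₁ injOn_G₁]
  exact integrableOn_congr_fun (fun y hy => by simp only [abs_det_fderiv_G₁ hy])
    isOpen_N₁.measurableSet

theorem isOpen_M₁_diff : IsOpen (M₁ \ {0}) := Metric.isOpen_ball.sdiff isClosed_singleton

theorem measurable_G₁ : Measurable G₁ := by
  unfold G₁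
  fun_prop

theorem measurable_F₁ : Measurable F₁ := by
  unfold F₁
  fun_prop

theorem quasiMeasurePreserving_G₁ : Measure.QuasiMeasurePreserving G₁
    (volume.restrict N₁) (volume.restrict (M₁ \ {0})) := by
  refine ⟨measurable_G₁, Measure.AbsolutelyContinuous.mk fun s hs h0 => ?_⟩
  rw [Measure.map_apply measurable_G₁ hs, Measure.restrict_apply (measurable_G₁ hs)]
  rw [Measure.restrict_apply hs] at h0
  refine measure_mono_null (t := F₁ '' (s ∩ (M₁ \ {0}))) ?_ ?_
  · rintro y ⟨hy, hyN⟩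
    exact ⟨G₁ y, ⟨hy, G₁_mem hyN⟩, F₁_G₁ (mem_N₁.1 hyN).1⟩
  · refine addHaar_image_eq_zero_of_differentiableOn_of_addHaar_eq_zero volume ?_ h0
    exact fun x hx => ((contDiffAt_F₁ hx.2.2).differentiableAt (by simp)).differentiableWithinAt

theorem quasiMeasurePreserving_F₁ : Measure.QuasiMeasurePreserving F₁
    (volume.restrict (M₁ \ {0})) (volume.restrict N₁) := by
  refine ⟨measurable_F₁, Measure.AbsolutelyContinuous.mk fun s hs h0 => ?_⟩
  rw [Measure.map_apply measurable_F₁ hs, Measure.restrict_apply (measurable_F₁ hs)]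
  rw [Measure.restrict_apply hs] at h0
  refine measure_mono_null (t := G₁ '' (s ∩ N₁)) ?_ ?_
  · rintro x ⟨hx, hxM⟩
    exact ⟨F₁ x, ⟨hx, F₁_mem hxM⟩, G₁_F₁ hxM.2⟩
  · refine addHaar_image_eq_zero_of_differentiableOn_of_addHaar_eq_zero volume ?_ h0
    exact fun x hx =>
      ((contDiffAt_G₁ (N₁_ne_zero hx.2)).differentiableAt (by simp)).differentiableWithinAt

theorem measurable_jac (Φ : Space → Space) (i j : Fin 3) : Measurable fun y => jac Φ y i j := by
  have h : Measurable fun y => fderiv ℝ Φ y (EuclideanSpace.single j 1) :=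
    measurable_fderiv_apply_const ℝ Φ _
  exact (EuclideanSpace.proj (𝕜 := ℝ) i).continuous.measurable.comp h

theorem aestronglyMeasurable_cmul {μ : Measure Space} {A : Space → Matrix (Fin 3) (Fin 3) ℝ}
    {v : Space → Fin 3 → ℂ} (hA : ∀ i j, Measurable fun y => A y i j)
    (hv : AEStronglyMeasurable v μ) : AEStronglyMeasurable (fun y => cmul (A y) (v y)) μ := by
  rw [aestronglyMeasurable_iff_aemeasurable] at hv ⊢
  rw [aemeasurable_pi_iff] at hv ⊢
  intro i
  simp only [cmul, Matrix.mulVec, dotProduct, Matrix.map_apply]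
  refine Finset.aemeasurable_fun_sum _ fun j _ => ?_
  exact (Complex.measurable_ofReal.comp (hA i j)).aemeasurable.mul (hv j)

theorem jac_comp {Φ Ψ : Space → Space} {x : Space} (hΦ : DifferentiableAt ℝ Φ (Ψ x))
    (hΨ : DifferentiableAt ℝ Ψ x) : jac (Φ ∘ Ψ) x = jac Φ (Ψ x) * jac Ψ x := by
  ext i j
  rw [Matrix.mul_apply]
  conv_lhs => rw [jac, Matrix.of_apply, fderiv_comp x hΦ hΨ, ContinuousLinearMap.comp_apply,
    fderiv_apply_eq]
  simp only [jac, Matrix.of_apply, mul_comm]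

theorem jac_id (x : Space) : jac id x = 1 := by
  ext i j
  simp [jac, Matrix.one_apply]

theorem jac_G₁_mul_jac_F₁ {x : Space} (hx : x ∈ M₁ \ {0}) :
    jac G₁ (F₁ x) * jac F₁ x = 1 := by
  rw [← jac_comp, ← jac_id x]
  · simp only [jac]
    have : G₁ ∘ F₁ =ᶠ[nhds x] id := by
      filter_upwards [isOpen_M₁_diff.mem_nhds hx] with z hz using G₁_F₁ hz.2
    rw [this.fderiv_eq]
  · exact (contDiffAt_G₁ (N₁_ne_zero (F₁_mem hx))).differentiableAt (by simp)
  · exact (contDiffAt_F₁ hx.2).differentiableAt (by simp)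

theorem jac_F₁_mul_jac_G₁ {x : Space} (hx : x ∈ M₁ \ {0}) :
    jac F₁ x * jac G₁ (F₁ x) = 1 := mul_eq_one_comm.1 (jac_G₁_mul_jac_F₁ hx)

theorem disjoint_N₁_N₂ : Disjoint N₁ N₂ :=
  Set.disjoint_left.2 fun y hy hy' => by
    have := (mem_N₁.1 hy).1
    simp only [N₂, mem_ball_zero_iff] at hy'
    linarith

theorem N_diff_eq : N \ cloakSurface = N₁ ∪ N₂ := by
  ext y
  simp only [N, cloakSurface, N₂, Set.mem_sdiff, Set.mem_union, mem_N₁, mem_ball_zero_iff,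
    mem_sphere_zero_iff_norm]
  constructor
  · rintro ⟨h1, h2⟩
    rcases lt_or_gt_of_ne h2 with h | h
    · exact Or.inr h
    · exact Or.inl ⟨h, h1⟩
  · rintro (⟨h1, h2⟩ | h)
    · exact ⟨h2, h1.ne'⟩
    · exact ⟨by linarith, h.ne⟩

theorem N₁_subset : N₁ ⊆ N \ cloakSurface := N_diff_eq ▸ Set.subset_union_left
theorem N₂_subset : N₂ ⊆ N \ cloakSurface := N_diff_eq ▸ Set.subset_union_right

theorem isOpen_N₂ : IsOpen N₂ := Metric.isOpen_ball

theorem not_mem_N₁ {y : Space} (hy : y ∈ N₂) : y ∉ N₁ := Set.disjoint_right.1 disjoint_N₁_N₂ hy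

theorem aestronglyMeasurable_pushOneForm {E : Space ⊕ Space → Fin 3 → ℂ} (hE : MeasurableOnM E) :
    AEStronglyMeasurable (pushOneForm E) (volume.restrict (N \ cloakSurface)) := by
  rw [N_diff_eq, aestronglyMeasurable_union_iff]
  constructor
  · refine AEStronglyMeasurable.congr (f := fun y => cmul (jac G₁ y)ᵀ ((E ∘ Sum.inl) (G₁ y))) ?_ ?_
    · exact aestronglyMeasurable_cmul (fun i j => measurable_jac G₁ j i)
        (hE.1.comp_quasiMeasurePreserving quasiMeasurePreserving_G₁)
    · filter_upwards [ae_restrict_mem isOpen_N₁.measurableSet] with y hy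
      simp [pushOneForm, hy]
  · refine hE.2.congr ?_
    change _ =ᵐ[volume.restrict N₂] _
    filter_upwards [ae_restrict_mem isOpen_N₂.measurableSet] with y hy
    simp [pushOneForm, not_mem_N₁ hy]

/-- The inverse of the push-forward by `F` is the pull-back by `F`. -/
theorem exists_unique_pushOneForm {Et : Space → Fin 3 → ℂ}
    (hEt : AEStronglyMeasurable Et (volume.restrict (N \ cloakSurface))) :
    ∃ E : Space ⊕ Space → Fin 3 → ℂ, MeasurableOnM E ∧
        Set.EqOn Et (pushOneForm E) (N \ cloakSurface) ∧
        ∀ E' : Space ⊕ Space → Fin 3 → ℂ,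
          Set.EqOn Et (pushOneForm E') (N \ cloakSurface) → Set.EqOn E' E puncturedM := by
  refine ⟨Sum.elim (fun x => cmul (jac F₁ x)ᵀ (Et (F₁ x))) Et, ⟨?_, ?_⟩, ?_, ?_⟩
  · exact aestronglyMeasurable_cmul (fun i j => measurable_jac F₁ j i)
      ((hEt.mono_measure (Measure.restrict_mono N₁_subset le_rfl)).comp_quasiMeasurePreserving
        quasiMeasurePreserving_F₁)
  · exact hEt.mono_measure (Measure.restrict_mono N₂_subset le_rfl)
  · intro y hy
    rw [N_diff_eq] at hy
    rcases hy with hy | hy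
    · have hF := F₁_G₁ (mem_N₁.1 hy).1
      have h := jac_F₁_mul_jac_G₁ (G₁_mem hy)
      rw [hF] at h
      simp [pushOneForm, hy, hF, cmul_cmul, ← Matrix.transpose_mul, h]
    · simp [pushOneForm, not_mem_N₁ hy]
  · rintro E' hE' _ (⟨x, hx, rfl⟩ | ⟨x, hx, rfl⟩)
    · have := hE' (N₁_subset (F₁_mem hx))
      simp [this, pushOneForm, F₁_mem hx, G₁_F₁ hx.2, cmul_cmul, ← Matrix.transpose_mul,
        jac_G₁_mul_jac_F₁ hx]
    · have := hE' (N₂_subset hx)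
      simp [this, pushOneForm, not_mem_N₁ hx]

/-! ### The weak pairing -/

/-- The integrand `curl h ⬝ E + h ⬝ B` of the weak form of the equation `curl E = -B`. -/
noncomputable def pairing (h : Space → Fin 3 → ℝ) (E B : Space → Fin 3 → ℂ) (x : Space) : ℂ :=
  rdot (curl h x) (E x) + rdot (h x) (B x)

theorem norm_rdot_le (a : Fin 3 → ℝ) (v : Fin 3 → ℂ) : ‖rdot a v‖ ≤ 3 * (‖a‖ * ‖v‖) := by
  have h : ∀ j, ‖(a j : ℂ) * v j‖ ≤ ‖a‖ * ‖v‖ := fun j => by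
    rw [norm_mul, Complex.norm_real]
    exact mul_le_mul (norm_le_pi_norm a j) (norm_le_pi_norm v j) (norm_nonneg _) (norm_nonneg _)
  rw [rdot, Fin.sum_univ_three]
  refine (norm_add₃_le).trans ?_
  linarith [h 0, h 1, h 2]

theorem norm_cross_le (a b : Fin 3 → ℝ) : ‖crossProduct a b‖ ≤ 2 * (‖a‖ * ‖b‖) := by
  have h : ∀ i j, |a i * b j| ≤ ‖a‖ * ‖b‖ := fun i j => by
    rw [abs_mul]
    exact mul_le_mul (norm_le_pi_norm a i) (norm_le_pi_norm b j) (abs_nonneg _) (norm_nonneg _)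
  have h2 : ∀ i j k l, |a i * b j - a k * b l| ≤ 2 * (‖a‖ * ‖b‖) := fun i j k l =>
    (abs_sub _ _).trans (by linarith [h i j, h k l])
  rw [pi_norm_le_iff_of_nonneg (by positivity)]
  intro i
  rw [cross_apply, Real.norm_eq_abs]
  fin_cases i <;> simp <;> exact h2 _ _ _ _

theorem norm_ofLp_le (y : Space) : ‖WithLp.ofLp y‖ ≤ ‖y‖ := by
  rw [pi_norm_le_iff_of_nonneg (norm_nonneg _)]
  exact fun i => PiLp.norm_apply_le y i

theorem pd_smul {φ : Space → ℝ} {h : Space → Fin 3 → ℝ} {x : Space} {L : Space →L[ℝ] ℝ}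
    (hφ : HasFDerivAt φ L x) (hh : DifferentiableAt ℝ h x) (i j : Fin 3) :
    pd i (fun z => φ z • h z) j x =
      φ x * pd i h j x + L (EuclideanSpace.single i 1) * h x j := by
  have : HasFDerivAt (fun z => φ z • h z) _ x := hφ.smul hh.hasFDerivAt
  rw [pd, this.fderiv]
  simp [pd]

/-- The product rule `curl (φ h) = φ curl h + grad φ × h`. -/
theorem curl_smul {φ : Space → ℝ} {h : Space → Fin 3 → ℝ} {x : Space} {L : Space →L[ℝ] ℝ}
    (hφ : HasFDerivAt φ L x) (hh : DifferentiableAt ℝ h x) :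
    curl (fun z => φ z • h z) x =
      φ x • curl h x + crossProduct (fun i => L (EuclideanSpace.single i 1)) (h x) := by
  simp only [curl, pd_smul hφ hh, cross_apply]
  ext i
  fin_cases i <;> simp <;> ring

theorem curl_congr {h h' : Space → Fin 3 → ℝ} {x : Space} (e : h =ᶠ[nhds x] h') :
    curl h x = curl h' x := by
  simp only [curl, pd, e.fderiv_eq]

theorem curl_eq_zero_of_notMem {h : Space → Fin 3 → ℝ} {x : Space} (hx : x ∉ tsupport h) :
    curl h x = 0 := by
  rw [curl_congr (notMem_tsupport_iff_eventuallyEq.1 hx)]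
  ext i
  fin_cases i <;> simp [curl, pd, Pi.zero_def]

theorem continuous_pd {h : Space → Fin 3 → ℝ} (hh : ContDiff ℝ 1 h) (i j : Fin 3) :
    Continuous (pd i h j) := by
  have := (hh.continuous_fderiv (by norm_num)).clm_apply
    (continuous_const (y := EuclideanSpace.single i (1 : ℝ)))
  exact (continuous_apply j).comp this

theorem continuous_curl {h : Space → Fin 3 → ℝ} (hh : ContDiff ℝ 1 h) : Continuous (curl h) := by
  refine continuous_pi fun i => ?_
  fin_cases i
  · exact (continuous_pd hh 1 2).sub (continuous_pd hh 2 1)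
  · exact (continuous_pd hh 2 0).sub (continuous_pd hh 0 2)
  · exact (continuous_pd hh 0 1).sub (continuous_pd hh 1 0)

theorem hasCompactSupport_curl {h : Space → Fin 3 → ℝ} (hc : HasCompactSupport h) :
    HasCompactSupport (curl h) :=
  hc.mono' fun x hx => by
    by_contra hn
    exact hx (curl_eq_zero_of_notMem hn)

theorem aestronglyMeasurable_rdot {μ : Measure Space} {a : Space → Fin 3 → ℝ}
    {v : Space → Fin 3 → ℂ} (ha : Continuous a) (hv : AEStronglyMeasurable v μ) :
    AEStronglyMeasurable (fun x => rdot (a x) (v x)) μ := by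
  rw [aestronglyMeasurable_iff_aemeasurable] at hv ⊢
  rw [aemeasurable_pi_iff] at hv
  refine Finset.aemeasurable_fun_sum _ fun j _ => ?_
  exact (Complex.measurable_ofReal.comp
    ((measurable_pi_apply j).comp ha.measurable)).aemeasurable.mul (hv j)

theorem integrable_rdot {μ : Measure Space} {a : Space → Fin 3 → ℝ} {v : Space → Fin 3 → ℂ}
    (ha : Continuous a) (hc : HasCompactSupport a) (hv : Integrable v μ) :
    Integrable (fun x => rdot (a x) (v x)) μ := by
  obtain ⟨C, hC⟩ := ha.bounded_above_of_compact_support hc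
  refine (hv.norm.const_mul (3 * C)).mono' (aestronglyMeasurable_rdot ha hv.1)
    (Filter.Eventually.of_forall fun x => (norm_rdot_le _ _).trans ?_)
  rw [mul_assoc]
  gcongr
  exact hC x

theorem rdot_zero_left (v : Fin 3 → ℂ) : rdot 0 v = 0 := by simp [rdot]

/-- Only the integrability of `v` on the support of `a` matters. -/
theorem integrableOn_rdot {U : Set Space} {a : Space → Fin 3 → ℝ} {v : Space → Fin 3 → ℂ}
    (ha : Continuous a) (hc : HasCompactSupport a) (hv : IntegrableOn v (tsupport a ∩ U)) :
    IntegrableOn (fun x => rdot (a x) (v x)) U := by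
  have hm : MeasurableSet (tsupport a) := (isClosed_tsupport a).measurableSet
  rw [IntegrableOn, ← integrableOn_iff_integrable_of_support_subset (s := tsupport a),
    IntegrableOn, Measure.restrict_restrict hm]
  · exact integrable_rdot ha hc hv
  · intro x hx
    by_contra hn
    exact hx (by simp only [image_eq_zero_of_notMem_tsupport hn, rdot_zero_left])

theorem integrableOn_pairing {U : Set Space} {h : Space → Fin 3 → ℝ} {E B : Space → Fin 3 → ℂ}
    (hh : ContDiff ℝ ∞ h) (hc : HasCompactSupport h) (hE : IntegrableOn E U)
    (hB : IntegrableOn B (tsupport h ∩ U)) : IntegrableOn (pairing h E B) U :=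
  (integrable_rdot (continuous_curl (hh.of_le (by simp))) (hasCompactSupport_curl hc) hE).add
    (integrableOn_rdot hh.continuous hc hB)

theorem pairing_congr {U : Set Space} (hU : IsOpen U) {h h' : Space → Fin 3 → ℝ}
    (e : Set.EqOn h h' U) (E B : Space → Fin 3 → ℂ) :
    Set.EqOn (pairing h E B) (pairing h' E B) U := by
  intro x hx
  simp only [pairing, curl_congr (e.eventuallyEq_of_mem (hU.mem_nhds hx)), e hx]

/-! ### Radial cutoffs -/

/-- The smooth radial cutoff `η(a|x|² + b)`, where `η` increases from `0` on `(-∞, 0]` to `1` on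
`[1, ∞)`. -/
noncomputable def cutoff (a b : ℝ) (x : Space) : ℝ := Real.smoothTransition (a * ‖x‖ ^ 2 + b)

theorem contDiff_cutoff (a b : ℝ) : ContDiff ℝ ∞ (cutoff a b) :=
  (Real.smoothTransition.contDiff (n := ⊤)).comp
    ((contDiff_const.mul (contDiff_norm_sq ℝ)).add contDiff_const)

theorem deriv_smoothTransition_eq_zero {t : ℝ} (ht : t ∉ Set.Ioo (0 : ℝ) 1) :
    deriv Real.smoothTransition t = 0 := by
  by_cases h : t ≤ 0
  · refine IsLocalMin.deriv_eq_zero (Filter.Eventually.of_forall fun s => ?_)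
    rw [Real.smoothTransition.zero_of_nonpos h]
    exact Real.smoothTransition.nonneg s
  · have h1 : 1 ≤ t := by
      by_contra h'
      exact ht ⟨not_le.1 h, not_le.1 h'⟩
    refine IsLocalMax.deriv_eq_zero (Filter.Eventually.of_forall fun s => ?_)
    rw [Real.smoothTransition.one_of_one_le h1]
    exact Real.smoothTransition.le_one s

theorem exists_deriv_smoothTransition_le :
    ∃ C, 0 ≤ C ∧ ∀ t, |deriv Real.smoothTransition t| ≤ C := by
  have hc : Continuous (deriv Real.smoothTransition) :=
    (Real.smoothTransition.contDiff (n := 1)).continuous_deriv (by norm_num)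
  have hs : HasCompactSupport (deriv Real.smoothTransition) :=
    HasCompactSupport.intro (isCompact_Icc (a := (0 : ℝ)) (b := 1)) fun t ht =>
      deriv_smoothTransition_eq_zero fun h => ht (Set.Ioo_subset_Icc_self h)
  obtain ⟨C, hC⟩ := hc.bounded_above_of_compact_support hs
  exact ⟨C, (norm_nonneg _).trans (hC 0), hC⟩

theorem hasFDerivAt_cutoff (a b : ℝ) (x : Space) : HasFDerivAt (cutoff a b)
    ((2 * a * deriv Real.smoothTransition (a * ‖x‖ ^ 2 + b)) • innerSL ℝ x) x := by
  have h1 : HasFDerivAt (fun x : Space => a * ‖x‖ ^ 2 + b) (a • (2 • innerSL ℝ x)) x :=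
    ((hasStrictFDerivAt_norm_sq x).hasFDerivAt.const_mul a).add_const b
  have h2 : HasDerivAt Real.smoothTransition
      (deriv Real.smoothTransition (a * ‖x‖ ^ 2 + b)) (a * ‖x‖ ^ 2 + b) :=
    ((Real.smoothTransition.contDiffAt (n := 1)).differentiableAt (by norm_num)).hasDerivAt
  refine (h2.comp_hasFDerivAt x h1).congr_fderiv ?_
  ext v
  simp
  ring

theorem rdot_add_left (a b : Fin 3 → ℝ) (v : Fin 3 → ℂ) :
    rdot (a + b) v = rdot a v + rdot b v := by
  simp [rdot, add_mul, Finset.sum_add_distrib]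

theorem rdot_smul_left (c : ℝ) (a : Fin 3 → ℝ) (v : Fin 3 → ℂ) :
    rdot (c • a) v = c * rdot a v := by
  simp [rdot, Finset.mul_sum, mul_assoc]

/-- The effect of a cutoff on the weak pairing: the gradient of a radial cutoff is radial, so the
additional term contains only the tangential part of `E`, or equivalently that of `h`. -/
theorem pairing_cutoff {h : Space → Fin 3 → ℝ} (E B : Space → Fin 3 → ℂ) (a b : ℝ) {x : Space}
    (hh : DifferentiableAt ℝ h x) :
    pairing (fun z => cutoff a b z • h z) E B x = cutoff a b x * pairing h E B x +
      (2 * a * deriv Real.smoothTransition (a * ‖x‖ ^ 2 + b) : ℝ) *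
        rdot (crossProduct (WithLp.ofLp x) (h x)) (E x) := by
  have hx : (fun i => ((2 * a * deriv Real.smoothTransition (a * ‖x‖ ^ 2 + b)) • innerSL ℝ x)
      (EuclideanSpace.single i 1)) =
      (2 * a * deriv Real.smoothTransition (a * ‖x‖ ^ 2 + b)) • WithLp.ofLp x := by
    ext i
    simp only [smul_apply, innerSL_apply_apply, PiLp.inner_apply]
    simp
  rw [pairing, curl_smul (hasFDerivAt_cutoff a b x) hh, hx, map_smul, LinearMap.smul_apply,
    rdot_add_left, rdot_smul_left, rdot_smul_left, rdot_smul_left, pairing]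
  ring

/-- Passage to the limit in cutoffs `cutoff (a n) (b n)` that exhaust `U`: the weak equation
extends from the truncated test forms to `h` as soon as the terms that contain the gradients of the
cutoffs are dominated. -/
theorem integral_pairing_eq_zero_of_cutoff {U : Set Space} (hU : MeasurableSet U)
    {h : Space → Fin 3 → ℝ} {E B : Space → Fin 3 → ℂ} (hh : ContDiff ℝ ∞ h) {a b : ℕ → ℝ}
    (hE : AEStronglyMeasurable E (volume.restrict U))
    (hint : IntegrableOn (pairing h E B) U)
    (hzero : ∀ n, ∫ x in U, pairing (fun z => cutoff (a n) (b n) z • h z) E B x = 0)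
    {g : Space → ℝ} (hg : IntegrableOn g U)
    (hbound : ∀ n, ∀ x ∈ U, 0 < a n * ‖x‖ ^ 2 + b n → a n * ‖x‖ ^ 2 + b n < 1 →
      ‖((2 * a n * deriv Real.smoothTransition (a n * ‖x‖ ^ 2 + b n) : ℝ) : ℂ) *
        rdot (crossProduct (WithLp.ofLp x) (h x)) (E x)‖ ≤ g x)
    (hlim : ∀ x ∈ U, ∀ᶠ n in Filter.atTop, 1 ≤ a n * ‖x‖ ^ 2 + b n) :
    ∫ x in U, pairing h E B x = 0 := by
  have hd : Differentiable ℝ h := hh.differentiable (by simp)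
  have hcross : Continuous fun x : Space => crossProduct (WithLp.ofLp x) (h x) := by
    have h1 : ∀ i, Continuous fun x : Space => x i := fun i => by fun_prop
    have h2 : ∀ i, Continuous fun x : Space => h x i :=
      fun i => (continuous_apply i).comp hh.continuous
    simp only [cross_apply]
    refine continuous_pi fun i => ?_
    fin_cases i <;> simp <;> fun_prop
  have hm : ∀ n, AEStronglyMeasurable
      (pairing (fun z => cutoff (a n) (b n) z • h z) E B) (volume.restrict U) := by
    intro n
    rw [show pairing (fun z => cutoff (a n) (b n) z • h z) E B = _ from
      funext fun x => pairing_cutoff E B (a n) (b n) (hd x)]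
    refine ((Complex.continuous_ofReal.comp
      (contDiff_cutoff _ _).continuous).aestronglyMeasurable.mul hint.1).add ?_
    refine AEStronglyMeasurable.mul ?_ (aestronglyMeasurable_rdot hcross hE)
    refine (Complex.continuous_ofReal.comp (continuous_const.mul ?_)).aestronglyMeasurable
    exact ((Real.smoothTransition.contDiff (n := 1)).continuous_deriv (by norm_num)).comp
      (by fun_prop)
  have := tendsto_integral_of_dominated_convergence (μ := volume.restrict U)
    (F := fun n => pairing (fun z => cutoff (a n) (b n) z • h z) E B) (f := pairing h E B)
    (fun x => ‖pairing h E B x‖ + |g x|) hm (hint.norm.add hg.abs) ?_ ?_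
  · simp only [hzero] at this
    exact tendsto_nhds_unique this tendsto_const_nhds
  · intro n
    filter_upwards [ae_restrict_mem hU] with x hx
    rw [pairing_cutoff E B _ _ (hd x)]
    refine (norm_add_le _ _).trans (add_le_add ?_ ?_)
    · rw [norm_mul, Complex.norm_real, cutoff, Real.norm_of_nonneg (Real.smoothTransition.nonneg _)]
      exact mul_le_of_le_one_left (norm_nonneg _) (Real.smoothTransition.le_one _)
    · by_cases ht : a n * ‖x‖ ^ 2 + b n ∈ Set.Ioo (0 : ℝ) 1
      · exact (hbound n x hx ht.1 ht.2).trans (le_abs_self _)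
      · simp [deriv_smoothTransition_eq_zero ht]
  · filter_upwards [ae_restrict_mem hU] with x hx
    refine tendsto_const_nhds.congr' ?_
    filter_upwards [hlim x hx] with n hn
    rw [pairing_cutoff E B _ _ (hd x), deriv_smoothTransition_eq_zero fun h => h.2.not_ge hn,
      cutoff, Real.smoothTransition.one_of_one_le hn]
    simp

/-! ### Extension of weak equations by cutoffs -/

theorem tsupport_subset_of_isClosed {X E : Type*} [TopologicalSpace X] [Zero E] {f : X → E}
    {K : Set X} (hK : IsClosed K) (h : ∀ x, x ∉ K → f x = 0) : tsupport f ⊆ K :=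
  closure_minimal (fun x hx => by_contra fun hn => hx (h x hn)) hK

/-- Truncation of a test form by a radial cutoff that vanishes outside `K`. -/
theorem cutoff_mem_compactTests {U K : Set Space} {h : Space → Fin 3 → ℝ} {a b : ℝ}
    (hh : ContDiff ℝ ∞ h) (hc : HasCompactSupport h) (hK : IsClosed K)
    (hKU : tsupport h ∩ K ⊆ U) (hab : ∀ x, x ∉ K → a * ‖x‖ ^ 2 + b ≤ 0) :
    (fun x => cutoff a b x • h x) ∈ compactTests U := by
  refine ⟨(contDiff_cutoff a b).smul hh, HasCompactSupport.smul_left (f := cutoff a b) hc,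
    Set.Subset.trans ?_ hKU⟩
  refine Set.subset_inter (tsupport_smul_subset_right (cutoff a b) h)
    (tsupport_subset_of_isClosed hK fun x hx => ?_)
  rw [cutoff, Real.smoothTransition.zero_of_nonpos (hab x hx), zero_smul]

theorem exists_norm_le {h : Space → Fin 3 → ℝ} (hh : Continuous h) (hc : HasCompactSupport h) :
    ∃ C, 0 ≤ C ∧ ∀ x, ‖h x‖ ≤ C := by
  obtain ⟨C, hC⟩ := hh.bounded_above_of_compact_support hc
  exact ⟨C, (norm_nonneg _).trans (hC 0), hC⟩

/-- The origin is a removable singularity for the weak equation on `M₁ \ {0}` if `E/|x|` is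
integrable: the gradients of cutoffs at the scale `1/n` are of the order of `1/|x|`. -/
theorem integral_pairing_M₁ {E B : Space → Fin 3 → ℂ}
    (hE : IntegrableOn E (M₁ \ {0}))
    (hE' : IntegrableOn (fun x => ‖x‖⁻¹ * ‖E x‖) (M₁ \ {0}))
    (hB : ∀ r < 2, IntegrableOn B (Metric.closedBall 0 r ∩ (M₁ \ {0})))
    (hw : ∀ h ∈ compactTests (M₁ \ {0}), ∫ x in M₁ \ {0}, pairing h E B x = 0) :
    ∀ h ∈ compactTests M₁, ∫ x in M₁ \ {0}, pairing h E B x = 0 := by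
  rintro h ⟨hh, hc, hs⟩
  obtain ⟨C, hC0, hC⟩ := exists_deriv_smoothTransition_le
  obtain ⟨D, hD0, hD⟩ := exists_norm_le hh.continuous hc
  -- the support of `h` lies in a smaller closed ball
  obtain ⟨r, hr, hsr⟩ : ∃ r < (2 : ℝ), tsupport h ⊆ Metric.closedBall 0 r := by
    obtain ⟨r, hr, h1⟩ := exists_lt_subset_ball hc.isClosed hs
    exact ⟨r, hr, h1.trans Metric.ball_subset_closedBall⟩
  refine integral_pairing_eq_zero_of_cutoff isOpen_M₁_diff.measurableSet hh
    -- the cutoffs vanish for `|x| ≤ 1/(n + 1)` and equal `1` for `|x| ≥ √2/(n + 1)`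
    (a := fun n => (n + 1) ^ 2) (b := fun _ => -1) hE.1
    (integrableOn_pairing hh hc hE ((hB r hr).mono_set (Set.inter_subset_inter_left _ hsr)))
    (fun n => hw _ ?_) (hE'.const_mul (24 * C * D)) ?_ ?_
  · refine cutoff_mem_compactTests (K := {x | 1 ≤ ((n : ℝ) + 1) ^ 2 * ‖x‖ ^ 2}) hh hc
      (isClosed_le (by fun_prop) (by fun_prop)) ?_ fun x hx => ?_
    · rintro x ⟨hx, hxK⟩
      refine ⟨hs hx, fun h0 => ?_⟩
      have h0' : x = 0 := h0
      simp [h0'] at hxK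
      linarith
    · have : ¬ (1 ≤ ((n : ℝ) + 1) ^ 2 * ‖x‖ ^ 2) := hx
      linarith
  · intro n x hx _ h1
    have hx0 : 0 < ‖x‖ := (mem_M₁_diff.1 hx).1
    set t := ((n : ℝ) + 1) ^ 2 * ‖x‖ ^ 2 + -1
    rw [norm_mul, Complex.norm_real, norm_mul, norm_mul, Real.norm_two, Real.norm_eq_abs,
      Real.norm_eq_abs, abs_of_nonneg (by positivity : (0 : ℝ) ≤ ((n : ℝ) + 1) ^ 2)]
    have e1 : ‖rdot (crossProduct (WithLp.ofLp x) (h x)) (E x)‖ ≤ 6 * D * ‖x‖ * ‖E x‖ := by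
      refine (norm_rdot_le _ _).trans ?_
      have : ‖crossProduct (WithLp.ofLp x) (h x)‖ ≤ 2 * (‖x‖ * D) :=
        (norm_cross_le _ _).trans (by gcongr; exacts [norm_ofLp_le x, hD x])
      nlinarith [norm_nonneg (E x), mul_le_mul_of_nonneg_right this (norm_nonneg (E x))]
    -- on the support of the gradient of the cutoff, `(n + 1)² |x|² ≤ 2`
    have e2 : ((n : ℝ) + 1) ^ 2 * ‖x‖ ≤ 2 * ‖x‖⁻¹ := by
      rw [← div_eq_mul_inv, le_div_iff₀ hx0]
      nlinarith
    calc 2 * ((n : ℝ) + 1) ^ 2 * |deriv Real.smoothTransition t| * ‖_‖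
        ≤ 2 * ((n : ℝ) + 1) ^ 2 * C * (6 * D * ‖x‖ * ‖E x‖) := by gcongr; exact hC t
      _ = 12 * C * D * ‖E x‖ * (((n : ℝ) + 1) ^ 2 * ‖x‖) := by ring
      _ ≤ 12 * C * D * ‖E x‖ * (2 * ‖x‖⁻¹) := by gcongr
      _ = _ := by ring
  · intro x hx
    have hx0 : 0 < ‖x‖ := (mem_M₁_diff.1 hx).1
    obtain ⟨n₀, hn₀⟩ := exists_nat_ge (2 * ‖x‖⁻¹)
    filter_upwards [Filter.eventually_ge_atTop n₀] with n hn
    have : 2 * ‖x‖⁻¹ ≤ n + 1 := by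
      have : (n₀ : ℝ) ≤ n := by exact_mod_cast hn
      linarith
    rw [← div_eq_mul_inv, div_le_iff₀ hx0] at this
    nlinarith

/-- A smooth form that vanishes on the part of `V` outside the ball of radius `s` agrees on `V` with
a smooth form that is compactly supported in any larger ball. -/
theorem exists_compactSupport_eqOn {h : Space → Fin 3 → ℝ} (hh : ContDiff ℝ ∞ h) {R : ℝ}
    {V : Set Space} {s : ℝ} (hs : 0 < s) (hsR : s < R)
    (hV : ∀ y ∈ V, s < ‖y‖ → h y = 0) :
    ∃ h' : Space → Fin 3 → ℝ, ContDiff ℝ ∞ h' ∧ HasCompactSupport h' ∧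
      tsupport h' ⊆ Metric.ball 0 R ∧ Set.EqOn h h' V := by
  let f : ContDiffBump (0 : Space) := ⟨s, (s + R) / 2, hs, by linarith⟩
  refine ⟨fun x => f x • h x, f.contDiff.smul hh, f.hasCompactSupport.smul_right, ?_, ?_⟩
  · refine (tsupport_smul_subset_left f h).trans ?_
    rw [f.tsupport_eq]
    exact Metric.closedBall_subset_ball (by change (s + R) / 2 < R; linarith)
  · intro y hy
    by_cases h1 : ‖y‖ ≤ s
    · have : f y = 1 := f.one_of_mem_closedBall (by simpa [f] using h1)
      simp [this]
    · simp [hV y hy (not_le.1 h1)]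

/-- The matrix `(DG₁)ᵀ` multiplies tangential components by `2 - 2/|y|`, so that the tangential part
of a push-forward carries the distance to the cloaking surface as a factor. -/
theorem cross_jac_G₁ {y : Space} (hy : y ≠ 0) (a : Fin 3 → ℝ) (v : Fin 3 → ℂ) :
    rdot (crossProduct (WithLp.ofLp y) a) (cmul (jac G₁ y)ᵀ v) =
      (2 - 2 * ‖y‖⁻¹ : ℝ) * rdot (crossProduct (WithLp.ofLp y) a) v := by
  rw [jac_G₁_transpose hy]
  simp [rdot, cmul, Matrix.mulVec, dotProduct, Fin.sum_univ_three, jac_G₁ hy, cross_apply]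
  ring

/-- The weak equation on `N₁` extends from compactly supported test forms to those that do not
vanish at the cloaking surface: the tangential part of `Et` is of the order of the distance to this
surface, whatever the boundary values of `h` are. -/
theorem integral_pairing_N₁ {E Et B : Space → Fin 3 → ℂ}
    (hEt : ∀ y ∈ N₁, Et y = cmul (jac G₁ y)ᵀ (E y))
    (hE : IntegrableOn E N₁) (hEt' : IntegrableOn Et N₁)
    (hB : ∀ r < 2, IntegrableOn B (Metric.closedBall 0 r ∩ N₁))
    (hw : ∀ h ∈ compactTests N₁, ∫ y in N₁, pairing h Et B y = 0)
    {h : Space → Fin 3 → ℝ} (hh : ContDiff ℝ ∞ h) (hc : HasCompactSupport h)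
    (hs : tsupport h ⊆ N) : ∫ y in N₁, pairing h Et B y = 0 := by
  obtain ⟨C, hC0, hC⟩ := exists_deriv_smoothTransition_le
  obtain ⟨D, hD0, hD⟩ := exists_norm_le hh.continuous hc
  obtain ⟨r, hr, hsr⟩ : ∃ r < (2 : ℝ), tsupport h ⊆ Metric.closedBall 0 r := by
    obtain ⟨r, hr, h1⟩ := exists_lt_subset_ball hc.isClosed hs
    exact ⟨r, hr, h1.trans Metric.ball_subset_closedBall⟩
  refine integral_pairing_eq_zero_of_cutoff isOpen_N₁.measurableSet hh
    -- the cutoffs are functions of `(n + 1)(|y|² - 1) - 1`, which increases away from the surface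
    (a := fun n => n + 1) (b := fun n => -(n + 1) - 1) hEt'.1
    (integrableOn_pairing hh hc hEt' ((hB r hr).mono_set (Set.inter_subset_inter_left _ hsr)))
    (fun n => hw _ ?_) (hE.norm.const_mul (48 * C * D)) ?_ ?_
  · refine cutoff_mem_compactTests (K := {x | 1 ≤ ((n : ℝ) + 1) * (‖x‖ ^ 2 - 1)}) hh hc
      (isClosed_le (by fun_prop) (by fun_prop)) ?_ fun x hx => ?_
    · rintro x ⟨hx, hxK⟩
      have hxK' : 1 ≤ ((n : ℝ) + 1) * (‖x‖ ^ 2 - 1) := hxK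
      have h2 := hs hx
      simp only [N, mem_ball_zero_iff] at h2
      refine mem_N₁.2 ⟨?_, h2⟩
      by_contra h3
      have : ‖x‖ ^ 2 - 1 ≤ 0 := by nlinarith [norm_nonneg x]
      nlinarith
    · have : ¬ (1 ≤ ((n : ℝ) + 1) * (‖x‖ ^ 2 - 1)) := hx
      linarith
  · intro n y hy _ h1
    obtain ⟨hy1, hy2⟩ := mem_N₁.1 hy
    set t := ((n : ℝ) + 1) * ‖y‖ ^ 2 + (-((n : ℝ) + 1) - 1) with ht
    rw [hEt y hy, cross_jac_G₁ (N₁_ne_zero hy), norm_mul, Complex.norm_real, norm_mul, norm_mul,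
      Real.norm_two, Real.norm_eq_abs, Real.norm_eq_abs,
      abs_of_nonneg (by positivity : (0 : ℝ) ≤ (n : ℝ) + 1), norm_mul, Complex.norm_real,
      Real.norm_eq_abs]
    have e1 : ‖rdot (crossProduct (WithLp.ofLp y) (h y)) (E y)‖ ≤ 12 * D * ‖E y‖ := by
      refine (norm_rdot_le _ _).trans ?_
      have : ‖crossProduct (WithLp.ofLp y) (h y)‖ ≤ 2 * (2 * D) :=
        (norm_cross_le _ _).trans (by gcongr; exacts [(norm_ofLp_le y).trans hy2.le, hD y])
      nlinarith [norm_nonneg (E y), mul_le_mul_of_nonneg_right this (norm_nonneg (E y))]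
    -- the tangential factor is at most the quantity in the cutoff, which is below `2/(n + 1)` here
    have e3 : |2 - 2 * ‖y‖⁻¹| ≤ ‖y‖ ^ 2 - 1 := by
      have hi : ‖y‖⁻¹ < 1 := inv_lt_one_of_one_lt₀ hy1
      have hm : ‖y‖ * ‖y‖⁻¹ = 1 := mul_inv_cancel₀ (by linarith)
      rw [abs_of_pos (by linarith)]
      nlinarith
    have e2 : ((n : ℝ) + 1) * |2 - 2 * ‖y‖⁻¹| ≤ 2 := by
      have : ((n : ℝ) + 1) * |2 - 2 * ‖y‖⁻¹| ≤ ((n : ℝ) + 1) * (‖y‖ ^ 2 - 1) := by gcongr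
      linarith
    calc 2 * ((n : ℝ) + 1) * |deriv Real.smoothTransition t| * (|2 - 2 * ‖y‖⁻¹| * ‖_‖)
        ≤ 2 * ((n : ℝ) + 1) * C * (|2 - 2 * ‖y‖⁻¹| * (12 * D * ‖E y‖)) := by gcongr; exact hC t
      _ = 24 * C * D * ‖E y‖ * (((n : ℝ) + 1) * |2 - 2 * ‖y‖⁻¹|) := by ring
      _ ≤ 24 * C * D * ‖E y‖ * 2 := by gcongr
      _ = _ := by ring
  · intro y hy
    obtain ⟨hy1, hy2⟩ := mem_N₁.1 hy
    obtain ⟨n₀, hn₀⟩ := exists_nat_ge (2 / (‖y‖ ^ 2 - 1))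
    have h0 : 0 < ‖y‖ ^ 2 - 1 := by nlinarith
    filter_upwards [Filter.eventually_ge_atTop n₀] with n hn
    have : 2 / (‖y‖ ^ 2 - 1) ≤ n + 1 := by
      have : (n₀ : ℝ) ≤ n := by exact_mod_cast hn
      linarith
    rw [div_le_iff₀ h0] at this
    linarith

/-- The weak equation on `N₂` extends from compactly supported test forms to those whose tangential
part vanishes on the cloaking surface: this part is of the order of the distance to the surface,
which compensates the growth of the gradients of the cutoffs. -/
theorem integral_pairing_N₂ {E B : Space → Fin 3 → ℂ}
    (hE : IntegrableOn E N₂) (hB : IntegrableOn B N₂)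
    (hw : ∀ h ∈ compactTests N₂, ∫ y in N₂, pairing h E B y = 0)
    {h : Space → Fin 3 → ℝ} (hh : ContDiff ℝ ∞ h) (hc : HasCompactSupport h)
    (htan : ∀ y ∈ cloakSurface, crossProduct (WithLp.ofLp y) (h y) = 0) :
    ∫ y in N₂, pairing h E B y = 0 := by
  obtain ⟨C, hC0, hC⟩ := exists_deriv_smoothTransition_le
  -- the tangential part of `h` is Lipschitz and vanishes on the unit sphere
  obtain ⟨L, hL0, hL⟩ : ∃ L : ℝ, 0 ≤ L ∧ ∀ y ∈ N₂,
      ‖crossProduct (WithLp.ofLp y) (h y)‖ ≤ L * (1 - ‖y‖) := by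
    have hsm : ContDiff ℝ 1 fun y : Space => crossProduct (WithLp.ofLp y) (h y) := by
      have h2 : ∀ i, ContDiff ℝ 1 fun x : Space => h x i := fun i =>
        (contDiff_pi.1 (hh.of_le (by simp)) i)
      simp only [cross_apply]
      refine contDiff_pi.2 fun i => ?_
      fin_cases i <;> simp <;> fun_prop
    have hcs : HasCompactSupport fun y : Space => crossProduct (WithLp.ofLp y) (h y) :=
      hc.mono fun x hx h0 => hx (by simp [h0])
    obtain ⟨L, hL⟩ := hsm.lipschitzWith_of_hasCompactSupport hcs (by norm_num)
    refine ⟨L, L.2, fun y hy => ?_⟩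
    simp only [N₂, mem_ball_zero_iff] at hy
    -- the point of the sphere closest to `y`
    obtain ⟨z, hz, hyz⟩ : ∃ z ∈ cloakSurface, ‖y - z‖ = 1 - ‖y‖ := by
      by_cases h0 : y = 0
      · refine ⟨EuclideanSpace.single 0 1, by simp [cloakSurface], by simp [h0]⟩
      · have hn : 0 < ‖y‖ := norm_pos_iff.2 h0
        refine ⟨‖y‖⁻¹ • y, by simp [cloakSurface, norm_smul, hn.ne'], ?_⟩
        have : y - ‖y‖⁻¹ • y = (1 - ‖y‖⁻¹) • y := by rw [sub_smul, one_smul]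
        rw [this, norm_smul, Real.norm_eq_abs, abs_of_nonpos, neg_sub, sub_mul,
          inv_mul_cancel₀ hn.ne', one_mul]
        linarith [(one_lt_inv₀ hn).2 hy]
    have := hL.dist_le_mul y z
    simpa [htan z hz, dist_eq_norm, hyz] using this
  refine integral_pairing_eq_zero_of_cutoff isOpen_N₂.measurableSet hh
    -- the cutoffs are functions of `(n + 1)(1 - |y|²) - 1`, which increases away from the surface
    (a := fun n => -(n + 1)) (b := fun n => (n + 1) - 1) hE.1
    (integrableOn_pairing hh hc hE (hB.mono_set Set.inter_subset_right))
    (fun n => hw _ ?_) (hE.norm.const_mul (12 * C * L)) ?_ ?_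
  · refine cutoff_mem_compactTests (K := {x | 1 ≤ ((n : ℝ) + 1) * (1 - ‖x‖ ^ 2)}) hh hc
      (isClosed_le (by fun_prop) (by fun_prop)) ?_ fun x hx => ?_
    · rintro x ⟨hx, hxK⟩
      have hxK' : 1 ≤ ((n : ℝ) + 1) * (1 - ‖x‖ ^ 2) := hxK
      simp only [N₂, mem_ball_zero_iff]
      by_contra h3
      have : 1 - ‖x‖ ^ 2 ≤ 0 := by nlinarith [norm_nonneg x]
      nlinarith
    · have : ¬ (1 ≤ ((n : ℝ) + 1) * (1 - ‖x‖ ^ 2)) := hx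
      linarith
  · intro n y hy _ h1
    have hy1 := hL y hy
    simp only [N₂, mem_ball_zero_iff] at hy
    set t := -((n : ℝ) + 1) * ‖y‖ ^ 2 + (((n : ℝ) + 1) - 1) with ht
    rw [norm_mul, Complex.norm_real, norm_mul, norm_mul,
      Real.norm_two, Real.norm_eq_abs, Real.norm_eq_abs, abs_neg,
      abs_of_nonneg (by positivity : (0 : ℝ) ≤ (n : ℝ) + 1)]
    have e1 : ‖rdot (crossProduct (WithLp.ofLp y) (h y)) (E y)‖ ≤
        3 * ((L * (1 - ‖y‖)) * ‖E y‖) := by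
      refine (norm_rdot_le _ _).trans ?_
      gcongr
    have e2 : ((n : ℝ) + 1) * (1 - ‖y‖) ≤ 2 := by
      have : ((n : ℝ) + 1) * (1 - ‖y‖) ≤ ((n : ℝ) + 1) * (1 - ‖y‖ ^ 2) := by
        gcongr
        nlinarith [norm_nonneg y]
      linarith
    calc 2 * ((n : ℝ) + 1) * |deriv Real.smoothTransition t| * ‖_‖
        ≤ 2 * ((n : ℝ) + 1) * C * (3 * ((L * (1 - ‖y‖)) * ‖E y‖)) := by gcongr; exact hC t
      _ = 6 * C * L * ‖E y‖ * (((n : ℝ) + 1) * (1 - ‖y‖)) := by ring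
      _ ≤ 6 * C * L * ‖E y‖ * 2 := by gcongr
      _ = _ := by ring
  · intro y hy
    simp only [N₂, mem_ball_zero_iff] at hy
    have h0 : 0 < 1 - ‖y‖ ^ 2 := by nlinarith [norm_nonneg y]
    obtain ⟨n₀, hn₀⟩ := exists_nat_ge (2 / (1 - ‖y‖ ^ 2))
    filter_upwards [Filter.eventually_ge_atTop n₀] with n hn
    have : 2 / (1 - ‖y‖ ^ 2) ≤ n + 1 := by
      have : (n₀ : ℝ) ≤ n := by exact_mod_cast hn
      linarith
    rw [div_le_iff₀ h0] at this
    linarith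

/-! ### Hardy's inequality and the div-curl identity -/

/-- The partial derivative `∂φ/∂xⁱ` of a real function. -/
noncomputable def partialD (i : Fin 3) (φ : Space → ℝ) (x : Space) : ℝ :=
  fderiv ℝ φ x (EuclideanSpace.single i 1)

theorem continuous_partialD {φ : Space → ℝ} (h : ContDiff ℝ 1 φ) (i : Fin 3) :
    Continuous (partialD i φ) :=
  (h.continuous_fderiv (by norm_num)).clm_apply continuous_const

theorem contDiff_partialD {φ : Space → ℝ} (h : ContDiff ℝ ∞ φ) (i : Fin 3) :
    ContDiff ℝ ∞ (partialD i φ) :=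
  (h.fderiv_right (m := ∞) (by simp)).clm_apply contDiff_const

theorem hasCompactSupport_partialD {φ : Space → ℝ} (h : HasCompactSupport φ) (i : Fin 3) :
    HasCompactSupport (partialD i φ) :=
  h.fderiv_apply ℝ _

theorem partialD_mul {φ ψ : Space → ℝ} {x : Space} (hφ : DifferentiableAt ℝ φ x)
    (hψ : DifferentiableAt ℝ ψ x) (i : Fin 3) :
    partialD i (fun z => φ z * ψ z) x = φ x * partialD i ψ x + ψ x * partialD i φ x := by
  have : HasFDerivAt (fun z => φ z * ψ z) _ x := hφ.hasFDerivAt.mul hψ.hasFDerivAt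
  rw [partialD, this.fderiv]
  simp [partialD]

theorem partialD_comm {φ : Space → ℝ} (h : ContDiff ℝ ∞ φ) (i j : Fin 3) (x : Space) :
    partialD i (partialD j φ) x = partialD j (partialD i φ) x := by
  have h2 : DifferentiableAt ℝ (fderiv ℝ φ) x :=
    (h.fderiv_right (m := ∞) (by simp)).differentiable (by simp) x
  have key : ∀ i j, partialD i (partialD j φ) x = fderiv ℝ (fderiv ℝ φ) x
      (EuclideanSpace.single i 1) (EuclideanSpace.single j 1) := fun i j => by
    have : HasFDerivAt (partialD j φ)
        ((ContinuousLinearMap.apply ℝ ℝ (EuclideanSpace.single j (1 : ℝ))) ∘L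
          fderiv ℝ (fderiv ℝ φ) x) x :=
      (ContinuousLinearMap.apply ℝ ℝ (EuclideanSpace.single j (1 : ℝ))).hasFDerivAt.comp x
        h2.hasFDerivAt
    rw [partialD, this.fderiv]
    simp
  rw [key, key]
  exact ((h.of_le (mod_cast le_top : ((2 : ℕ∞) : WithTop ℕ∞) ≤ ∞)).contDiffAt.isSymmSndFDerivAt
    (by simp)).eq _ _

theorem integral_partialD_eq_zero {φ : Space → ℝ} (h : ContDiff ℝ 1 φ) (hc : HasCompactSupport φ)
    (i : Fin 3) : ∫ x, partialD i φ x = 0 := by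
  have hi : Integrable fun x => fderiv ℝ φ x (EuclideanSpace.single i (1 : ℝ)) :=
    (continuous_partialD h i).integrable_of_hasCompactSupport (hasCompactSupport_partialD hc i)
  have := integral_mul_fderiv_eq_neg_fderiv_mul_of_integrable (μ := volume)
    (f := fun _ : Space => (1 : ℝ)) (g := φ) (v := EuclideanSpace.single i (1 : ℝ)) (by simp)
    (by simpa only [one_mul] using hi)
    (by simpa using h.continuous.integrable_of_hasCompactSupport hc) (by simp)
    (fun x _ => h.differentiable (by norm_num) x)
  simpa [partialD] using this

/-- Hardy's inequality in dimension three, regularized at the origin: the divergence of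
`v² x/(|x|² + ε)` has zero integral, and the term with the gradient of `v` is estimated by
completing the square. -/
theorem hardy_regularized {v : Space → ℝ} (hv : ContDiff ℝ ∞ v) (hc : HasCompactSupport v)
    {ε : ℝ} (hε : 0 < ε) :
    ∫ x, v x ^ 2 / (‖x‖ ^ 2 + ε) ≤ 4 * ∑ i, ∫ x, partialD i v x ^ 2 := by
  have hv1 : ContDiff ℝ 1 v := hv.of_le (by simp)
  have hs : ∀ x : Space, 0 < ‖x‖ ^ 2 + ε := fun x => by positivity
  have hsq : ContDiff ℝ 1 fun x : Space => ‖x‖ ^ 2 + ε := (contDiff_norm_sq ℝ).add contDiff_const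
  -- the components of the vector field `x / (|x|² + ε)`, whose divergence is at least
  -- `1 / (|x|² + ε)`
  let V : Fin 3 → Space → ℝ := fun i x => x i / (‖x‖ ^ 2 + ε)
  have hV : ∀ i, ContDiff ℝ 1 (V i) := fun i =>
    ContDiff.div (by fun_prop) hsq fun x => (hs x).ne'
  have hDV : ∀ i x, partialD i (V i) x =
      1 / (‖x‖ ^ 2 + ε) - 2 * x i ^ 2 / (‖x‖ ^ 2 + ε) ^ 2 := by
    intro i x
    have h1 : HasFDerivAt (fun x : Space => ‖x‖ ^ 2 + ε) (2 • innerSL ℝ x) x :=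
      (hasStrictFDerivAt_norm_sq x).hasFDerivAt.add_const ε
    have h2 : HasFDerivAt (fun x : Space => x i) (EuclideanSpace.proj (𝕜 := ℝ) i) x :=
      (EuclideanSpace.proj (𝕜 := ℝ) i).hasFDerivAt
    have h3 := h2.mul ((hasDerivAt_inv (hs x).ne').comp_hasFDerivAt x h1)
    have h4 : V i = (fun x : Space => x i) * (Inv.inv ∘ fun x : Space => ‖x‖ ^ 2 + ε) :=
      funext fun z => div_eq_mul_inv _ _
    rw [partialD, h4, h3.fderiv]
    have := (hs x).ne'
    simp only [add_apply, smul_apply, innerSL_apply_apply, PiLp.inner_apply]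
    simp
    field_simp
    ring
  have hcsq : HasCompactSupport fun x => v x ^ 2 :=
    hc.mono fun x hx h0 => hx (by simp [h0])
  have hI : ∀ i, ∫ x, partialD i (fun z => v z ^ 2 * V i z) x = 0 := fun i =>
    integral_partialD_eq_zero ((hv1.pow 2).mul (hV i)) hcsq.mul_right i
  have hD2 : ∀ i x, partialD i (fun z => v z ^ 2 * V i z) x =
      v x ^ 2 * partialD i (V i) x + 2 * v x * partialD i v x * V i x := by
    intro i x
    have hd := hv1.differentiable (by norm_num) x
    rw [partialD_mul (φ := fun z => v z ^ 2) (hd.pow 2) ((hV i).differentiable (by norm_num) x)]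
    simp_rw [pow_two]
    rw [partialD_mul hd hd]
    ring
  have hint : ∀ i, Integrable (partialD i (fun z => v z ^ 2 * V i z)) := fun i =>
    (continuous_partialD ((hv1.pow 2).mul (hV i)) i).integrable_of_hasCompactSupport
      (hasCompactSupport_partialD hcsq.mul_right i)
  have hsum : ∫ x, ∑ i, partialD i (fun z => v z ^ 2 * V i z) x = 0 := by
    rw [integral_finsetSum _ fun i _ => hint i]
    simp [hI]
  have hA : Integrable fun x => v x ^ 2 / (‖x‖ ^ 2 + ε) := by
    refine Continuous.integrable_of_hasCompactSupport
      ((hv.continuous.pow 2).div hsq.continuous fun x => (hs x).ne') ?_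
    exact hc.mono fun x hx h0 => hx (by simp [h0])
  have hG : ∀ i, Integrable fun x => partialD i v x ^ 2 := fun i =>
    ((continuous_partialD hv1 i).pow 2).integrable_of_hasCompactSupport
      ((hasCompactSupport_partialD hc i).mono fun x hx h0 => hx (by simp [h0]))
  have hpt : ∀ x, v x ^ 2 / (‖x‖ ^ 2 + ε) ≤ ∑ i, partialD i (fun z => v z ^ 2 * V i z) x +
      (1 / 2 * (v x ^ 2 / (‖x‖ ^ 2 + ε)) + 2 * ∑ i, partialD i v x ^ 2) := by
    intro x
    simp only [hD2, hDV, Fin.sum_univ_three, V]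
    have hn := norm_sq_eq x
    have hsx := hs x
    set s := ‖x‖ ^ 2 + ε with hsdef
    set p := partialD 0 v x
    set q := partialD 1 v x
    set r := partialD 2 v x
    set w := v x / s with hw
    have hv' : v x = w * s := by rw [hw]; field_simp
    have e1 : v x ^ 2 / s = w ^ 2 * s := by rw [hv']; field_simp
    have e2 : ∀ t : ℝ, v x ^ 2 * (1 / s - 2 * t ^ 2 / s ^ 2) = w ^ 2 * s - 2 * (w * t) ^ 2 := by
      intro t; rw [hv']; field_simp
    have e3 : ∀ d t : ℝ, 2 * v x * d * (t / s) = 2 * d * (w * t) := by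
      intro d t; rw [hv']; field_simp
    rw [e1, e2, e2, e2, e3, e3, e3]
    have hsn : x 0 ^ 2 + x 1 ^ 2 + x 2 ^ 2 ≤ s := by rw [← hn]; linarith
    have := mul_le_mul_of_nonneg_left hsn (sq_nonneg w)
    nlinarith [sq_nonneg (2 * p + w * x 0), sq_nonneg (2 * q + w * x 1),
      sq_nonneg (2 * r + w * x 2)]
  have hfin : ∫ x, v x ^ 2 / (‖x‖ ^ 2 + ε) ≤ 0 +
      (1 / 2 * (∫ x, v x ^ 2 / (‖x‖ ^ 2 + ε)) + 2 * ∑ i, ∫ x, partialD i v x ^ 2) := by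
    rw [← hsum, ← integral_finsetSum _ fun i _ => hG i, ← integral_const_mul, ← integral_const_mul,
      ← integral_add, ← integral_add]
    · refine integral_mono hA ?_ hpt
      exact (integrable_finsetSum _ fun i _ => hint i).add
        ((hA.const_mul _).add ((integrable_finsetSum _ fun i _ => hG i).const_mul _))
    · exact integrable_finsetSum _ fun i _ => hint i
    · exact (hA.const_mul _).add ((integrable_finsetSum _ fun i _ => hG i).const_mul _)
    · exact hA.const_mul _
    · exact (integrable_finsetSum _ fun i _ => hG i).const_mul _
  linarith

/-- The gradient of a compactly supported vector field is controlled by its curl and its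
divergence: `∫ ∂ᵢvⱼ ∂ⱼvᵢ = ∫ ∂ᵢvᵢ ∂ⱼvⱼ` after two integrations by parts. -/
theorem sum_integral_partialD_sq {v : Fin 3 → Space → ℝ} (hv : ∀ j, ContDiff ℝ ∞ (v j))
    (hc : ∀ j, HasCompactSupport (v j)) :
    ∑ i, ∑ j, ∫ x, partialD i (v j) x ^ 2 =
      1 / 2 * (∑ i, ∑ j, ∫ x, (partialD i (v j) x - partialD j (v i) x) ^ 2) +
        ∫ x, (∑ i, partialD i (v i) x) ^ 2 := by
  have hv1 : ∀ j, ContDiff ℝ 1 (v j) := fun j => (hv j).of_le (by simp)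
  have hcont : ∀ i j, Continuous (partialD i (v j)) := fun i j => continuous_partialD (hv1 j) i
  have hint : ∀ i j k l, Integrable fun x => partialD i (v j) x * partialD k (v l) x :=
    fun i j k l => ((hcont i j).mul (hcont k l)).integrable_of_hasCompactSupport
      (hasCompactSupport_partialD (hc j) i).mul_right
  have hcomm : ∀ i j, ∫ x, partialD i (v j) x * partialD j (v i) x =
      ∫ x, partialD i (v i) x * partialD j (v j) x := by
    intro i j
    have hd : ∀ j x, DifferentiableAt ℝ (v j) x := fun j x =>
      (hv1 j).differentiable (by norm_num) x
    have hd' : ∀ i j x, DifferentiableAt ℝ (partialD i (v j)) x := fun i j x =>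
      (contDiff_partialD (hv j) i).differentiable (by simp) x
    have hC : ∀ i j k, ContDiff ℝ 1 fun z => v j z * partialD i (v k) z := fun i j k =>
      (hv1 j).mul ((contDiff_partialD (hv k) i).of_le (by simp))
    have hS : ∀ i j k, HasCompactSupport fun z => v j z * partialD i (v k) z := fun i j k =>
      (hc j).mul_right
    have h1 := integral_partialD_eq_zero (hC j j i) (hS j j i) i
    have h2 := integral_partialD_eq_zero (hC i j i) (hS i j i) j
    have I : ∀ i j k l, Integrable (partialD l fun z => v j z * partialD i (v k) z) :=
      fun i j k l => (continuous_partialD (hC i j k) l).integrable_of_hasCompactSupport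
        (hasCompactSupport_partialD (hS i j k) l)
    have h3 : ∫ x, (partialD i (v j) x * partialD j (v i) x -
        partialD i (v i) x * partialD j (v j) x) = 0 := by
      rw [← sub_zero (0 : ℝ)]
      nth_rewrite 1 [← h1]
      rw [← h2, ← integral_sub (I j j i i) (I i j i j)]
      refine integral_congr_ae (Filter.Eventually.of_forall fun x => ?_)
      simp only
      rw [partialD_mul (hd j x) (hd' j i x), partialD_mul (hd j x) (hd' i i x),
        partialD_comm (hv i) i j]
      ring
    rwa [integral_sub (hint i j j i) (hint i i j j), sub_eq_zero] at h3
  have hsq : ∀ i j, Integrable fun x => partialD i (v j) x ^ 2 := fun i j => by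
    simpa only [pow_two] using hint i j i j
  have e1 : ∀ i j, ∫ x, (partialD i (v j) x - partialD j (v i) x) ^ 2 =
      (∫ x, partialD i (v j) x ^ 2) + (∫ x, partialD j (v i) x ^ 2) -
        2 * ∫ x, partialD i (v i) x * partialD j (v j) x := by
    intro i j
    rw [← hcomm, ← integral_const_mul, ← integral_add (hsq i j) (hsq j i), ← integral_sub]
    · congr 1
      ext x
      ring
    · exact (hsq i j).add (hsq j i)
    · exact (hint i j j i).const_mul 2
  have e2 : ∫ x, (∑ i, partialD i (v i) x) ^ 2 =
      ∑ i, ∑ j, ∫ x, partialD i (v i) x * partialD j (v j) x := by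
    simp only [pow_two, Finset.sum_mul_sum]
    rw [integral_finsetSum _ fun i _ => integrable_finsetSum _ fun j _ => hint i i j j]
    exact Finset.sum_congr rfl fun i _ => integral_finsetSum _ fun j _ => hint i i j j
  rw [e2]
  simp only [e1, Fin.sum_univ_three]
  ring

/-! ### Mollification -/

open Convolution in
/-- The convolution `ρ * f`. -/
noncomputable def mollify (ρ f : Space → ℝ) : Space → ℝ :=
  ρ ⋆[ContinuousLinearMap.lsmul ℝ ℝ, volume] f

theorem mollify_apply (ρ f : Space → ℝ) (x : Space) : mollify ρ f x = ∫ t, ρ t * f (x - t) := rfl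

theorem mollify_apply' (ρ f : Space → ℝ) (x : Space) : mollify ρ f x = ∫ y, ρ (x - y) * f y := by
  rw [mollify, convolution_eq_swap]
  rfl

theorem contDiff_mollify {ρ f : Space → ℝ} (hρ : ContDiff ℝ ∞ ρ) (hc : HasCompactSupport ρ)
    (hf : LocallyIntegrable f) : ContDiff ℝ ∞ (mollify ρ f) :=
  hc.contDiff_convolution_left _ hρ hf

theorem hasCompactSupport_mollify {ρ f : Space → ℝ} (hc : HasCompactSupport ρ)
    (hf : HasCompactSupport f) : HasCompactSupport (mollify ρ f) :=
  HasCompactSupport.convolution _ hc hf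

theorem integrable_mul_of_locallyIntegrable {φ f : Space → ℝ} (hφ : Continuous φ)
    (hc : HasCompactSupport φ) (hf : LocallyIntegrable f) : Integrable fun y => φ y * f y := by
  have := hf.integrable_smul_left_of_hasCompactSupport hφ hc
  exact this

/-- A derivative of a mollification is a weak derivative tested against the translated kernel. -/
theorem partialD_mollify {ρ f : Space → ℝ} (hρ : ContDiff ℝ ∞ ρ) (hc : HasCompactSupport ρ)
    (hf : LocallyIntegrable f) (i : Fin 3) (x : Space) :
    partialD i (mollify ρ f) x = -∫ y, partialD i (fun z => ρ (x - z)) y * f y := by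
  have h1 : ContDiff ℝ 1 ρ := hρ.of_le (by simp)
  have h := hc.hasFDerivAt_convolution_left (ContinuousLinearMap.lsmul ℝ ℝ) (μ := volume) h1 hf x
  have h2 : HasFDerivAt (mollify ρ f) _ x := h
  have hd : ∀ y, partialD i (fun z => ρ (x - z)) y = -partialD i ρ (x - y) := by
    intro y
    have h3 : HasFDerivAt (fun z => ρ (x - z)) _ y :=
      (h1.differentiable (by norm_num) (x - y)).hasFDerivAt.comp y
        ((hasFDerivAt_id (𝕜 := ℝ) y).const_sub x)
    rw [partialD, h3.fderiv]
    simp [partialD]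
  have hce : ConvolutionExistsAt (fderiv ℝ ρ) f x
      ((ContinuousLinearMap.lsmul ℝ ℝ).precompL Space) volume :=
    (hc.fderiv ℝ).convolutionExists_left _ (h1.continuous_fderiv (by norm_num)) hf x
  rw [partialD, h2.fderiv, convolution, ContinuousLinearMap.integral_apply hce]
  rw [← integral_sub_left_eq_self _ volume x, ← integral_neg]
  congr 1
  ext y
  rw [hd]
  simp [partialD, ContinuousLinearMap.precompL_apply]

/-- Convolution with a probability density is a contraction of `L²`, by Jensen's inequality. -/
theorem mollify_sq_le {ρ f : Space → ℝ} (hρ : ContDiff ℝ ∞ ρ) (hc : HasCompactSupport ρ)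
    (h0 : ∀ x, 0 ≤ ρ x) (h1 : ∫ x, ρ x = 1) (hf : MemLp f 2) :
    Integrable (fun x => mollify ρ f x ^ 2) ∧ ∫ x, mollify ρ f x ^ 2 ≤ ∫ x, f x ^ 2 := by
  have hf2 : Integrable fun x => f x ^ 2 := hf.integrable_sq
  have hfl : LocallyIntegrable f := hf.locallyIntegrable (by norm_num)
  have hρi : Integrable ρ := hρ.continuous.integrable_of_hasCompactSupport hc
  have hx : ∀ x, mollify ρ f x ^ 2 ≤ mollify ρ (fun y => f y ^ 2) x := by
    intro x
    set m := mollify ρ f x with hm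
    have e1 : Integrable fun t => ρ t * f (x - t) :=
      hc.convolutionExists_left (ContinuousLinearMap.lsmul ℝ ℝ) hρ.continuous hfl x
    have e2 : Integrable fun t => ρ t * f (x - t) ^ 2 :=
      hc.convolutionExists_left (ContinuousLinearMap.lsmul ℝ ℝ) hρ.continuous
        hf2.locallyIntegrable x
    -- the variance of `f (x - ·)` with respect to the density `ρ` is nonnegative
    have e3 : 0 ≤ ∫ t, ρ t * (f (x - t) - m) ^ 2 :=
      integral_nonneg fun t => mul_nonneg (h0 t) (sq_nonneg _)
    have e4 : ∫ t, ρ t * (f (x - t) - m) ^ 2 =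
        (∫ t, ρ t * f (x - t) ^ 2) - 2 * m * (∫ t, ρ t * f (x - t)) + m ^ 2 * ∫ t, ρ t := by
      have e5 : Integrable fun t => ρ t * f (x - t) ^ 2 - 2 * m * (ρ t * f (x - t)) :=
        e2.sub (e1.const_mul _)
      rw [← integral_const_mul, ← integral_const_mul, ← integral_sub e2 (e1.const_mul _),
        ← integral_add e5 (hρi.const_mul _)]
      congr 1
      ext t
      ring
    rw [e4, h1, ← mollify_apply ρ f, ← mollify_apply ρ fun y => f y ^ 2, ← hm] at e3
    nlinarith
  have hi : Integrable (mollify ρ fun y => f y ^ 2) := hρi.integrable_convolution _ hf2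
  have hI : Integrable fun x => mollify ρ f x ^ 2 := by
    refine hi.mono' ((contDiff_mollify hρ hc hfl).continuous.pow 2).aestronglyMeasurable
      (Filter.Eventually.of_forall fun x => ?_)
    rw [Real.norm_of_nonneg (sq_nonneg _)]
    exact hx x
  refine ⟨hI, (integral_mono hI hi hx).trans_eq ?_⟩
  have := integral_convolution (ContinuousLinearMap.lsmul ℝ ℝ) hρi hf2
  rw [h1] at this
  simpa [mollify] using this

/-- A compactly supported square integrable vector field on three-space whose weak curl and weak
divergence are square integrable lies in the Sobolev space `H¹`, so that it satisfies Hardy's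
inequality. Here the estimate for smooth fields is applied to mollifications, with a bound that does
not depend on the mollifier, and carried to the limit by Fatou's lemma. -/
theorem integrable_sq_div_norm_sq {u : Fin 3 → Space → ℝ} (hu : ∀ j, MemLp (u j) 2)
    (hc : ∀ j, HasCompactSupport (u j))
    (hcurl : ∀ i j, ∃ f : Space → ℝ, MemLp f 2 ∧ ∀ φ : Space → ℝ, ContDiff ℝ ∞ φ →
      HasCompactSupport φ → ∫ x, (partialD i φ x * u j x - partialD j φ x * u i x) = ∫ x, φ x * f x)
    (hdiv : ∃ g : Space → ℝ, MemLp g 2 ∧ ∀ φ : Space → ℝ, ContDiff ℝ ∞ φ →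
      HasCompactSupport φ → ∫ x, ∑ i, partialD i φ x * u i x = ∫ x, φ x * g x) (j : Fin 3) :
    Integrable fun x => u j x ^ 2 / ‖x‖ ^ 2 := by
  choose f hf2 hf using hcurl
  obtain ⟨g, hg2, hg⟩ := hdiv
  have hul : ∀ j, LocallyIntegrable (u j) := fun j => (hu j).locallyIntegrable (by norm_num)
  set K : ℝ := 4 * (1 / 2 * (∑ i, ∑ j, ∫ x, f i j x ^ 2) + ∫ x, g x ^ 2) with hK
  have hbound : ∀ ρ : Space → ℝ, ContDiff ℝ ∞ ρ → HasCompactSupport ρ → (∀ x, 0 ≤ ρ x) →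
      ∫ x, ρ x = 1 → ∀ ε, 0 < ε → ∫ x, mollify ρ (u j) x ^ 2 / (‖x‖ ^ 2 + ε) ≤ K := by
    intro ρ hρ hρc h0 h1 ε hε
    have hv : ∀ j, ContDiff ℝ ∞ (mollify ρ (u j)) := fun j => contDiff_mollify hρ hρc (hul j)
    have hvc : ∀ j, HasCompactSupport (mollify ρ (u j)) := fun j =>
      hasCompactSupport_mollify hρc (hc j)
    have hφ : ∀ x, ContDiff ℝ ∞ fun y => ρ (x - y) := fun x =>
      hρ.comp (contDiff_const.sub contDiff_id)
    have hφc : ∀ x, HasCompactSupport fun y => ρ (x - y) := fun x =>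
      hρc.comp_homeomorph (Homeomorph.subLeft x)
    have hint : ∀ x i j, Integrable fun y => partialD i (fun z => ρ (x - z)) y * u j y :=
      fun x i j => integrable_mul_of_locallyIntegrable
        (continuous_partialD ((hφ x).of_le (by simp)) i)
        (hasCompactSupport_partialD (hφc x) i) (hul j)
    have hC : ∀ i j x, (partialD i (mollify ρ (u j)) x - partialD j (mollify ρ (u i)) x) ^ 2 =
        mollify ρ (f i j) x ^ 2 := by
      intro i j x
      rw [partialD_mollify hρ hρc (hul j), partialD_mollify hρ hρc (hul i), mollify_apply',
        ← hf i j _ (hφ x) (hφc x), integral_sub (hint x i j) (hint x j i)]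
      ring
    have hD : ∀ x, (∑ i, partialD i (mollify ρ (u i)) x) ^ 2 = mollify ρ g x ^ 2 := by
      intro x
      simp only [partialD_mollify hρ hρc (hul _)]
      rw [mollify_apply', ← hg _ (hφ x) (hφc x), integral_finsetSum _ fun i _ => hint x i i,
        Finset.sum_neg_distrib, neg_sq]
    refine (hardy_regularized (hv j) (hvc j) hε).trans ?_
    rw [hK]
    refine mul_le_mul_of_nonneg_left ?_ (by norm_num)
    calc ∑ i, ∫ x, partialD i (mollify ρ (u j)) x ^ 2
        ≤ ∑ i, ∑ j, ∫ x, partialD i (mollify ρ (u j)) x ^ 2 :=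
          Finset.sum_le_sum fun i _ => Finset.single_le_sum
            (f := fun j => ∫ x, partialD i (mollify ρ (u j)) x ^ 2)
            (fun j _ => integral_nonneg fun x => sq_nonneg _) (Finset.mem_univ j)
      _ = _ := sum_integral_partialD_sq hv hvc
      _ ≤ _ := by
        simp only [hC, hD]
        refine add_le_add (mul_le_mul_of_nonneg_left (Finset.sum_le_sum fun i _ =>
          Finset.sum_le_sum fun j _ => ?_) (by norm_num)) ?_
        · exact (mollify_sq_le hρ hρc h0 h1 (hf2 _ _)).2
        · exact (mollify_sq_le hρ hρc h0 h1 hg2).2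
  -- mollifiers that concentrate at the origin
  let ψ : ℕ → ContDiffBump (0 : Space) := fun n =>
    ⟨1 / ((n : ℝ) + 1) / 2, 1 / ((n : ℝ) + 1), by positivity, by
      have : (0 : ℝ) < 1 / ((n : ℝ) + 1) := by positivity
      linarith⟩
  have hψ : Filter.Tendsto (fun n => (ψ n).rOut) Filter.atTop (nhds 0) :=
    tendsto_one_div_add_atTop_nhds_zero_nat
  have hlim : ∀ᵐ x, Filter.Tendsto (fun n => mollify ((ψ n).normed volume) (u j) x) Filter.atTop
      (nhds (u j x)) :=
    ContDiffBump.ae_convolution_tendsto_right_of_locallyIntegrable (K := 2) hψ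
      (Filter.Eventually.of_forall fun n => by
        change 1 / ((n : ℝ) + 1) ≤ 2 * (1 / ((n : ℝ) + 1) / 2)
        linarith) (hul j)
  have hsm : ∀ n, Continuous (mollify ((ψ n).normed volume) (u j)) := fun n =>
    (contDiff_mollify (ψ n).contDiff_normed (ψ n).hasCompactSupport_normed (hul j)).continuous
  have hε : ∀ n : ℕ, (0 : ℝ) < 1 / ((n : ℝ) + 1) := fun n => by positivity
  let w : ℕ → Space → ℝ := fun n x =>
    mollify ((ψ n).normed volume) (u j) x ^ 2 / (‖x‖ ^ 2 + 1 / ((n : ℝ) + 1))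
  have hw0 : ∀ n x, 0 ≤ w n x := fun n x =>
    div_nonneg (sq_nonneg _) (add_nonneg (sq_nonneg _) (hε n).le)
  have hwc : ∀ n, Continuous (w n) := fun n =>
    ((hsm n).pow 2).div (by fun_prop) fun x =>
      (add_pos_of_nonneg_of_pos (sq_nonneg _) (hε n)).ne'
  have hwlim : ∀ᵐ x : Space, Filter.Tendsto (fun n => w n x) Filter.atTop
      (nhds (u j x ^ 2 / ‖x‖ ^ 2)) := by
    have hne : ∀ᵐ x : Space, x ≠ 0 := by simp [ae_iff]
    filter_upwards [hlim, hne] with x hx hx0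
    refine (hx.pow 2).div ?_ (by simpa using hx0)
    simpa using tendsto_const_nhds.add (tendsto_one_div_add_atTop_nhds_zero_nat (𝕜 := ℝ))
  have hmeas : AEStronglyMeasurable (fun x => u j x ^ 2 / ‖x‖ ^ 2) volume :=
    aestronglyMeasurable_of_tendsto_ae _ (fun n => (hwc n).aestronglyMeasurable) hwlim
  refine ⟨hmeas, ?_⟩
  rw [hasFiniteIntegral_iff_ofReal (Filter.Eventually.of_forall fun x => by positivity)]
  calc ∫⁻ x, ENNReal.ofReal (u j x ^ 2 / ‖x‖ ^ 2)
      = ∫⁻ x, Filter.liminf (fun n => ENNReal.ofReal (w n x)) Filter.atTop := by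
        refine lintegral_congr_ae ?_
        filter_upwards [hwlim] with x hx
        exact (ENNReal.tendsto_ofReal hx).liminf_eq.symm
    _ ≤ Filter.liminf (fun n => ∫⁻ x, ENNReal.ofReal (w n x)) Filter.atTop :=
        lintegral_liminf_le fun n => (hwc n).measurable.ennreal_ofReal
    _ ≤ ENNReal.ofReal K := by
        refine Filter.liminf_le_of_le (by isBoundedDefault) fun b hb => ?_
        obtain ⟨n, hn⟩ := hb.exists
        refine hn.trans ?_
        rw [← ofReal_integral_eq_lintegral_ofReal]
        · exact ENNReal.ofReal_le_ofReal (hbound _ (ψ n).contDiff_normed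
            (ψ n).hasCompactSupport_normed (ψ n).nonneg_normed (ψ n).integral_normed _ (hε n))
        · refine (hwc n).integrable_of_hasCompactSupport ?_
          have h1 : HasCompactSupport (mollify ((ψ n).normed volume) (u j)) :=
            hasCompactSupport_mollify (ψ n).hasCompactSupport_normed (hc j)
          exact h1.mono fun x hx h0 => hx (by simp [w, h0])
        · exact Filter.Eventually.of_forall (hw0 n)
    _ < ⊤ := ENNReal.ofReal_lt_top

/-! ### Localization near the origin -/

theorem integrable_mul_of_hasCompactSupport {μ : Measure Space} {φ w : Space → ℝ}
    (hφ : Continuous φ) (hc : HasCompactSupport φ) (hw : Integrable w μ) :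
    Integrable (fun x => φ x * w x) μ := by
  obtain ⟨C, hC⟩ := hφ.bounded_above_of_compact_support hc
  refine (hw.norm.const_mul C).mono' (hφ.aestronglyMeasurable.mul hw.1)
    (Filter.Eventually.of_forall fun x => ?_)
  rw [norm_mul]
  gcongr
  exact hC x

/-- Extension by zero of the product of a square integrable function on `U` with a continuous
function that is compactly supported in `U`. -/
theorem memLp_mul_of_tsupport_subset {U : Set Space} (hU : MeasurableSet U) {φ w : Space → ℝ}
    (hφ : Continuous φ) (hc : HasCompactSupport φ) (hs : tsupport φ ⊆ U)
    (hw : MemLp w 2 (volume.restrict U)) : MemLp (fun x => φ x * w x) 2 := by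
  obtain ⟨C, hC⟩ := hφ.bounded_above_of_compact_support hc
  have h1 : MemLp (fun x => φ x * w x) 2 (volume.restrict U) := by
    refine hw.of_le_mul (c := C) (hφ.aestronglyMeasurable.mul hw.1)
      (Filter.Eventually.of_forall fun x => ?_)
    rw [norm_mul]
    gcongr
    exact hC x
  have h2 := (memLp_indicator_iff_restrict hU).2 h1
  refine (congrArg (MemLp · 2 volume) (funext fun x => ?_)).mp h2
  by_cases hx : x ∈ U
  · simp [hx]
  · simp [hx, image_eq_zero_of_notMem_tsupport fun h => hx (hs h)]

/-- Localization of the weak equation `div w = -b` on `U` by a cutoff function. -/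
theorem exists_weakDiv_mul {U : Set Space} (hU : MeasurableSet U) {w : Fin 3 → Space → ℝ}
    {b χ : Space → ℝ} (hw : ∀ i, MemLp (w i) 2 (volume.restrict U))
    (hwi : ∀ i, IntegrableOn (w i) U)
    (hb : MemLp b 2 (volume.restrict U)) (hbi : IntegrableOn b U) (hχ : ContDiff ℝ ∞ χ)
    (hχc : HasCompactSupport χ) (hχs : tsupport χ ⊆ U)
    (h : ∀ φ : Space → ℝ, ContDiff ℝ ∞ φ → HasCompactSupport φ → tsupport φ ⊆ U →
      ∫ x in U, ∑ i, partialD i φ x * w i x = ∫ x in U, φ x * b x) :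
    ∃ f : Space → ℝ, MemLp f 2 ∧ ∀ φ : Space → ℝ, ContDiff ℝ ∞ φ → HasCompactSupport φ →
      ∫ x, ∑ i, partialD i φ x * (χ x * w i x) = ∫ x, φ x * f x := by
  have hχ1 : ContDiff ℝ 1 χ := hχ.of_le (by simp)
  have hDs : ∀ i, tsupport (partialD i χ) ⊆ tsupport χ := fun i =>
    tsupport_fderiv_apply_subset ℝ _
  refine ⟨fun x => χ x * b x - ∑ i, partialD i χ x * w i x, ?_, fun φ hφ hφc => ?_⟩
  · refine (memLp_mul_of_tsupport_subset hU hχ.continuous hχc hχs hb).sub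
      (memLp_finsetSum _ fun i _ => ?_)
    exact memLp_mul_of_tsupport_subset hU (continuous_partialD hχ1 i)
      (hasCompactSupport_partialD hχc i) ((hDs i).trans hχs) (hw i)
  · have hφ1 : ContDiff ℝ 1 φ := hφ.of_le (by simp)
    have h0 : ∀ x, x ∉ U → χ x = 0 := fun x hx =>
      image_eq_zero_of_notMem_tsupport fun h => hx (hχs h)
    have h0' : ∀ i x, x ∉ U → partialD i χ x = 0 := fun i x hx =>
      image_eq_zero_of_notMem_tsupport fun h => hx (hχs (hDs i h))
    rw [← setIntegral_eq_integral_of_forall_compl_eq_zero (s := U) (f := fun x => ∑ i, _)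
        fun x hx => by simp [h0 x hx],
      ← setIntegral_eq_integral_of_forall_compl_eq_zero (s := U) (f := fun x => φ x * _)
        fun x hx => by simp [h0 x hx, h0' _ x hx]]
    have hpt : ∀ x, ∑ i, partialD i φ x * (χ x * w i x) =
        (∑ i, partialD i (fun z => χ z * φ z) x * w i x) -
          φ x * ∑ i, partialD i χ x * w i x := by
      intro x
      rw [Finset.mul_sum, ← Finset.sum_sub_distrib]
      refine Finset.sum_congr rfl fun i _ => ?_
      rw [partialD_mul (hχ1.differentiable (by norm_num) x) (hφ1.differentiable (by norm_num) x)]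
      ring
    have hi1 : IntegrableOn (fun x => ∑ i, partialD i (fun z => χ z * φ z) x * w i x) U :=
      integrable_finsetSum _ fun i _ => integrable_mul_of_hasCompactSupport
        (continuous_partialD (hχ1.mul hφ1) i) (hasCompactSupport_partialD hχc.mul_right i) (hwi i)
    have hi2 : IntegrableOn (fun x => φ x * ∑ i, partialD i χ x * w i x) U :=
      integrable_mul_of_hasCompactSupport hφ.continuous hφc (integrable_finsetSum _ fun i _ =>
        integrable_mul_of_hasCompactSupport (continuous_partialD hχ1 i)
          (hasCompactSupport_partialD hχc i) (hwi i))
    have hi3 : IntegrableOn (fun x => φ x * (χ x * b x)) U :=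
      integrable_mul_of_hasCompactSupport hφ.continuous hφc
        (integrable_mul_of_hasCompactSupport hχ.continuous hχc hbi)
    simp only [hpt, mul_sub]
    rw [integral_sub hi1 hi2, integral_sub hi3 hi2,
      h _ (hχ.mul hφ) hχc.mul_right ((tsupport_mul_subset_left).trans hχs)]
    congr 2
    ext x
    ring

/-- The gradient of a function, in components. -/
noncomputable def gradient (φ : Space → ℝ) (x : Space) : Fin 3 → ℝ := fun i => partialD i φ x

theorem curl_smul_const {φ : Space → ℝ} {x : Space} (hφ : DifferentiableAt ℝ φ x)
    (a : Fin 3 → ℝ) : curl (fun z => φ z • a) x = crossProduct (gradient φ x) a := by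
  rw [curl_smul hφ.hasFDerivAt (differentiableAt_const a)]
  have : curl (fun _ : Space => a) x = 0 := by
    ext i
    fin_cases i <;> simp [curl, pd]
  rw [this, smul_zero, zero_add]
  rfl

/-- Near the origin, a square integrable solution of `curl E = -B`, `div E = 0` with square
integrable `B` satisfies `E / |x| ∈ L²`. -/
theorem integrableOn_sq_div_norm_sq_of_weak_curl {E B : Space → Fin 3 → ℂ} {r : ℝ} (hr : 0 < r)
    (hE : MemLp E 2 (volume.restrict (Metric.ball 0 r)))
    (hB : MemLp B 2 (volume.restrict (Metric.ball 0 r)))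
    (hcurl : ∀ h ∈ compactTests (Metric.ball 0 r), ∫ x in Metric.ball 0 r, pairing h E B x = 0)
    (hdiv : ∀ φ : Space → ℝ, ContDiff ℝ ∞ φ → HasCompactSupport φ → tsupport φ ⊆ Metric.ball 0 r →
      ∫ x in Metric.ball 0 r, rdot (gradient φ x) (E x) = 0) (j : Fin 3) :
    IntegrableOn (fun x => ‖E x j‖ ^ 2 / ‖x‖ ^ 2) (Metric.ball 0 (r / 4)) := by
  set U : Set Space := Metric.ball 0 r with hUdef
  have hU : MeasurableSet U := Metric.isOpen_ball.measurableSet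
  have : IsFiniteMeasure (volume.restrict U) := ⟨by
    rw [Measure.restrict_apply_univ]; exact measure_ball_lt_top⟩
  have hEi : IntegrableOn E U := hE.integrable (by norm_num)
  have hBi : IntegrableOn B U := hB.integrable (by norm_num)
  let χ : ContDiffBump (0 : Space) := ⟨r / 4, r / 2, by linarith, by linarith⟩
  have hχs : tsupport χ ⊆ U := by
    rw [χ.tsupport_eq]
    exact Metric.closedBall_subset_ball (by change r / 2 < r; linarith)
  have hgrad : ∀ {φ : Space → ℝ}, ContDiff ℝ ∞ φ → HasCompactSupport φ →
      Continuous (gradient φ) ∧ HasCompactSupport (gradient φ) := fun {φ} hφ hφc => by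
    refine ⟨continuous_pi fun i => continuous_partialD (hφ.of_le (by simp)) i, ?_⟩
    refine hφc.mono' fun x hx => by_contra fun hn => hx ?_
    ext i
    rw [gradient, Pi.zero_apply, partialD,
      image_eq_zero_of_notMem_tsupport fun h => hn (tsupport_fderiv_subset ℝ h)]
    rfl
  -- the argument applies to the real and to the imaginary parts
  have main : ∀ L : ℂ →L[ℝ] ℝ, IntegrableOn (fun x => L (E x j) ^ 2 / ‖x‖ ^ 2)
      (Metric.ball 0 (r / 4)) := by
    intro L
    have hLm : ∀ (c : ℝ) (z : ℂ), L ((c : ℂ) * z) = c * L z := fun c z => by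
      rw [← Complex.real_smul, map_smul, smul_eq_mul]
    have hLp : ∀ {V : Space → Fin 3 → ℂ}, MemLp V 2 (volume.restrict U) → ∀ i,
        MemLp (fun x => L (V x i)) 2 (volume.restrict U) := fun {V} hV i =>
      (L ∘L (ContinuousLinearMap.proj i : (Fin 3 → ℂ) →L[ℝ] ℂ)).comp_memLp' hV
    have hLi : ∀ {V : Space → Fin 3 → ℂ}, MemLp V 2 (volume.restrict U) → ∀ i,
        IntegrableOn (fun x => L (V x i)) U := fun {V} hV i => (hLp hV i).integrable (by norm_num)
    -- the components of the curl equation, with indices modulo `3`, from test forms `φ dxᵏ`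
    have key : ∀ (k : Fin 3) (φ : Space → ℝ), ContDiff ℝ ∞ φ → HasCompactSupport φ →
        tsupport φ ⊆ U → ∫ x in U, (partialD (k + 1) φ x * L (E x (k + 2)) -
          partialD (k + 2) φ x * L (E x (k + 1))) = ∫ x in U, φ x * L (B x k) := by
      intro k φ hφ hφc hφs
      have hh : (fun x => φ x • (Pi.single k 1 : Fin 3 → ℝ)) ∈ compactTests U :=
        ⟨hφ.smul contDiff_const, HasCompactSupport.smul_right (f := φ) hφc,
          (tsupport_smul_subset_left φ _).trans hφs⟩
      have h1 := hcurl _ hh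
      have h2 : IntegrableOn (pairing _ E B) U :=
        integrableOn_pairing hh.1 hh.2.1 hEi (hBi.mono_set Set.inter_subset_right)
      have h3 := L.integral_comp_comm h2
      rw [h1, map_zero] at h3
      have h4 : ∀ i l, IntegrableOn (fun x => partialD i φ x * L (E x l)) U := fun i l =>
        integrable_mul_of_hasCompactSupport (continuous_partialD (hφ.of_le (by simp)) _)
          (hasCompactSupport_partialD hφc _) (hLi hE _)
      have h5 : IntegrableOn (fun x => φ x * L (B x k)) U :=
        integrable_mul_of_hasCompactSupport hφ.continuous hφc (hLi hB k)
      have h6 : IntegrableOn (fun x => partialD (k + 1) φ x * L (E x (k + 2)) -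
          partialD (k + 2) φ x * L (E x (k + 1))) U := (h4 _ _).sub (h4 _ _)
      rw [← sub_eq_zero, ← integral_sub h6 h5, ← neg_eq_zero, ← integral_neg, ← h3]
      congr 1
      ext x
      rw [pairing, curl_smul_const (hφ.differentiable (by simp) x), map_add]
      fin_cases k <;>
        simp [rdot, cross_apply, Fin.sum_univ_three, gradient, hLm] <;> ring
    have hcurl' : ∀ i j, ∃ b : Space → ℝ, MemLp b 2 (volume.restrict U) ∧
        ∀ φ : Space → ℝ, ContDiff ℝ ∞ φ → HasCompactSupport φ → tsupport φ ⊆ U →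
          ∫ x in U, (partialD i φ x * L (E x j) - partialD j φ x * L (E x i)) =
            ∫ x in U, φ x * b x := by
      have hpos := fun k => (⟨_, hLp hB k, key k⟩ : ∃ b : Space → ℝ,
        MemLp b 2 (volume.restrict U) ∧
        ∀ φ : Space → ℝ, ContDiff ℝ ∞ φ → HasCompactSupport φ → tsupport φ ⊆ U →
          ∫ x in U, (partialD (k + 1) φ x * L (E x (k + 2)) -
            partialD (k + 2) φ x * L (E x (k + 1))) = ∫ x in U, φ x * b x)
      have hneg : ∀ k : Fin 3, ∃ b : Space → ℝ, MemLp b 2 (volume.restrict U) ∧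
        ∀ φ : Space → ℝ, ContDiff ℝ ∞ φ → HasCompactSupport φ → tsupport φ ⊆ U →
          ∫ x in U, (partialD (k + 2) φ x * L (E x (k + 1)) -
            partialD (k + 1) φ x * L (E x (k + 2))) = ∫ x in U, φ x * b x := fun k => by
        refine ⟨fun x => -L (B x k), (hLp hB k).neg, fun φ h1 h2 h3 => ?_⟩
        simp only [mul_neg]
        rw [integral_neg, ← key k φ h1 h2 h3, ← integral_neg]
        simp only [neg_sub]
      have hzero : ∀ k : Fin 3, ∃ b : Space → ℝ, MemLp b 2 (volume.restrict U) ∧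
        ∀ φ : Space → ℝ, ContDiff ℝ ∞ φ → HasCompactSupport φ → tsupport φ ⊆ U →
          ∫ x in U, (partialD k φ x * L (E x k) -
            partialD k φ x * L (E x k)) = ∫ x in U, φ x * b x := fun k =>
        ⟨0, MemLp.zero, fun φ h1 h2 h3 => by simp⟩
      intro i j
      fin_cases i <;> fin_cases j
      exacts [hzero 0, hpos 2, hneg 1, hneg 2, hzero 1, hpos 0, hpos 1, hneg 0, hzero 2]
    have hres := integrable_sq_div_norm_sq (u := fun j x => χ x * L (E x j))
      (fun j => memLp_mul_of_tsupport_subset hU χ.continuous χ.hasCompactSupport hχs (hLp hE j))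
      (fun j => χ.hasCompactSupport.mul_right) (fun i j => ?_) ?_ j
    · refine (hres.integrableOn (s := Metric.ball 0 (r / 4))).congr_fun (fun x hx => ?_)
        Metric.isOpen_ball.measurableSet
      have : χ x = 1 := χ.one_of_mem_closedBall (Metric.ball_subset_closedBall hx)
      simp [this]
    · obtain ⟨b, hb, hb'⟩ := hcurl' i j
      -- the `(i, j)` component of the curl is the divergence of the field with the component `Eⱼ`
      -- in the direction `i`, the component `-Eᵢ` in the direction `j`, and no third component
      have hLij : ∀ (i j l : Fin 3), MemLp (fun x => if l = i then L (E x j) else 0) 2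
          (volume.restrict U) := fun i j l => by
        split_ifs
        exacts [hLp hE j, MemLp.zero']
      have hw : ∀ l : Fin 3, MemLp (fun x => (if l = i then L (E x j) else 0) -
          if l = j then L (E x i) else 0) 2 (volume.restrict U) := fun l =>
        (hLij i j l).sub (hLij j i l)
      obtain ⟨f, hf, hf'⟩ := exists_weakDiv_mul hU hw (fun l => (hw l).integrable (by norm_num)) hb
        (hb.integrable (by norm_num)) χ.contDiff χ.hasCompactSupport hχs fun φ h1 h2 h3 => by
          rw [← hb' φ h1 h2 h3]
          simp [mul_sub, Finset.sum_sub_distrib]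
      refine ⟨f, hf, fun φ h1 h2 => ?_⟩
      rw [← hf' φ h1 h2]
      simp [mul_sub, Finset.sum_sub_distrib]
    · refine exists_weakDiv_mul hU (b := 0) (hLp hE) (hLi hE) MemLp.zero (integrable_zero _ _ _)
        χ.contDiff χ.hasCompactSupport hχs fun φ h1 h2 h3 => ?_
      have h4 := L.integral_comp_comm (integrable_rdot (hgrad h1 h2).1 (hgrad h1 h2).2 hEi)
      rw [hdiv φ h1 h2 h3, map_zero] at h4
      simp only [Pi.zero_apply, mul_zero, integral_zero]
      rw [← h4]
      simp [rdot, hLm, gradient]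
  refine ((main Complex.reCLM).add (main Complex.imCLM)).congr
    (Filter.Eventually.of_forall fun x => ?_)
  simp only [Pi.add_apply, Complex.reCLM_apply, Complex.imCLM_apply, ← add_div,
    Complex.sq_norm, Complex.normSq_apply]
  ring

/-! ### Pull-back of test forms -/

/-- The pull-back of a real 1-form by `Φ`, extended by zero outside `V`. -/
noncomputable def pullback (Φ : Space → Space) (V : Set Space) (h : Space → Fin 3 → ℝ) :
    Space → Fin 3 → ℝ :=
  V.indicator fun y => (jac Φ y)ᵀ *ᵥ h (Φ y)

/-- Pull-back by a diffeomorphism `Φ` of `V` onto `U`, with inverse `Ψ`, preserves compactly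
supported test forms. -/
theorem pullback_mem_compactTests {Φ Ψ : Space → Space} {U V : Set Space} (hV : IsOpen V)
    (hΦ : ∀ y ∈ V, ContDiffAt ℝ ∞ Φ y) (hΨ : ContinuousOn Ψ U) (hΨV : Set.MapsTo Ψ U V)
    (hinv : ∀ y ∈ V, Ψ (Φ y) = y) {h : Space → Fin 3 → ℝ} (hh : h ∈ compactTests U) :
    pullback Φ V h ∈ compactTests V := by
  obtain ⟨hs, hc, hU⟩ := hh
  have hK : IsCompact (Ψ '' tsupport h) := hc.isCompact.image_of_continuousOn (hΨ.mono hU)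
  have hKV : Ψ '' tsupport h ⊆ V := by
    rintro _ ⟨x, hx, rfl⟩
    exact hΨV (hU hx)
  have h0 : ∀ y, y ∉ Ψ '' tsupport h → pullback Φ V h y = 0 := by
    intro y hy
    by_cases hyV : y ∈ V
    · have : Φ y ∉ tsupport h := fun hx => hy ⟨Φ y, hx, hinv y hyV⟩
      simp [pullback, hyV, image_eq_zero_of_notMem_tsupport this]
    · simp [pullback, hyV]
  have hts : tsupport (pullback Φ V h) ⊆ Ψ '' tsupport h :=
    tsupport_subset_of_isClosed hK.isClosed h0
  refine ⟨contDiff_iff_contDiffAt.2 fun y => ?_, HasCompactSupport.intro hK h0, hts.trans hKV⟩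
  -- smoothness at the boundary of `V`: there the extension by zero vanishes identically
  by_cases hy : y ∈ tsupport (pullback Φ V h)
  swap
  · exact contDiffAt_const.congr_of_eventuallyEq (notMem_tsupport_iff_eventuallyEq.1 hy)
  have hyV := hKV (hts hy)
  have h1 : ContDiffAt ℝ ∞ (fun y => (jac Φ y)ᵀ *ᵥ h (Φ y)) y := by
    refine contDiffAt_pi.2 fun j => ?_
    simp only [Matrix.mulVec, dotProduct, Matrix.transpose_apply]
    refine ContDiffAt.sum fun p _ => ContDiffAt.mul ?_ ?_
    · have h2 : ContDiffAt ℝ ∞ (fun z => fderiv ℝ Φ z (EuclideanSpace.single j 1)) y :=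
        ((hΦ y hyV).fderiv_right (m := ∞) (by simp)).clm_apply contDiffAt_const
      exact (EuclideanSpace.proj (𝕜 := ℝ) p).contDiff.contDiffAt.comp y h2
    · exact (contDiff_pi.1 hs p).contDiffAt.comp y (hΦ y hyV)
  refine h1.congr_of_eventuallyEq ?_
  filter_upwards [hV.mem_nhds hyV] with z hz
  simp [pullback, hz]

theorem continuousOn_F₁ : ContinuousOn F₁ (M₁ \ {0}) := fun _ hx =>
  (contDiffAt_F₁ hx.2).continuousAt.continuousWithinAt

theorem continuousOn_G₁ : ContinuousOn G₁ N₁ := fun _ hy =>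
  (contDiffAt_G₁ (N₁_ne_zero hy)).continuousAt.continuousWithinAt

theorem pullback_G₁_mem {h : Space → Fin 3 → ℝ} (hh : h ∈ compactTests (M₁ \ {0})) :
    pullback G₁ N₁ h ∈ compactTests N₁ :=
  pullback_mem_compactTests isOpen_N₁ (fun _ hy => contDiffAt_G₁ (N₁_ne_zero hy)) continuousOn_F₁
    (fun _ hx => F₁_mem hx) (fun _ hy => F₁_G₁ (mem_N₁.1 hy).1) hh

theorem pullback_F₁_mem {h : Space → Fin 3 → ℝ} (hh : h ∈ compactTests N₁) :
    pullback F₁ (M₁ \ {0}) h ∈ compactTests (M₁ \ {0}) :=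
  pullback_mem_compactTests isOpen_M₁_diff (fun _ hx => contDiffAt_F₁ hx.2) continuousOn_G₁
    (fun _ hy => G₁_mem hy) (fun _ hx => G₁_F₁ hx.2) hh

theorem pullback_G₁_F₁ (h : Space → Fin 3 → ℝ) :
    Set.EqOn (pullback G₁ N₁ (pullback F₁ (M₁ \ {0}) h)) h N₁ := by
  intro y hy
  have hF := F₁_G₁ (mem_N₁.1 hy).1
  have h1 := jac_F₁_mul_jac_G₁ (G₁_mem hy)
  rw [hF] at h1
  simp only [pullback, Set.indicator_of_mem hy, Set.indicator_of_mem (G₁_mem hy), hF,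
    Matrix.mulVec_mulVec, ← Matrix.transpose_mul, h1, Matrix.transpose_one, Matrix.one_mulVec]

/-- The weak Maxwell equations are invariant under the change of variables: `Et` is the
push-forward of the 1-form `E` and `Bt` is the push-forward of the 2-form `B`. -/
theorem integral_pairing_pullback {E B Et Bt : Space → Fin 3 → ℂ}
    (hEt : ∀ y ∈ N₁, Et y = cmul (jac G₁ y)ᵀ (E (G₁ y)))
    (hBt : ∀ y ∈ N₁, Bt y = cmul (jac G₁ y).adjugate (B (G₁ y)))
    {h : Space → Fin 3 → ℝ} (hh : ContDiff ℝ ∞ h) :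
    ∫ y in N₁, pairing (pullback G₁ N₁ h) Et Bt y = ∫ x in M₁ \ {0}, pairing h E B x := by
  rw [integral_comp_G₁]
  refine setIntegral_congr_fun isOpen_N₁.measurableSet fun y hy => ?_
  have hev : pullback G₁ N₁ h =ᶠ[nhds y] fun y => (jac G₁ y)ᵀ *ᵥ h (G₁ y) := by
    filter_upwards [isOpen_N₁.mem_nhds hy] with z hz
    simp [pullback, hz]
  have hG : ContDiffAt ℝ 2 G₁ y :=
    (contDiffAt_G₁ (N₁_ne_zero hy)).of_le (mod_cast le_top : ((2 : ℕ∞) : WithTop ℕ∞) ≤ ∞)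
  simp only [pairing]
  rw [curl_congr hev, hev.eq_of_nhds, curl_pullback hG (hh.differentiable (by simp) _), hEt y hy,
    hBt y hy, rdot_adjugate, rdot_transpose, Complex.real_smul, mul_add]

/-- Away from the origin and from the cloaking surface, the weak equations on `N₁` and on `M₁` are
the same, since the pull-backs by `F₁` and `G₁` are inverse bijections between the test forms. -/
theorem forall_compactTests_N₁_iff {E B Et Bt : Space → Fin 3 → ℂ}
    (hEt : ∀ y ∈ N₁, Et y = cmul (jac G₁ y)ᵀ (E (G₁ y)))
    (hBt : ∀ y ∈ N₁, Bt y = cmul (jac G₁ y).adjugate (B (G₁ y))) :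
    (∀ h ∈ compactTests N₁, ∫ y in N₁, pairing h Et Bt y = 0) ↔
      ∀ h ∈ compactTests (M₁ \ {0}), ∫ x in M₁ \ {0}, pairing h E B x = 0 := by
  constructor
  · intro H h hh
    rw [← integral_pairing_pullback hEt hBt hh.1]
    exact H _ (pullback_G₁_mem hh)
  · intro H h hh
    rw [← H _ (pullback_F₁_mem hh), ← integral_pairing_pullback hEt hBt (pullback_F₁_mem hh).1]
    exact setIntegral_congr_fun isOpen_N₁.measurableSet
      (pairing_congr isOpen_N₁ (pullback_G₁_F₁ h).symm Et Bt)

/-! ### Bounds for the Jacobian matrix -/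

theorem norm_cmul_le {A : Matrix (Fin 3) (Fin 3) ℝ} {C : ℝ} (hA : ∀ i j, |A i j| ≤ C)
    (v : Fin 3 → ℂ) : ‖cmul A v‖ ≤ 3 * (C * ‖v‖) := by
  have hC : 0 ≤ C := (abs_nonneg _).trans (hA 0 0)
  rw [pi_norm_le_iff_of_nonneg (by positivity)]
  intro i
  have h : ∀ j, ‖(A i j : ℂ) * v j‖ ≤ C * ‖v‖ := fun j => by
    rw [norm_mul, Complex.norm_real]
    exact mul_le_mul (hA i j) (norm_le_pi_norm v j) (norm_nonneg _) hC
  simp only [cmul, Matrix.mulVec, dotProduct, Fin.sum_univ_three, Matrix.map_apply]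
  refine (norm_add₃_le).trans ?_
  linarith [h 0, h 1, h 2]

theorem abs_mul_coord_le (y : Space) (i j : Fin 3) : |y i * y j| ≤ ‖y‖ ^ 2 := by
  rw [abs_mul, pow_two]
  exact mul_le_mul (PiLp.norm_apply_le y i) (PiLp.norm_apply_le y j) (abs_nonneg _) (norm_nonneg _)

theorem abs_jac_G₁_le {y : Space} (hy : 1 < ‖y‖) (i j : Fin 3) : |jac G₁ y i j| ≤ 4 := by
  have h0 : y ≠ 0 := norm_pos_iff.1 (by linarith)
  have hi : ‖y‖⁻¹ < 1 := inv_lt_one_of_one_lt₀ hy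
  have hp : 0 < ‖y‖⁻¹ := by positivity
  rw [jac_G₁ h0]
  have h1 : |2 * ‖y‖⁻¹ ^ 3 * (y i * y j)| ≤ 2 := by
    rw [abs_mul, abs_of_pos (by positivity)]
    calc 2 * ‖y‖⁻¹ ^ 3 * |y i * y j| ≤ 2 * ‖y‖⁻¹ ^ 3 * ‖y‖ ^ 2 := by
          gcongr; exact abs_mul_coord_le y i j
      _ = 2 * ‖y‖⁻¹ := by field_simp
      _ ≤ 2 := by linarith
  have h2 : |(2 - 2 * ‖y‖⁻¹) * (if i = j then (1 : ℝ) else 0)| ≤ 2 := by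
    rw [abs_mul, abs_of_pos (by linarith : 0 < 2 - 2 * ‖y‖⁻¹)]
    split_ifs <;> simp
  exact (abs_add_le _ _).trans (by linarith)

/-- The adjugate has the eigenvalues `2 (2 - 2/|y|)` on the tangential directions and
`(2 - 2/|y|)²` in the radial direction; in particular it vanishes on the cloaking surface. -/
theorem adjugate_jac_G₁ {y : Space} (hy : y ≠ 0) (i j : Fin 3) : (jac G₁ y).adjugate i j =
    (2 - 2 * ‖y‖⁻¹) * (2 * (if i = j then 1 else 0) - 2 * ‖y‖⁻¹ ^ 3 * (y i * y j)) := by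
  have h : 0 < ‖y‖ := norm_pos_iff.2 hy
  have e : (2 : ℝ) = (2 - 2 * ‖y‖⁻¹) + 2 * ‖y‖⁻¹ ^ 3 * (y 0 ^ 2 + y 1 ^ 2 + y 2 ^ 2) := by
    rw [← norm_sq_eq]
    field_simp
    ring
  set a := 2 - 2 * ‖y‖⁻¹
  set b := 2 * ‖y‖⁻¹ ^ 3
  rw [Matrix.adjugate_fin_three]
  simp only [jac_G₁ hy]
  have e' : ∀ c : ℝ, a * (2 * c - b * (y i * y j)) =
      a * ((a + b * (y 0 ^ 2 + y 1 ^ 2 + y 2 ^ 2)) * c - b * (y i * y j)) := fun c => by rw [← e]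
  rw [e']
  fin_cases i <;> fin_cases j <;> simp <;> ring

theorem abs_adjugate_jac_G₁_le {y : Space} (hy : 1 < ‖y‖) (i j : Fin 3) :
    |(jac G₁ y).adjugate i j| ≤ 4 * (2 - 2 * ‖y‖⁻¹) := by
  have h0 : y ≠ 0 := norm_pos_iff.1 (by linarith)
  have hi : ‖y‖⁻¹ < 1 := inv_lt_one_of_one_lt₀ hy
  have hp : 0 < ‖y‖⁻¹ := by positivity
  rw [adjugate_jac_G₁ h0, abs_mul, abs_of_pos (by linarith : 0 < 2 - 2 * ‖y‖⁻¹), mul_comm]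
  have h1 : |2 * ‖y‖⁻¹ ^ 3 * (y i * y j)| ≤ 2 := by
    rw [abs_mul, abs_of_pos (by positivity)]
    calc 2 * ‖y‖⁻¹ ^ 3 * |y i * y j| ≤ 2 * ‖y‖⁻¹ ^ 3 * ‖y‖ ^ 2 := by
          gcongr; exact abs_mul_coord_le y i j
      _ = 2 * ‖y‖⁻¹ := by field_simp
      _ ≤ 2 := by linarith
  have h2 : |2 * (if i = j then (1 : ℝ) else 0)| ≤ 2 := by
    split_ifs <;> simp
  gcongr
  · linarith
  · exact (abs_sub _ _).trans (by linarith)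

/-! ### Transfer of integrability -/

theorem aestronglyMeasurable_comp_G₁ {E : Space → Fin 3 → ℂ}
    (hE : AEStronglyMeasurable E (volume.restrict (M₁ \ {0}))) :
    AEStronglyMeasurable (fun y => E (G₁ y)) (volume.restrict N₁) :=
  hE.comp_quasiMeasurePreserving quasiMeasurePreserving_G₁

theorem integrableOn_pushOneForm {E : Space → Fin 3 → ℂ}
    (hE : IntegrableOn (fun y => E (G₁ y)) N₁) :
    IntegrableOn (fun y => cmul (jac G₁ y)ᵀ (E (G₁ y))) N₁ := by
  refine (hE.norm.const_mul 12).mono'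
    (aestronglyMeasurable_cmul (fun i j => measurable_jac G₁ j i) hE.1) ?_
  filter_upwards [ae_restrict_mem isOpen_N₁.measurableSet] with y hy
  refine (norm_cmul_le (fun i j => abs_jac_G₁_le (mem_N₁.1 hy).1 j i) _).trans_eq ?_
  ring

theorem measurable_adjugate_jac (i j : Fin 3) :
    Measurable fun y => (jac G₁ y).adjugate i j := by
  have h := measurable_jac G₁
  simp only [Matrix.adjugate_fin_three]
  fin_cases i <;> fin_cases j <;> simp <;> fun_prop

theorem integrableOn_pushTwoForm {E : Space → Fin 3 → ℂ}
    (hE : IntegrableOn (fun y => E (G₁ y)) N₁) :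
    IntegrableOn (fun y => cmul (jac G₁ y).adjugate (E (G₁ y))) N₁ := by
  refine (hE.norm.const_mul 24).mono' (aestronglyMeasurable_cmul measurable_adjugate_jac hE.1) ?_
  filter_upwards [ae_restrict_mem isOpen_N₁.measurableSet] with y hy
  have hp : 0 < ‖y‖⁻¹ := by
    have := (mem_N₁.1 hy).1
    positivity
  refine (norm_cmul_le (C := 8) (fun i j => ?_) _).trans_eq (by ring)
  exact (abs_adjugate_jac_G₁_le (mem_N₁.1 hy).1 i j).trans (by linarith)

/-- The integrability of `|E|²/|x|²` makes the push-forward of `E` integrable at the cloaking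
surface. -/
theorem integrableOn_comp_G₁_of_div_norm_sq {E : Space → Fin 3 → ℂ}
    (hE : AEStronglyMeasurable E (volume.restrict (M₁ \ {0})))
    (h : IntegrableOn (fun x => ‖E x‖ ^ 2 / ‖x‖ ^ 2) (M₁ \ {0})) :
    IntegrableOn (fun y => E (G₁ y)) N₁ := by
  rw [integrableOn_comp_G₁] at h
  have hfin : volume N₁ ≠ ⊤ :=
    ((measure_mono Set.sdiff_subset).trans_lt measure_ball_lt_top).ne
  refine ((integrableOn_const hfin (C := (1 : ℝ))).add (h.const_mul 2)).mono'
    (aestronglyMeasurable_comp_G₁ hE) ?_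
  filter_upwards [ae_restrict_mem isOpen_N₁.measurableSet] with y hy
  obtain ⟨h1, h2⟩ := mem_N₁.1 hy
  have hpos : 0 < ‖y‖ := by linarith
  have hpos' : 0 < ‖y‖ - 1 := by linarith
  -- the Jacobian determinant divided by `|G₁ y|²` is `2 / |y|²`
  have e : (jac G₁ y).det • (‖E (G₁ y)‖ ^ 2 / ‖G₁ y‖ ^ 2) = 2 / ‖y‖ ^ 2 * ‖E (G₁ y)‖ ^ 2 := by
    rw [det_jac_G₁ (N₁_ne_zero hy), norm_G₁ h1, smul_eq_mul]
    field_simp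
  -- this is bounded below, since `|y| < 2`
  have h3 : 1 / 2 ≤ 2 / ‖y‖ ^ 2 := by
    rw [div_le_div_iff₀ (by norm_num) (by positivity)]
    nlinarith
  simp only [Pi.add_apply, e]
  -- `|E| ≤ 1 + |E|²`
  nlinarith [sq_nonneg (‖E (G₁ y)‖ - 1), sq_nonneg (‖E (G₁ y)‖),
    mul_le_mul_of_nonneg_right h3 (sq_nonneg ‖E (G₁ y)‖)]

/-- The integrability of the push-forward of `E` at the cloaking surface makes `E/|x|` integrable
at the origin. -/
theorem integrableOn_inv_norm_mul_norm {E Et : Space → Fin 3 → ℂ}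
    (hE : AEStronglyMeasurable E (volume.restrict (M₁ \ {0})))
    (hEt : ∀ y ∈ N₁, Et y = cmul (jac G₁ y)ᵀ (E (G₁ y))) (h : IntegrableOn Et N₁) :
    IntegrableOn (fun x => ‖x‖⁻¹ * ‖E x‖) (M₁ \ {0}) := by
  rw [integrableOn_comp_G₁]
  refine (h.norm.const_mul 12).mono' ?_ ?_
  · simp only [smul_eq_mul]
    refine AEStronglyMeasurable.mul ?_ (AEStronglyMeasurable.mul ?_
      (aestronglyMeasurable_comp_G₁ hE).norm)
    · have hm := measurable_jac G₁
      simp only [Matrix.det_fin_three]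
      exact Measurable.aestronglyMeasurable (by fun_prop)
    · exact measurable_G₁.norm.inv.aestronglyMeasurable
  · filter_upwards [ae_restrict_mem isOpen_N₁.measurableSet] with y hy
    obtain ⟨h1, h2⟩ := mem_N₁.1 hy
    have hpos : 0 < ‖y‖ := by linarith
    have hpos' : 0 < ‖y‖ - 1 := by linarith
    have hdet := det_jac_G₁_pos h1
    -- `det(DG₁) E` is recovered from the push-forward by the adjugate, whose size is comparable
    -- to `|G₁ y|`
    have e1 : cmul (jac G₁ y).adjugateᵀ (Et y) = ((jac G₁ y).det : ℂ) • E (G₁ y) := by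
      rw [hEt y hy, cmul_cmul, ← Matrix.transpose_mul, Matrix.mul_adjugate, Matrix.transpose_smul,
        Matrix.transpose_one, cmul_smul_one]
    have e2 : (jac G₁ y).det * ‖E (G₁ y)‖ ≤ 3 * (4 * (2 - 2 * ‖y‖⁻¹) * ‖Et y‖) := by
      have := norm_cmul_le (A := (jac G₁ y).adjugateᵀ)
        (fun i j => abs_adjugate_jac_G₁_le h1 j i) (Et y)
      rwa [e1, norm_smul, Complex.norm_real, Real.norm_of_nonneg hdet.le] at this
    have e3 : (2 - 2 * ‖y‖⁻¹) ≤ ‖G₁ y‖ := by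
      rw [norm_G₁ h1]
      have : ‖y‖ * ‖y‖⁻¹ = 1 := mul_inv_cancel₀ hpos.ne'
      have : 0 < ‖y‖⁻¹ := by positivity
      nlinarith
    have hG : 0 < ‖G₁ y‖ := by rw [norm_G₁ h1]; linarith
    rw [norm_smul, norm_mul, norm_inv, norm_norm, norm_norm, Real.norm_of_nonneg hdet.le]
    calc (jac G₁ y).det * (‖G₁ y‖⁻¹ * ‖E (G₁ y)‖)
        = ‖G₁ y‖⁻¹ * ((jac G₁ y).det * ‖E (G₁ y)‖) := by ring
      _ ≤ ‖G₁ y‖⁻¹ * (3 * (4 * (2 - 2 * ‖y‖⁻¹) * ‖Et y‖)) := by gcongr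
      _ ≤ ‖G₁ y‖⁻¹ * (3 * (4 * ‖G₁ y‖ * ‖Et y‖)) := by gcongr
      _ = 12 * ‖Et y‖ := by field_simp; ring

/-! ### Energy and square integrability -/

theorem sq_norm_le_sum (v : Fin 3 → ℂ) : ‖v‖ ^ 2 ≤ ∑ j, ‖v j‖ ^ 2 := by
  have h0 : 0 ≤ ∑ j, ‖v j‖ ^ 2 := Finset.sum_nonneg fun j _ => sq_nonneg _
  refine (Real.le_sqrt (norm_nonneg _) h0).1 ((pi_norm_le_iff_of_nonneg (Real.sqrt_nonneg _)).2
    fun i => Real.le_sqrt_of_sq_le ?_)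
  exact Finset.single_le_sum (f := fun j => ‖v j‖ ^ 2) (fun j _ => sq_nonneg _) (Finset.mem_univ i)

theorem memLp_two_iff_integrable_energyDensity {μ : Measure Space} {E : Space → Fin 3 → ℂ}
    (hE : AEStronglyMeasurable E μ) :
    MemLp E 2 μ ↔ Integrable (energyDensity (fun _ => 1) E) μ := by
  have hm : AEStronglyMeasurable (fun x => ∑ j, ‖E x j‖ ^ 2) μ := by
    refine Finset.aestronglyMeasurable_fun_sum _ fun j _ => ?_
    exact ((continuous_apply j).comp_aestronglyMeasurable hE).norm.pow 2
  have he : energyDensity (fun _ => 1) E = fun x => ((∑ j, ‖E x j‖ ^ 2 : ℝ) : ℂ) :=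
    funext (energyDensity_one E)
  have h0 : ∀ x, 0 ≤ ∑ j, ‖E x j‖ ^ 2 := fun x => Finset.sum_nonneg fun j _ => sq_nonneg _
  rw [memLp_two_iff_integrable_sq_norm hE, he]
  constructor
  · intro h
    refine (h.const_mul 3).mono' (Complex.continuous_ofReal.comp_aestronglyMeasurable hm)
      (Filter.Eventually.of_forall fun x => ?_)
    rw [Complex.norm_real, Real.norm_of_nonneg (h0 x)]
    have : ∀ j, ‖E x j‖ ^ 2 ≤ ‖E x‖ ^ 2 := fun j =>
      pow_le_pow_left₀ (norm_nonneg _) (norm_le_pi_norm _ j) 2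
    rw [Fin.sum_univ_three]
    linarith [this 0, this 1, this 2]
  · intro h
    refine h.norm.mono' (hE.norm.pow 2) (Filter.Eventually.of_forall fun x => ?_)
    rw [norm_pow, norm_norm, Complex.norm_real, Real.norm_of_nonneg (h0 x)]
    exact sq_norm_le_sum (E x)

/-! ### Weak solutions near the origin -/

theorem compactTests_mono {U V : Set Space} (h : U ⊆ V) : compactTests U ⊆ compactTests V :=
  fun _ hh => ⟨hh.1, hh.2.1, hh.2.2.trans h⟩

theorem pairing_eq_zero_of_notMem {h : Space → Fin 3 → ℝ} (E B : Space → Fin 3 → ℂ) {x : Space}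
    (hx : x ∉ tsupport h) : pairing h E B x = 0 := by
  rw [pairing, curl_eq_zero_of_notMem hx, image_eq_zero_of_notMem_tsupport hx, rdot_zero_left,
    rdot_zero_left, add_zero]

theorem integral_pairing_of_subset {U V : Set Space} (hV : MeasurableSet V) (hUV : U ⊆ V)
    {h : Space → Fin 3 → ℝ} (hh : tsupport h ⊆ U) (E B : Space → Fin 3 → ℂ) :
    ∫ x in V, pairing h E B x = ∫ x in U, pairing h E B x :=
  (setIntegral_eq_of_subset_of_forall_sdiff_eq_zero hV hUV fun _ hx =>
    pairing_eq_zero_of_notMem E B fun h' => hx.2 (hh h'))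

theorem restrict_M₁_diff : volume.restrict (M₁ \ {0}) = volume.restrict M₁ :=
  Measure.restrict_congr_set (sdiff_null_ae_eq_self (by simp))

/-- A smooth field on `V` whose support has no limit points in `K \ V` is integrable on `K ∩ V`. -/
theorem integrableOn_of_disjoint_closure {V K : Set Space} (hV : IsOpen V) (hK : IsCompact K)
    {f : Space → Fin 3 → ℂ} (hf : ContinuousOn f V)
    (hs : closure {x | x ∈ V ∧ f x ≠ 0} ∩ K ⊆ V) : IntegrableOn f (K ∩ V) := by
  have hK' : IsCompact (closure {x | x ∈ V ∧ f x ≠ 0} ∩ K) := hK.inter_left isClosed_closure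
  have h1 := (hf.mono hs).integrableOn_compact (μ := volume) hK'
  have h2 : IntegrableOn f ((K ∩ V) \ (closure {x | x ∈ V ∧ f x ≠ 0} ∩ K)) := by
    refine (integrableOn_zero (ε' := Fin 3 → ℂ)).congr_fun (fun x hx => ?_)
      ((hK.measurableSet.inter hV.measurableSet).diff hK'.measurableSet)
    by_contra hne
    exact hx.2 ⟨subset_closure ⟨hx.1.2, fun h => hne h.symm⟩, hx.1.1⟩
  exact (h1.union h2).mono_set fun x hx => by
    by_cases h : x ∈ closure {x | x ∈ V ∧ f x ≠ 0} ∩ K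
    · exact Or.inl h
    · exact Or.inr ⟨hx, h⟩

/-- The right-hand side of a weak equation `curl E = -B` is weakly divergence free. -/
theorem integral_gradient_eq_zero {U : Set Space} {E B : Space → Fin 3 → ℂ}
    (hw : ∀ h ∈ compactTests U, ∫ x in U, pairing h E B x = 0) {φ : Space → ℝ}
    (hφ : ContDiff ℝ ∞ φ) (hφc : HasCompactSupport φ) (hφs : tsupport φ ⊆ U) :
    ∫ x in U, rdot (gradient φ x) (B x) = 0 := by
  have hts : tsupport (gradient φ) ⊆ tsupport φ := by
    refine tsupport_subset_of_isClosed (isClosed_tsupport φ) fun x hx => ?_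
    ext i
    rw [gradient, partialD,
      image_eq_zero_of_notMem_tsupport fun h => hx (tsupport_fderiv_subset ℝ h)]
    rfl
  have hg : gradient φ ∈ compactTests U :=
    ⟨contDiff_pi.2 fun i => contDiff_partialD hφ i,
      HasCompactSupport.intro hφc.isCompact fun x hx =>
        image_eq_zero_of_notMem_tsupport fun h => hx (hts h), hts.trans hφs⟩
  rw [← hw _ hg]
  congr 1
  ext x
  have hpd : ∀ i j, pd i (gradient φ) j x = partialD i (partialD j φ) x := fun i j => by
    have hd : DifferentiableAt ℝ (gradient φ) x := hg.1.differentiable (by simp) x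
    have := ((ContinuousLinearMap.proj j : (Fin 3 → ℝ) →L[ℝ] ℝ).hasFDerivAt.comp x
      hd.hasFDerivAt).fderiv
    rw [partialD, show partialD j φ =
      (ContinuousLinearMap.proj j : (Fin 3 → ℝ) →L[ℝ] ℝ) ∘ gradient φ from rfl, this]
    rfl
  have hc : curl (gradient φ) x = 0 := by
    simp only [curl, hpd, partialD_comm hφ 2 1, partialD_comm hφ 0 2, partialD_comm hφ 1 0,
      sub_self]
    ext i
    fin_cases i <;> rfl
  rw [pairing, hc, rdot_zero_left, zero_add]

/-- A weak solution of Maxwell's equations without currents near the origin satisfies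
`E / |x|, H / |x| ∈ L²` near the origin; stated for a symmetric pair of equations
`curl E = -b H`, `curl H = -a E`. -/
theorem integrableOn_sq_div_norm_sq_of_pair {E H : Space → Fin 3 → ℂ} {r : ℝ} (hr : 0 < r)
    {a b : ℂ} (ha : a ≠ 0) (hE : MemLp E 2 (volume.restrict (Metric.ball 0 r)))
    (hH : MemLp H 2 (volume.restrict (Metric.ball 0 r)))
    (h1 : ∀ h ∈ compactTests (Metric.ball 0 r),
      ∫ x in Metric.ball 0 r, pairing h E (fun x => b • H x) x = 0)
    (h2 : ∀ h ∈ compactTests (Metric.ball 0 r),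
      ∫ x in Metric.ball 0 r, pairing h H (fun x => a • E x) x = 0) (j : Fin 3) :
    IntegrableOn (fun x => ‖E x j‖ ^ 2 / ‖x‖ ^ 2) (Metric.ball 0 (r / 4)) := by
  refine integrableOn_sq_div_norm_sq_of_weak_curl hr hE (hH.const_smul b) h1
    (fun φ hφ hφc hφs => ?_) j
  have := integral_gradient_eq_zero h2 hφ hφc hφs
  simp only [rdot_smul] at this
  rw [integral_const_mul] at this
  exact (mul_eq_zero.1 this).resolve_left ha

/-- Away from the origin the weight `1/|x|²` is bounded, so that only the behaviour near the origin
matters. -/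
theorem integrableOn_norm_sq_div {E : Space → Fin 3 → ℂ} {r : ℝ} (hr : 0 < r)
    (hE : MemLp E 2 (volume.restrict (M₁ \ {0})))
    (h : ∀ j, IntegrableOn (fun x => ‖E x j‖ ^ 2 / ‖x‖ ^ 2) (Metric.ball 0 r)) :
    IntegrableOn (fun x => ‖E x‖ ^ 2 / ‖x‖ ^ 2) (M₁ \ {0}) := by
  have hm : AEStronglyMeasurable (fun x => ‖E x‖ ^ 2 / ‖x‖ ^ 2) (volume.restrict (M₁ \ {0})) :=
    (hE.1.norm.aemeasurable.pow_const 2).div (by fun_prop) |>.aestronglyMeasurable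
  rw [← Set.inter_union_sdiff (M₁ \ {0}) (Metric.ball 0 r)]
  have hmb : MeasurableSet (Metric.ball (0 : Space) r) := Metric.isOpen_ball.measurableSet
  refine IntegrableOn.union ?_ ?_
  · have hsum : IntegrableOn (fun x => ∑ j, ‖E x j‖ ^ 2 / ‖x‖ ^ 2) (Metric.ball 0 r) :=
      integrable_finsetSum _ fun j _ => h j
    refine (hsum.mono_set Set.inter_subset_right).mono'
      (hm.mono_measure (Measure.restrict_mono Set.inter_subset_left le_rfl))
      (Filter.Eventually.of_forall fun x => ?_)
    rw [Real.norm_of_nonneg (by positivity), ← Finset.sum_div]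
    gcongr
    exact sq_norm_le_sum (E x)
  · have h2 : IntegrableOn (fun x => (r ^ 2)⁻¹ * ‖E x‖ ^ 2) (M₁ \ {0}) :=
      ((memLp_two_iff_integrable_sq_norm hE.1).1 hE).const_mul ((r ^ 2)⁻¹)
    refine (h2.mono_set Set.sdiff_subset).mono'
      (hm.mono_measure (Measure.restrict_mono Set.sdiff_subset le_rfl)) ?_
    filter_upwards [ae_restrict_mem (isOpen_M₁_diff.measurableSet.diff hmb)] with x hx
    have hxr : r ≤ ‖x‖ := by simpa using hx.2
    rw [Real.norm_of_nonneg (by positivity), div_eq_mul_inv, mul_comm]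
    gcongr

/-! ### The domain `M₂` -/

/-- A field whose tangential trace vanishes satisfies its weak equation with all test forms that
are smooth up to the boundary. -/
theorem integral_pairing_of_hasZeroTangentialTrace {E B : Space → Fin 3 → ℂ}
    (hE : IntegrableOn E M₂) (hB : IntegrableOn B M₂)
    (hw : ∀ h ∈ compactTests M₂, ∫ x in M₂, pairing h E B x = 0)
    (ht : HasZeroTangentialTrace M₂ E) {h : Space → Fin 3 → ℝ} (hh : ContDiff ℝ ∞ h)
    (hc : HasCompactSupport h) : ∫ x in M₂, pairing h E B x = 0 := by
  obtain ⟨C, hC2, hC, hCt⟩ := ht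
  have : IsFiniteMeasure (volume.restrict M₂) := ⟨by
    rw [Measure.restrict_apply_univ]; exact measure_ball_lt_top⟩
  have hCi : IntegrableOn C M₂ := hC2.integrable (by norm_num)
  have hsplit : ∀ h : Space → Fin 3 → ℝ, ContDiff ℝ ∞ h → HasCompactSupport h →
      ∫ x in M₂, pairing h E B x = (∫ x in M₂, rdot (curl h x) (E x)) +
        ∫ x in M₂, rdot (h x) (B x) := fun h hh hc =>
    integral_add (integrable_rdot (continuous_curl (hh.of_le (by simp)))
      (hasCompactSupport_curl hc) hE) (integrable_rdot hh.continuous hc hB)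
  -- the weak curl is unique: it is `-B`
  have hCB : ∀ᵐ x, x ∈ M₂ → ∀ j, C x j + B x j = 0 := by
    have hj : ∀ j, ∀ᵐ x, x ∈ M₂ → C x j + B x j = 0 := fun j => by
      have hpr : ∀ {V : Space → Fin 3 → ℂ}, IntegrableOn V M₂ →
          IntegrableOn (fun x => V x j) M₂ := fun {V} hV =>
        (ContinuousLinearMap.proj (R := ℝ) j : (Fin 3 → ℂ) →L[ℝ] ℂ).integrable_comp hV
      refine IsOpen.ae_eq_zero_of_integral_contDiff_smul_eq_zero Metric.isOpen_ball
        ((hpr hCi).add (hpr hB)).locallyIntegrableOn fun φ hφ hφc hφs => ?_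
      have hmem : (fun x => φ x • (Pi.single j 1 : Fin 3 → ℝ)) ∈ compactTests M₂ :=
        ⟨hφ.smul contDiff_const, HasCompactSupport.smul_right (f := φ) hφc,
          (tsupport_smul_subset_left φ _).trans hφs⟩
      have h1 := hw _ hmem
      rw [hsplit _ hmem.1 hmem.2.1, hC _ hmem, ← integral_add (integrable_rdot hmem.1.continuous
        hmem.2.1 hCi) (integrable_rdot hmem.1.continuous hmem.2.1 hB)] at h1
      rw [← setIntegral_eq_integral_of_forall_compl_eq_zero (s := M₂), ← h1]
      · congr 1
        ext x
        simp only [rdot_smul_left]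
        fin_cases j <;> simp [rdot, Fin.sum_univ_three]
      · intro x hx
        rw [image_eq_zero_of_notMem_tsupport fun h => hx (hφs h), zero_smul]
    filter_upwards [ae_all_iff.2 hj] with x hx hxM j using hx j hxM
  rw [hsplit h hh hc, hCt h hh, ← integral_add (integrable_rdot hh.continuous hc hCi)
    (integrable_rdot hh.continuous hc hB)]
  refine (setIntegral_congr_ae Metric.isOpen_ball.measurableSet (g := fun _ => 0) ?_).trans
    (by simp)
  filter_upwards [hCB] with x hx hxM
  simp only [rdot, ← Finset.sum_add_distrib, ← mul_add, hx hxM, mul_zero, Finset.sum_const_zero]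

/-- A weak equation that holds for all forms smooth up to the boundary contains the natural boundary
condition: the weak curl of `E` is `-B`, and the tangential trace of `E` vanishes. -/
theorem hasZeroTangentialTrace_of_integral_pairing {E B : Space → Fin 3 → ℂ}
    (hE : IntegrableOn E M₂) (hB : MemLp B 2 (volume.restrict M₂))
    (hw : ∀ h : Space → Fin 3 → ℝ, ContDiff ℝ ∞ h → ∫ x in M₂, pairing h E B x = 0) :
    HasZeroTangentialTrace M₂ E := by
  have : IsFiniteMeasure (volume.restrict M₂) := ⟨by
    rw [Measure.restrict_apply_univ]; exact measure_ball_lt_top⟩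
  have hBi : IntegrableOn B M₂ := hB.integrable (by norm_num)
  have key : ∀ h : Space → Fin 3 → ℝ, ContDiff ℝ ∞ h → ∫ x in M₂, rdot (curl h x) (E x) =
      ∫ x in M₂, rdot (h x) (-B x) := by
    intro h hh
    -- replace `h` by a compactly supported form that agrees with it on the ball
    obtain ⟨h', hh', hc', -, he⟩ := exists_compactSupport_eqOn (V := M₂) hh (s := 1) (R := 2)
      (by norm_num) (by norm_num) fun y hy h1 => by
        simp only [M₂, mem_ball_zero_iff] at hy
        linarith
    have h1 := hw h' hh'
    have h2 : ∫ x in M₂, pairing h' E B x = (∫ x in M₂, rdot (curl h' x) (E x)) +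
        ∫ x in M₂, rdot (h' x) (B x) :=
      integral_add (integrable_rdot (continuous_curl (hh'.of_le (by simp)))
        (hasCompactSupport_curl hc') hE) (integrable_rdot hh'.continuous hc' hBi)
    have h3 : ∫ x in M₂, rdot (curl h x) (E x) = ∫ x in M₂, rdot (curl h' x) (E x) :=
      setIntegral_congr_fun Metric.isOpen_ball.measurableSet fun x hx => by
        simp only [curl_congr (he.eventuallyEq_of_mem (Metric.isOpen_ball.mem_nhds hx))]
    have h4 : ∫ x in M₂, rdot (h x) (-B x) = -∫ x in M₂, rdot (h' x) (B x) := by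
      rw [← integral_neg]
      refine setIntegral_congr_fun Metric.isOpen_ball.measurableSet fun x hx => ?_
      simp [rdot, he hx, Finset.sum_neg_distrib]
    rw [h3, h4]
    linear_combination h1 - h2
  exact ⟨fun x => -B x, hB.neg, fun h hh => key h hh.1, key⟩

/-! ### Test forms with jumps across the cloaking surface -/

theorem exists_smooth_of_mem_surfaceTests {h : Space → Fin 3 → ℝ} (hh : h ∈ surfaceTests) :
    ∃ h₁ h₂ : Space → Fin 3 → ℝ, ContDiff ℝ ∞ h₁ ∧ ContDiff ℝ ∞ h₂ ∧ HasCompactSupport h₁ ∧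
      HasCompactSupport h₂ ∧ tsupport h₁ ⊆ N ∧ Set.EqOn h h₁ N₁ ∧ Set.EqOn h h₂ N₂ := by
  obtain ⟨⟨h₁, h₂, hs₁, hs₂, he₁, he₂⟩, r, hr, hr0⟩ := hh
  obtain ⟨h₁', hs₁', hc₁', ht₁', he₁'⟩ := exists_compactSupport_eqOn (V := N₁) hs₁
    (s := max r 1) (R := 2) (by positivity) (max_lt hr (by norm_num)) fun y hy hry => by
      rw [← he₁ hy]
      exact hr0 y (N₁_subset hy).1 ((le_max_left _ _).trans_lt hry)
  obtain ⟨h₂', hs₂', hc₂', -, he₂'⟩ := exists_compactSupport_eqOn (V := N₂) hs₂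
    (s := 1) (R := 2) (by norm_num) (by norm_num) fun y hy hry => by
      simp only [N₂, mem_ball_zero_iff] at hy
      linarith
  exact ⟨h₁', h₂', hs₁', hs₂', hc₁', hc₂', ht₁', he₁.trans he₁', he₂.trans he₂'⟩

/-- The boundary condition on a test form, stated through limits, is a pointwise condition on its
smooth extension from `N₂`. -/
theorem cross_eq_zero_of_mem_surfaceTestsPEC {e e₂ : Space → Fin 3 → ℝ}
    (he : e ∈ surfaceTestsPEC) (hc : Continuous e₂) (heq : Set.EqOn e e₂ N₂) {y : Space}
    (hy : y ∈ cloakSurface) : crossProduct (WithLp.ofLp y) (e₂ y) = 0 := by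
  have h1 := (he.2 y hy).2
  have hcont : Continuous fun x => crossProduct (WithLp.ofLp y) (e₂ x) :=
    (LinearMap.continuous_of_finiteDimensional (crossProduct (WithLp.ofLp y))).comp hc
  have h2 : Filter.Tendsto (fun x => crossProduct (WithLp.ofLp y) (e x)) (nhdsWithin y N₂)
      (nhds (crossProduct (WithLp.ofLp y) (e₂ y))) := by
    refine (hcont.continuousAt.tendsto.mono_left nhdsWithin_le_nhds).congr' ?_
    filter_upwards [self_mem_nhdsWithin] with x hx
    rw [heq hx]
  have : (nhdsWithin y N₂).NeBot := by
    rw [← mem_closure_iff_nhdsWithin_neBot, N₂, closure_ball _ one_ne_zero]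
    exact Metric.sphere_subset_closedBall hy
  exact tendsto_nhds_unique h2 h1

/-- Forms supported away from the cloaking surface are admissible in both weak equations on `N`. -/
theorem compactTests_subset_surfaceTestsPEC :
    compactTests (N \ cloakSurface) ⊆ surfaceTestsPEC := by
  rintro h ⟨hs, hc, ht⟩
  refine ⟨⟨⟨h, h, hs, hs, fun _ _ => rfl, fun _ _ => rfl⟩, ?_⟩, fun y hy => ?_⟩
  · obtain ⟨r, hr, h1⟩ := exists_lt_subset_ball hc.isClosed (ht.trans Set.sdiff_subset)
    refine ⟨r, hr, fun y _ hry => image_eq_zero_of_notMem_tsupport fun hy => ?_⟩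
    have := h1 hy
    simp only [mem_ball_zero_iff] at this
    linarith
  · have h0 : h =ᶠ[nhds y] 0 := notMem_tsupport_iff_eventuallyEq.1 fun h' => (ht h').2 hy
    have h1 : Filter.Tendsto (fun x => crossProduct (WithLp.ofLp y) (h x)) (nhds y) (nhds 0) := by
      refine tendsto_const_nhds.congr' ?_
      filter_upwards [h0] with x hx
      simp [hx]
    exact ⟨h1.mono_left nhdsWithin_le_nhds, h1.mono_left nhdsWithin_le_nhds⟩

/-- The test forms in Faraday's law may jump across the cloaking surface; hence an arbitrary smooth
form on the closure of `N₂`, extended by zero, is admissible. -/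
theorem indicator_mem_surfaceTests {h : Space → Fin 3 → ℝ} (hh : ContDiff ℝ ∞ h) :
    N₂.indicator h ∈ surfaceTests := by
  refine ⟨⟨0, h, contDiff_const, hh, fun y hy => ?_, fun y hy => ?_⟩, 1, by norm_num,
    fun y _ hy => ?_⟩
  · exact Set.indicator_of_notMem (fun h' => not_mem_N₁ h' hy) h
  · exact Set.indicator_of_mem hy h
  · refine Set.indicator_of_notMem (fun h' => ?_) h
    simp only [N₂, mem_ball_zero_iff] at h'
    linarith

theorem measurableSet_N_diff : MeasurableSet (N \ cloakSurface) := by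
  rw [N_diff_eq]
  exact isOpen_N₁.measurableSet.union isOpen_N₂.measurableSet

theorem integral_pairing_indicator (h : Space → Fin 3 → ℝ) (E B : Space → Fin 3 → ℂ) :
    ∫ y in N \ cloakSurface, pairing (N₂.indicator h) E B y = ∫ y in N₂, pairing h E B y := by
  rw [setIntegral_eq_of_subset_of_forall_sdiff_eq_zero measurableSet_N_diff N₂_subset]
  · exact setIntegral_congr_fun isOpen_N₂.measurableSet
      (pairing_congr isOpen_N₂ (fun y hy => Set.indicator_of_mem hy h) E B)
  · rintro y ⟨hy, hy2⟩
    rw [N_diff_eq] at hy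
    have hy1 : y ∈ N₁ := hy.resolve_right hy2
    have he : Set.EqOn (N₂.indicator h) 0 N₁ := fun z hz =>
      Set.indicator_of_notMem (fun h' => not_mem_N₁ h' hz) h
    rw [pairing_congr isOpen_N₁ he E B hy1]
    exact pairing_eq_zero_of_notMem (h := 0) E B (by simp [tsupport])

/-- The weak equations on `N` minus the cloaking surface split into those on `N₁` and on `N₂`. -/
theorem integral_pairing_N_diff {h h₁ h₂ : Space → Fin 3 → ℝ} {E B : Space → Fin 3 → ℂ}
    (he₁ : Set.EqOn h h₁ N₁) (he₂ : Set.EqOn h h₂ N₂) (hi₁ : IntegrableOn (pairing h₁ E B) N₁)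
    (hi₂ : IntegrableOn (pairing h₂ E B) N₂) :
    ∫ y in N \ cloakSurface, pairing h E B y =
      (∫ y in N₁, pairing h₁ E B y) + ∫ y in N₂, pairing h₂ E B y := by
  have e₁ := pairing_congr isOpen_N₁ he₁ E B
  have e₂ := pairing_congr isOpen_N₂ he₂ E B
  have m₁ := isOpen_N₁.measurableSet
  have m₂ := isOpen_N₂.measurableSet
  rw [N_diff_eq, setIntegral_union disjoint_N₁_N₂ m₂ (hi₁.congr_fun e₁.symm m₁)
    (hi₂.congr_fun e₂.symm m₂), setIntegral_congr_fun m₁ e₁, setIntegral_congr_fun m₂ e₂]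

/-- The integrand of Faraday's law is the pairing with the 2-form `-ikB`. -/
theorem faraday_integrand (k : ℝ) (h : Space → Fin 3 → ℝ) (E B : Space → Fin 3 → ℂ) (x : Space) :
    rdot (curl h x) (E x) - Complex.I * k * rdot (h x) (B x) =
      pairing h E (fun x => (-(Complex.I * k)) • B x) x := by
  rw [pairing, rdot_smul]
  ring

theorem cmul_materialTilde_N₂ {y : Space} (hy : y ∈ N₂) (v : Fin 3 → ℂ) :
    cmul (materialTilde y) v = v := by
  rw [materialTilde, if_neg (not_mem_N₁ hy), cmul_one]

theorem energyDensity_N₂ {E Et : Space → Fin 3 → ℂ} (hE : Set.EqOn Et E N₂) :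
    Set.EqOn (energyDensity materialTilde Et) (energyDensity (fun _ => 1) E) N₂ := fun y hy => by
  simp only [energyDensity, materialTilde, if_neg (not_mem_N₁ hy), hE hy]

theorem integrableOn_energyDensity_N₁_iff {E Et : Space → Fin 3 → ℂ}
    (hEt : ∀ y ∈ N₁, Et y = cmul (jac G₁ y)ᵀ (E (G₁ y))) :
    IntegrableOn (energyDensity materialTilde Et) N₁ ↔
      IntegrableOn (energyDensity (fun _ => 1) E) (M₁ \ {0}) := by
  rw [integrableOn_comp_G₁]
  refine integrableOn_congr_fun (fun y hy => ?_) isOpen_N₁.measurableSet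
  rw [energyDensity_materialTilde hy (hEt y hy), Complex.real_smul]

/-! ### Equivalence of the Maxwell problems on `M` and on `N` -/

section

variable {k : ℝ} {e₁ e₂ h₁ h₂ j₁ j₂ Et Ht Jt : Space → Fin 3 → ℂ}

/-- The push-forward of a solution on `M` is a solution on `N`. The delicate point is the behaviour
at the cloaking surface: `E/|x|` and `H/|x|` are square integrable near the origin, so the
push-forwards are integrable and the weak equations on `N₁` extend up to the surface. -/
theorem isSolutionN_of_isSolutionM (hk : k ≠ 0)
    (hEt₁ : ∀ y ∈ N₁, Et y = cmul (jac G₁ y)ᵀ (e₁ (G₁ y))) (hEt₂ : Set.EqOn Et e₂ N₂)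
    (hHt₁ : ∀ y ∈ N₁, Ht y = cmul (jac G₁ y)ᵀ (h₁ (G₁ y))) (hHt₂ : Set.EqOn Ht h₂ N₂)
    (hJt₁ : ∀ y ∈ N₁, Jt y = cmul (jac G₁ y).adjugate (j₁ (G₁ y))) (hJt₂ : Set.EqOn Jt j₂ N₂)
    (hj₁ : (0 : Space) ∉ closure {x | x ∈ M₁ \ {0} ∧ j₁ x ≠ 0})
    (hJi : ∀ r < 2, IntegrableOn Jt (Metric.closedBall 0 r ∩ (N \ cloakSurface)))
    (hM₁ : IsSolutionM₁ k e₁ h₁ j₁) (hM₂ : IsSolutionM₂ k e₂ h₂ j₂) :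
    IsSolutionN k Et Ht Jt := by
  have hIk : Complex.I * (k : ℂ) ≠ 0 :=
    mul_ne_zero Complex.I_ne_zero (Complex.ofReal_ne_zero.2 hk)
  have m₁ := isOpen_N₁.measurableSet
  have m₂ := isOpen_N₂.measurableSet
  obtain ⟨hE, hH, -, -, hEE, hEH, hF, hA⟩ := hM₁
  obtain ⟨⟨hE₂, hH₂, -, -, hEE₂, hEH₂, hF₂, hA₂⟩, htr⟩ := hM₂
  simp only [cmul_one, faraday_integrand] at hF hF₂
  simp only [cmul_one] at hA hA₂
  have hE2 : MemLp e₁ 2 (volume.restrict M₁) := (memLp_two_iff_integrable_energyDensity hE.1).2 hEE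
  have hH2 : MemLp h₁ 2 (volume.restrict M₁) := (memLp_two_iff_integrable_energyDensity hH.1).2 hEH
  -- there are no currents in a ball around the origin
  obtain ⟨r, hr0, hr2, hjr⟩ : ∃ r : ℝ, 0 < r ∧ r ≤ 2 ∧
      ∀ x ∈ Metric.ball (0 : Space) r, x ≠ 0 → j₁ x = 0 := by
    obtain ⟨r, hr0, hr⟩ := Metric.mem_nhds_iff.1 (isClosed_closure.isOpen_compl.mem_nhds hj₁)
    refine ⟨min r 2, lt_min hr0 (by norm_num), min_le_right _ _, fun x hx hx0 => ?_⟩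
    by_contra hne
    exact hr (Metric.ball_subset_ball (min_le_left _ _) hx) (subset_closure
      ⟨⟨Metric.ball_subset_ball (min_le_right _ _) hx, hx0⟩, hne⟩)
  have hsub : Metric.ball (0 : Space) r ⊆ M₁ := Metric.ball_subset_ball hr2
  have hne : ∀ᵐ x : Space, x ≠ 0 := by simp [ae_iff]
  have hFr : ∀ h ∈ compactTests (Metric.ball 0 r), ∫ x in Metric.ball 0 r,
      pairing h e₁ (fun x => (-(Complex.I * k)) • h₁ x) x = 0 := fun h hh => by
    rw [← integral_pairing_of_subset Metric.isOpen_ball.measurableSet hsub hh.2.2]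
    exact hF h (compactTests_mono hsub hh)
  have hAr : ∀ h ∈ compactTests (Metric.ball 0 r), ∫ x in Metric.ball 0 r,
      pairing h h₁ (fun x => (Complex.I * k) • e₁ x) x = 0 := fun h hh => by
    rw [← hA h (compactTests_mono hsub hh)]
    refine Eq.trans ?_ (integral_pairing_of_subset Metric.isOpen_ball.measurableSet hsub hh.2.2
      h₁ fun x => (Complex.I * k) • e₁ x - j₁ x).symm
    refine setIntegral_congr_ae Metric.isOpen_ball.measurableSet ?_
    filter_upwards [hne] with x hx hxr
    simp only [pairing, hjr x hxr hx, sub_zero]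
  -- `E` and `H` exchange their roles, with `-ik` in place of `ik`
  have hsqE := integrableOn_sq_div_norm_sq_of_pair hr0 hIk
    (hE2.mono_measure (Measure.restrict_mono hsub le_rfl))
    (hH2.mono_measure (Measure.restrict_mono hsub le_rfl)) hFr hAr
  have hsqH := integrableOn_sq_div_norm_sq_of_pair hr0 (neg_ne_zero.2 hIk)
    (hH2.mono_measure (Measure.restrict_mono hsub le_rfl))
    (hE2.mono_measure (Measure.restrict_mono hsub le_rfl)) hAr hFr
  rw [← restrict_M₁_diff] at hE2 hH2
  have hEG : IntegrableOn (fun y => e₁ (G₁ y)) N₁ := integrableOn_comp_G₁_of_div_norm_sq hE2.1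
    (integrableOn_norm_sq_div (by positivity) hE2 hsqE)
  have hHG : IntegrableOn (fun y => h₁ (G₁ y)) N₁ := integrableOn_comp_G₁_of_div_norm_sq hH2.1
    (integrableOn_norm_sq_div (by positivity) hH2 hsqH)
  have hEi₁ : IntegrableOn Et N₁ := (integrableOn_pushOneForm hEG).congr_fun
    (fun y hy => (hEt₁ y hy).symm) m₁
  have hHi₁ : IntegrableOn Ht N₁ := (integrableOn_pushOneForm hHG).congr_fun
    (fun y hy => (hHt₁ y hy).symm) m₁
  have hDt₁ : ∀ y ∈ N₁, cmul (materialTilde y) (Et y) = cmul (jac G₁ y).adjugate (e₁ (G₁ y)) :=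
    fun y hy => by rw [hEt₁ y hy, cmul_materialTilde hy]
  have hBt₁ : ∀ y ∈ N₁, cmul (materialTilde y) (Ht y) = cmul (jac G₁ y).adjugate (h₁ (G₁ y)) :=
    fun y hy => by rw [hHt₁ y hy, cmul_materialTilde hy]
  have hDt₂ : ∀ y ∈ N₂, cmul (materialTilde y) (Et y) = e₂ y :=
    fun y hy => by rw [hEt₂ hy, cmul_materialTilde_N₂ hy]
  have hBt₂ : ∀ y ∈ N₂, cmul (materialTilde y) (Ht y) = h₂ y :=
    fun y hy => by rw [hHt₂ hy, cmul_materialTilde_N₂ hy]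
  have hDi₁ : IntegrableOn (fun y => cmul (materialTilde y) (Et y)) N₁ :=
    (integrableOn_pushTwoForm hEG).congr_fun (fun y hy => (hDt₁ y hy).symm) m₁
  have hBi₁ : IntegrableOn (fun y => cmul (materialTilde y) (Ht y)) N₁ :=
    (integrableOn_pushTwoForm hHG).congr_fun (fun y hy => (hBt₁ y hy).symm) m₁
  have hEi₂ : IntegrableOn Et N₂ := IntegrableOn.congr_fun hE₂ hEt₂.symm m₂
  have hHi₂ : IntegrableOn Ht N₂ := IntegrableOn.congr_fun hH₂ hHt₂.symm m₂
  have hDi₂ : IntegrableOn (fun y => cmul (materialTilde y) (Et y)) N₂ :=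
    IntegrableOn.congr_fun hE₂ (fun y hy => (hDt₂ y hy).symm) m₂
  have hBi₂ : IntegrableOn (fun y => cmul (materialTilde y) (Ht y)) N₂ :=
    IntegrableOn.congr_fun hH₂ (fun y hy => (hBt₂ y hy).symm) m₂
  have hJ₁ : ∀ r < 2, IntegrableOn Jt (Metric.closedBall 0 r ∩ N₁) := fun r hr =>
    (hJi r hr).mono_set (Set.inter_subset_inter_right _ N₁_subset)
  have hJ₂ : IntegrableOn Jt N₂ := (hJi 1 (by norm_num)).mono_set
    (Set.subset_inter Metric.ball_subset_closedBall N₂_subset)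
  have hsubset : M₁ \ {0} ⊆ M₁ := Set.sdiff_subset
  constructor
  · rw [N_diff_eq]; exact hEi₁.union hEi₂
  · rw [N_diff_eq]; exact hHi₁.union hHi₂
  · rw [N_diff_eq]; exact hDi₁.union hDi₂
  · rw [N_diff_eq]; exact hBi₁.union hBi₂
  · rw [N_diff_eq]
    exact ((integrableOn_energyDensity_N₁_iff hEt₁).2 (IntegrableOn.mono_set hEE hsubset)).union
      (IntegrableOn.congr_fun hEE₂ (energyDensity_N₂ hEt₂).symm m₂)
  · rw [N_diff_eq]
    exact ((integrableOn_energyDensity_N₁_iff hHt₁).2 (IntegrableOn.mono_set hEH hsubset)).union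
      (IntegrableOn.congr_fun hEH₂ (energyDensity_N₂ hHt₂).symm m₂)
  · intro h hh
    obtain ⟨g₁, g₂, hs₁, hs₂, hc₁, hc₂, ht₁, heq₁, heq₂⟩ := exists_smooth_of_mem_surfaceTests hh
    have hB₁' : IntegrableOn (fun y => (-(Complex.I * k)) • cmul (materialTilde y) (Ht y)) N₁ :=
      hBi₁.smul (-(Complex.I * (k : ℂ)))
    have hB₂' : IntegrableOn (fun y => (-(Complex.I * k)) • cmul (materialTilde y) (Ht y)) N₂ :=
      hBi₂.smul (-(Complex.I * (k : ℂ)))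
    simp only [faraday_integrand k _ Et fun y => cmul (materialTilde y) (Ht y)]
    rw [integral_pairing_N_diff heq₁ heq₂
      (integrableOn_pairing hs₁ hc₁ hEi₁ (hB₁'.mono_set Set.inter_subset_right))
      (integrableOn_pairing hs₂ hc₂ hEi₂ (hB₂'.mono_set Set.inter_subset_right))]
    have z₁ := integral_pairing_N₁ hEt₁ hEG hEi₁ (fun r _ => hB₁'.mono_set Set.inter_subset_right)
      ((forall_compactTests_N₁_iff (B := fun x => (-(Complex.I * k)) • h₁ x) hEt₁ fun y hy => by
        rw [hBt₁ y hy, cmul_smul]).2 fun h hh => by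
          rw [restrict_M₁_diff]
          exact hF h (compactTests_mono hsubset hh)) hs₁ hc₁ ht₁
    -- on `N₂` the test form is free at the boundary, and the trace of `E` vanishes
    have z₂ := integral_pairing_of_hasZeroTangentialTrace hE₂ (hH₂.smul (-(Complex.I * (k : ℂ))))
      hF₂ htr hs₂ hc₂
    rw [z₁, zero_add, ← z₂]
    refine setIntegral_congr_fun m₂ fun y hy => ?_
    simp only [pairing, hBt₂ y hy, hEt₂ hy, Pi.smul_apply]
  · intro h hh
    obtain ⟨g₁, g₂, hs₁, hs₂, hc₁, hc₂, ht₁, heq₁, heq₂⟩ := exists_smooth_of_mem_surfaceTests hh.1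
    have hB₁' : ∀ r < 2, IntegrableOn (fun y => (Complex.I * k) • cmul (materialTilde y) (Et y) -
        Jt y) (Metric.closedBall 0 r ∩ N₁) := fun r hr =>
      ((hDi₁.mono_set Set.inter_subset_right).smul (Complex.I * (k : ℂ))).sub (hJ₁ r hr)
    have hB₂' : IntegrableOn (fun y => (Complex.I * k) • cmul (materialTilde y) (Et y) - Jt y) N₂ :=
      (hDi₂.smul (Complex.I * (k : ℂ))).sub hJ₂
    obtain ⟨s, hs, hts⟩ : ∃ s < (2 : ℝ), tsupport g₁ ⊆ Metric.closedBall 0 s := by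
      obtain ⟨s, hs, h1⟩ := exists_lt_subset_ball hc₁.isClosed ht₁
      exact ⟨s, hs, h1.trans Metric.ball_subset_closedBall⟩
    refine (integral_pairing_N_diff heq₁ heq₂
      (integrableOn_pairing hs₁ hc₁ hHi₁ ((hB₁' s hs).mono_set (Set.inter_subset_inter_left _ hts)))
      (integrableOn_pairing hs₂ hc₂ hHi₂ (hB₂'.mono_set Set.inter_subset_right))).trans ?_
    have z₁ := integral_pairing_N₁ hHt₁ hHG hHi₁ hB₁'
      ((forall_compactTests_N₁_iff (B := fun x => (Complex.I * k) • e₁ x - j₁ x) hHt₁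
        fun y hy => by
          rw [hDt₁ y hy, hJt₁ y hy, cmul_sub, cmul_smul]).2 fun h hh => by
          rw [restrict_M₁_diff]
          exact hA h (compactTests_mono hsubset hh)) hs₁ hc₁ ht₁
    -- on `N₂` the trace of `H` is free, and the tangential part of the test form vanishes
    have z₂ := integral_pairing_N₂ hHi₂ hB₂' (fun h hh => by
      rw [← hA₂ h hh]
      refine setIntegral_congr_fun m₂ fun y hy => ?_
      simp only [pairing, hDt₂ y hy, hHt₂ hy, hJt₂ hy]) hs₂ hc₂
      fun y hy => cross_eq_zero_of_mem_surfaceTestsPEC hh hs₂.continuous heq₂ hy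
    rw [z₁, z₂, add_zero]

/-- A solution on `N` is the push-forward of a solution on `M`. The integrability of `Ẽ` and `H̃` up
to the cloaking surface makes the origin a removable singularity of the weak equations on `M₁`, and
the test forms supported in the closure of `N₂` give the boundary condition on `M₂`. -/
theorem isSolutionM_of_isSolutionN
    (he₁ : AEStronglyMeasurable e₁ (volume.restrict (M₁ \ {0})))
    (hh₁ : AEStronglyMeasurable h₁ (volume.restrict (M₁ \ {0})))
    (hEt₁ : ∀ y ∈ N₁, Et y = cmul (jac G₁ y)ᵀ (e₁ (G₁ y))) (hEt₂ : Set.EqOn Et e₂ N₂)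
    (hHt₁ : ∀ y ∈ N₁, Ht y = cmul (jac G₁ y)ᵀ (h₁ (G₁ y))) (hHt₂ : Set.EqOn Ht h₂ N₂)
    (hJt₁ : ∀ y ∈ N₁, Jt y = cmul (jac G₁ y).adjugate (j₁ (G₁ y))) (hJt₂ : Set.EqOn Jt j₂ N₂)
    (hji : ∀ r < 2, IntegrableOn j₁ (Metric.closedBall 0 r ∩ (M₁ \ {0})))
    (hN : IsSolutionN k Et Ht Jt) :
    IsSolutionM₁ k e₁ h₁ j₁ ∧ IsSolutionM₂ k e₂ h₂ j₂ := by
  have m₁ := isOpen_N₁.measurableSet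
  have m₂ := isOpen_N₂.measurableSet
  obtain ⟨hE, hH, hD, hB, hEE, hEH, hF, hA⟩ := hN
  simp only [faraday_integrand k _ Et fun y => cmul (materialTilde y) (Ht y)] at hF
  have hE₂ : IntegrableOn e₂ M₂ := (hE.mono_set N₂_subset).congr_fun hEt₂ m₂
  have hH₂ : IntegrableOn h₂ M₂ := (hH.mono_set N₂_subset).congr_fun hHt₂ m₂
  have hEE₁ : IntegrableOn (energyDensity (fun _ => 1) e₁) (M₁ \ {0}) :=
    (integrableOn_energyDensity_N₁_iff hEt₁).1 (hEE.mono_set N₁_subset)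
  have hEH₁ : IntegrableOn (energyDensity (fun _ => 1) h₁) (M₁ \ {0}) :=
    (integrableOn_energyDensity_N₁_iff hHt₁).1 (hEH.mono_set N₁_subset)
  have hEE₂ : IntegrableOn (energyDensity (fun _ => 1) e₂) M₂ :=
    (hEE.mono_set N₂_subset).congr_fun (energyDensity_N₂ hEt₂) m₂
  have hEH₂ : IntegrableOn (energyDensity (fun _ => 1) h₂) M₂ :=
    (hEH.mono_set N₂_subset).congr_fun (energyDensity_N₂ hHt₂) m₂
  have hfin₁ : IsFiniteMeasure (volume.restrict (M₁ \ {0})) := ⟨by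
    rw [Measure.restrict_apply_univ]
    exact (measure_mono Set.sdiff_subset).trans_lt measure_ball_lt_top⟩
  have hE₁ : IntegrableOn e₁ (M₁ \ {0}) :=
    ((memLp_two_iff_integrable_energyDensity he₁).2 hEE₁).integrable (by norm_num)
  have hH₁ : IntegrableOn h₁ (M₁ \ {0}) :=
    ((memLp_two_iff_integrable_energyDensity hh₁).2 hEH₁).integrable (by norm_num)
  have hDt₁ : ∀ y ∈ N₁, cmul (materialTilde y) (Et y) = cmul (jac G₁ y).adjugate (e₁ (G₁ y)) :=
    fun y hy => by rw [hEt₁ y hy, cmul_materialTilde hy]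
  have hBt₁ : ∀ y ∈ N₁, cmul (materialTilde y) (Ht y) = cmul (jac G₁ y).adjugate (h₁ (G₁ y)) :=
    fun y hy => by rw [hHt₁ y hy, cmul_materialTilde hy]
  have hDt₂ : ∀ y ∈ N₂, cmul (materialTilde y) (Et y) = e₂ y :=
    fun y hy => by rw [hEt₂ hy, cmul_materialTilde_N₂ hy]
  have hBt₂ : ∀ y ∈ N₂, cmul (materialTilde y) (Ht y) = h₂ y :=
    fun y hy => by rw [hHt₂ hy, cmul_materialTilde_N₂ hy]
  have hPEC : ∀ {U : Set Space}, U ⊆ N \ cloakSurface → compactTests U ⊆ surfaceTestsPEC :=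
    fun hU => (compactTests_mono hU).trans compactTests_subset_surfaceTestsPEC
  have hF₁ : ∀ h ∈ compactTests M₁, ∫ x in M₁ \ {0},
      pairing h e₁ (fun x => (-(Complex.I * k)) • h₁ x) x = 0 := by
    refine integral_pairing_M₁ hE₁
      (integrableOn_inv_norm_mul_norm he₁ hEt₁ (hE.mono_set N₁_subset))
      (fun r _ => (IntegrableOn.mono_set hH₁ Set.inter_subset_right).smul (-(Complex.I * (k : ℂ))))
      ((forall_compactTests_N₁_iff (Bt := fun y => (-(Complex.I * k)) •
        cmul (materialTilde y) (Ht y)) hEt₁ fun y hy => by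
          rw [hBt₁ y hy, cmul_smul]).1 fun h hh => ?_)
    rw [← integral_pairing_of_subset measurableSet_N_diff N₁_subset hh.2.2]
    exact hF h (hPEC N₁_subset hh).1
  have hA₁ : ∀ h ∈ compactTests M₁, ∫ x in M₁ \ {0},
      pairing h h₁ (fun x => (Complex.I * k) • e₁ x - j₁ x) x = 0 := by
    refine integral_pairing_M₁ hH₁
      (integrableOn_inv_norm_mul_norm hh₁ hHt₁ (hH.mono_set N₁_subset))
      (fun r hr => ((IntegrableOn.mono_set hE₁ Set.inter_subset_right).smul
        (Complex.I * (k : ℂ))).sub (hji r hr))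
      ((forall_compactTests_N₁_iff (Bt := fun y => (Complex.I * k) •
        cmul (materialTilde y) (Et y) - Jt y) hHt₁ fun y hy => by
          rw [hDt₁ y hy, hJt₁ y hy, cmul_sub, cmul_smul]).1 fun h hh => ?_)
    rw [← integral_pairing_of_subset measurableSet_N_diff N₁_subset hh.2.2]
    exact hA h (hPEC N₁_subset hh)
  have hF₂ : ∀ h : Space → Fin 3 → ℝ, ContDiff ℝ ∞ h → ∫ x in M₂,
      pairing h e₂ (fun x => (-(Complex.I * k)) • h₂ x) x = 0 := by
    intro h hh
    rw [← hF _ (indicator_mem_surfaceTests hh), integral_pairing_indicator]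
    refine setIntegral_congr_fun m₂ fun y hy => ?_
    simp only [pairing, hBt₂ y hy, hEt₂ hy]
  refine ⟨⟨?_, ?_, ?_, ?_, ?_, ?_, ?_, ?_⟩, ⟨hE₂, hH₂, ?_, ?_, hEE₂, hEH₂, ?_, ?_⟩, ?_⟩
  · rwa [IntegrableOn, restrict_M₁_diff] at hE₁
  · rwa [IntegrableOn, restrict_M₁_diff] at hH₁
  · simp only [cmul_one]
    rwa [IntegrableOn, restrict_M₁_diff] at hE₁
  · simp only [cmul_one]
    rwa [IntegrableOn, restrict_M₁_diff] at hH₁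
  · rwa [IntegrableOn, restrict_M₁_diff] at hEE₁
  · rwa [IntegrableOn, restrict_M₁_diff] at hEH₁
  · simp only [cmul_one, faraday_integrand]
    rwa [restrict_M₁_diff] at hF₁
  · simp only [cmul_one]
    rwa [restrict_M₁_diff] at hA₁
  · simpa only [cmul_one] using hE₂
  · simpa only [cmul_one] using hH₂
  · simp only [cmul_one, faraday_integrand]
    exact fun h hh => hF₂ h hh.1
  · simp only [cmul_one]
    intro h hh
    rw [← hA h (hPEC N₂_subset hh)]
    refine Eq.trans ?_ (integral_pairing_of_subset measurableSet_N_diff N₂_subset hh.2.2 Ht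
      fun y => (Complex.I * k) • cmul (materialTilde y) (Et y) - Jt y).symm
    refine setIntegral_congr_fun m₂ fun y hy => ?_
    simp only [pairing, hDt₂ y hy, hHt₂ hy, hJt₂ hy]
  · have hH2 : MemLp h₂ 2 (volume.restrict M₂) :=
      (memLp_two_iff_integrable_energyDensity hH₂.1).2 hEH₂
    exact hasZeroTangentialTrace_of_integral_pairing hE₂
      (hH2.const_smul (-(Complex.I * (k : ℂ)))) hF₂

end

end Cloaking

theorem mainTheorem4 (k : ℝ) (hk : k ≠ 0)
    (J : Cloaking.Space ⊕ Cloaking.Space → Fin 3 → ℂ) (Jt : Cloaking.Space → Fin 3 → ℂ)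
    (hJ₁ : ContDiffOn ℝ ∞ (J ∘ Sum.inl) (Cloaking.M₁ \ {0}))
    (hJ₂ : ContDiffOn ℝ ∞ (J ∘ Sum.inr) Cloaking.M₂)
    (hJt : ContDiffOn ℝ ∞ Jt (Cloaking.N \ Cloaking.cloakSurface))
    (hJ_supp : (0 : Cloaking.Space) ∉
      closure {x | x ∈ Cloaking.M₁ \ {0} ∧ J (Sum.inl x) ≠ 0})
    (hJt_supp : Disjoint
      (closure {y | y ∈ Cloaking.N \ Cloaking.cloakSurface ∧ Jt y ≠ 0}) Cloaking.cloakSurface)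
    (hJJt : Set.EqOn Jt (Cloaking.pushTwoForm J) (Cloaking.N \ Cloaking.cloakSurface)) :
    (∀ (E H : Cloaking.Space ⊕ Cloaking.Space → Fin 3 → ℂ)
        (Et Ht : Cloaking.Space → Fin 3 → ℂ),
      Cloaking.MeasurableOnM E → Cloaking.MeasurableOnM H →
      AEStronglyMeasurable Et (volume.restrict (Cloaking.N \ Cloaking.cloakSurface)) →
      AEStronglyMeasurable Ht (volume.restrict (Cloaking.N \ Cloaking.cloakSurface)) →
      Set.EqOn Et (Cloaking.pushOneForm E) (Cloaking.N \ Cloaking.cloakSurface) →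
      Set.EqOn Ht (Cloaking.pushOneForm H) (Cloaking.N \ Cloaking.cloakSurface) →
      (Cloaking.IsSolutionN k Et Ht Jt ↔
        Cloaking.IsSolutionM₁ k (E ∘ Sum.inl) (H ∘ Sum.inl) (J ∘ Sum.inl) ∧
        Cloaking.IsSolutionM₂ k (E ∘ Sum.inr) (H ∘ Sum.inr) (J ∘ Sum.inr))) ∧
    (∀ Et : Cloaking.Space → Fin 3 → ℂ,
      AEStronglyMeasurable Et (volume.restrict (Cloaking.N \ Cloaking.cloakSurface)) →
      ∃ E : Cloaking.Space ⊕ Cloaking.Space → Fin 3 → ℂ, Cloaking.MeasurableOnM E ∧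
        Set.EqOn Et (Cloaking.pushOneForm E) (Cloaking.N \ Cloaking.cloakSurface) ∧
        ∀ E' : Cloaking.Space ⊕ Cloaking.Space → Fin 3 → ℂ,
          Set.EqOn Et (Cloaking.pushOneForm E') (Cloaking.N \ Cloaking.cloakSurface) →
          Set.EqOn E' E Cloaking.puncturedM) ∧
    (∀ E : Cloaking.Space ⊕ Cloaking.Space → Fin 3 → ℂ, Cloaking.MeasurableOnM E →
      AEStronglyMeasurable (Cloaking.pushOneForm E)
        (volume.restrict (Cloaking.N \ Cloaking.cloakSurface))) := by
  have hJtN : IsOpen (Cloaking.N \ Cloaking.cloakSurface) :=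
    Metric.isOpen_ball.sdiff Metric.isClosed_sphere
  have hJi : ∀ r < 2, IntegrableOn Jt
      (Metric.closedBall 0 r ∩ (Cloaking.N \ Cloaking.cloakSurface)) := fun r hr =>
    Cloaking.integrableOn_of_disjoint_closure hJtN (isCompact_closedBall 0 r) hJt.continuousOn
      fun x hx => ⟨Metric.closedBall_subset_ball hr hx.2, Set.disjoint_left.1 hJt_supp hx.1⟩
  have hji : ∀ r < 2, IntegrableOn (J ∘ Sum.inl)
      (Metric.closedBall 0 r ∩ (Cloaking.M₁ \ {0})) := fun r hr =>
    Cloaking.integrableOn_of_disjoint_closure Cloaking.isOpen_M₁_diff (isCompact_closedBall 0 r)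
      hJ₁.continuousOn fun x hx => ⟨Metric.closedBall_subset_ball hr hx.2, fun h0 =>
        hJ_supp ((Set.mem_singleton_iff.1 h0) ▸ hx.1)⟩
  have push₁ : ∀ {X : Cloaking.Space ⊕ Cloaking.Space → Fin 3 → ℂ} {Xt},
      Set.EqOn Xt (Cloaking.pushOneForm X) (Cloaking.N \ Cloaking.cloakSurface) →
      ∀ y ∈ Cloaking.N₁, Xt y =
        Cloaking.cmul (Cloaking.jac Cloaking.G₁ y)ᵀ ((X ∘ Sum.inl) (Cloaking.G₁ y)) :=
    fun hX y hy => by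
      rw [hX (Cloaking.N₁_subset hy), Cloaking.pushOneForm, if_pos hy, Function.comp_apply]
  have push₂ : ∀ {X : Cloaking.Space ⊕ Cloaking.Space → Fin 3 → ℂ} {Xt},
      Set.EqOn Xt (Cloaking.pushOneForm X) (Cloaking.N \ Cloaking.cloakSurface) →
      Set.EqOn Xt (X ∘ Sum.inr) Cloaking.N₂ :=
    fun hX y hy => by
      rw [hX (Cloaking.N₂_subset hy), Cloaking.pushOneForm, if_neg (Cloaking.not_mem_N₁ hy),
        Function.comp_apply]
  have hJt₁ : ∀ y ∈ Cloaking.N₁, Jt y =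
      Cloaking.cmul (Cloaking.jac Cloaking.G₁ y).adjugate ((J ∘ Sum.inl) (Cloaking.G₁ y)) :=
    fun y hy => by
      rw [hJJt (Cloaking.N₁_subset hy), Cloaking.pushTwoForm, if_pos hy, Function.comp_apply]
  have hJt₂ : Set.EqOn Jt (J ∘ Sum.inr) Cloaking.N₂ := fun y hy => by
    rw [hJJt (Cloaking.N₂_subset hy), Cloaking.pushTwoForm, if_neg (Cloaking.not_mem_N₁ hy),
      Function.comp_apply]
  refine ⟨fun E H Et Ht hE hH _ _ hEt hHt => ⟨fun hN => ?_, fun hM => ?_⟩,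
    fun Et hEt => Cloaking.exists_unique_pushOneForm hEt,
    fun E hE => Cloaking.aestronglyMeasurable_pushOneForm hE⟩
  · exact Cloaking.isSolutionM_of_isSolutionN hE.1 hH.1 (push₁ hEt) (push₂ hEt) (push₁ hHt)
      (push₂ hHt) hJt₁ hJt₂ hji hN
  · exact Cloaking.isSolutionN_of_isSolutionM hk (push₁ hEt) (push₂ hEt) (push₁ hHt)
      (push₂ hHt) hJt₁ hJt₂ hJ_supp hJi hM.1 hM.2
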